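/- **Setting.** Let $d\ge 1$ and $y=x^{T}\theta^*+\epsilon+s$ with $\theta^*\in\mathbb R^d$, where $x\in\mathbb R^d$, $\epsilon\in\mathbb R$, $s\in\mathbb R$ are independent, $\mathbb E[x]=0$, $\mathbb E[xx^T]=I_d$, $\mathbb P(\|x\|\ge t)\le 2e^{-t/\sigma_x}$ for all $t\ge 0$ (with $\sigma_x>0$), $\mathbb E|\epsilon|<\infty$, $\mathbb E[\epsilon]=0$ and $\mathbb E|s|<\infty$. Let $l:\mathbb R\to[0,\infty)$ be differentiable, with $l'$ non-decreasing, $l'(0)=0$, $|l'|\le a_l$, $|l'(t)-l'(t')|\le L_l|t-t'|$ for all $t,t'$, and $l'(t)-l'(t')\ge\mu_l(t-t')$ whenever $-\Delta_l\le t'\le t\le\Delta_l$, where $a_l,\mu_l,\Delta_l>0$ and $L_l\ge 0$. Let $\Delta_{\epsilon,s}<\Delta_l$ satisfy $\mathbb P(|\epsilon+s|\le\Delta_{\epsilon,s})>0$, and put $\tilde\eta=\mathbb P(|\epsilon+s|\ge\Delta_l)$. Given i.i.d. copies $(x_n,y_n)_{n\ge0}$ of $(x,y)$, a deterministic $\theta_0\in\mathbb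 R^d$ and stepsizes $\alpha_n$, let $$\theta_{n+1}=\theta_n+\alpha_n\,l'(y_n-x_n^T\theta_n)\,x_n,\qquad \hat\theta_n=\frac1n\sum_{t=0}^{n-1}\theta_t .$$ Let $\nabla f(\theta)=-\mathbb E[l'(y-x^T\theta)x]$, $w(\theta)=-\nabla f(\theta)-l'(y-x^T\theta)x$, $$\Delta=\frac{\Delta_l-\Delta_{\epsilon,s}}{\sigma_x\ln(8\,\mathbb E\|x\|^4)},\qquad \mu=\frac{\mu_l}{2}\mathbb P(|\epsilon+s|\le\Delta_{\epsilon,s}),$$ let $V_{1,0}(\theta)=e^{\|\theta-\theta^*\|/\Delta}-e/2$ if $\|\theta-\theta^*\|>\Delta$ and $V_{1,0}(\theta)=e\|\theta-\theta^*\|^2/(2\Delta^2)$ otherwise, and $V_{1,p}(\theta)=\|\theta-\theta^*\|^pV_{1,0}(\theta)$. **Claim.** There is $b>0$ with $\langle\theta-\theta^*,\nabla f(\theta)\rangle\ge b\|\theta-\theta^*\|$ whenever $\|\theta-\theta^*\|>\Delta$. Fix any such $b$ and put $\mu_{2p}=\min\{\tfrac{b}{2\Delta},\mu(1+p)\}$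 for $p\in\mathbb N=\{0,1,\dots\}$. Then $0<\mu_{2p}\le\mu_l(1-\tilde\eta)(1+p)$, and there are $c\in\mathbb R$, $\bar\alpha>0$ such that, with finite expectations, $$\mathbb E\big[V_{1,0}(\theta-\alpha(\nabla f(\theta)+w(\theta)))\big]\le(1-\alpha\mu_0)V_{1,0}(\theta)+\alpha^2c\qquad\text{for all }\theta\in\mathbb R^d,\ 0<\alpha\le\bar\alpha. \tag{$*$}$$ Moreover the following hold (all expectations on the left-hand sides being finite). 1. (Constant stepsize.) For every $p\in\mathbb N$ there are $\alpha_p>0$ and $D_p\in\mathbb R$ such that for $\alpha_n\equiv\alpha\in(0,\alpha_p]$, all $\theta_0\in\mathbb R^d$ and all $n\ge\frac{-p\ln\alpha}{\alpha\mu_0}$, $$\mathbb E\|\theta_n-\theta^*\|^{2p+2}\le\frac{2\Delta^2V_{1,2p}(\theta_0)}{e}(1-\alpha\mu_{2p})^n+\alpha^{p+1}D_p .$$ 2. Let $(c,\bar\alpha)$ with $\bar\alpha>0$ satisfy $(*)$. For every $\iota>1/\mu_0$ there is $\kappa_\iota>0$ such that for $\alpha_n=\frac{\iota}{n+\kappa}$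 with any $\kappa\ge\kappa_\iota$, all $n\ge0$ and all $\theta_0\in\mathbb R^d$, $$\mathbb E\|\theta_n-\theta^*\|^2\le\frac{2\Delta^2V_{1,0}(\theta_0)}{e}\Big(\frac{\kappa}{n+\kappa}\Big)^{\iota\mu_0}+\frac{8e\iota^2\Delta^2c}{(\iota\mu_0-1)e}\cdot\frac1{n+\kappa}.$$ 3. Let $(c,\bar\alpha)$ with $\bar\alpha>0$ satisfy $(*)$. For every $\xi\in(0,1)$ and $\iota>0$ there is $\kappa_{\iota,\xi}>0$ such that for $\alpha_n=\frac{\iota}{(n+\kappa)^\xi}$ with any $\kappa\ge\kappa_{\iota,\xi}$, all $n\ge0$ and all $\theta_0\in\mathbb R^d$, $$\mathbb E\|\theta_n-\theta^*\|^2\le\frac{2\Delta^2V_{1,0}(\theta_0)}{e}\exp\Big(-\frac{\mu_0\iota}{1-\xi}\big((n+\kappa)^{1-\xi}-\kappa^{1-\xi}\big)\Big)+\frac{4\iota\Delta^2c}{\mu_0e}\cdot\frac1{(n+\kappa)^\xi}.$$ 4. (Averaged iterates.) Suppose that $l$ is twice differentiable and that $u\mapsto\mathbb E[l''(\epsilon+s+u)]$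 is Lipschitz at $0$, i.e. $|\mathbb E[l''(\epsilon+s+u)]-\mathbb E[l''(\epsilon+s)]|\le K|u|$ for some $K$ and all $u\in\mathbb R$ (automatic if $l''$ is Lipschitz). Then $\mathbb E[l''(\epsilon+s)]>0$, and for every $\xi\in[1/2,1)$, $\iota>0$, $\theta_0\in\mathbb R^d$ there is $C$ such that, if the $k$-th update ($k=1,2,\dots$) uses the stepsize $\iota/k^\xi$, then for all $n\ge1$ $$\mathbb E\|\hat\theta_n-\theta^*\|^2\le\frac{d\,\mathbb E[l'(\epsilon+s)^2]}{n\,\mathbb E[l''(\epsilon+s)]^2}+\frac{C}{n^{(\xi+1/2)\wedge(2-\xi)}} .$$ The leading term is the Cramér–Rao type bound of regression with the loss $l$ and sample size $n$: it equals $\frac1n\operatorname{Tr}(H^{-1}SH^{-1})$, where $H$ is the Jacobian matrix of $\nabla f$ at $\theta^*$ and $S=\mathbb E[w(\theta^*)w(\theta^*)^T]$. -/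

import Mathlib

open MeasureTheory ProbabilityTheory

noncomputable section

namespace RobustReg

/-- `ℝ^d` with its Euclidean norm. -/
abbrev Vec (d : ℕ) : Type := EuclideanSpace ℝ (Fin d)

/-- The data of a robust linear regression problem: the population variables `x, ε, s` on a
measure space `(Ω₀, P)`, the true parameter, the loss function, and the constants that occur in the
assumptions. The properties these objects have to satisfy are collected in `Model.Assumptions`. -/
structure Model (d : ℕ) (Ω₀ : Type*) [MeasurableSpace Ω₀] where
  P : Measure Ω₀
  /-- the covariate -/
  x : Ω₀ → Vec d
  /-- the noise -/
  ε : Ω₀ → ℝ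
  /-- the corruption -/
  s : Ω₀ → ℝ
  /-- the true parameter -/
  θstar : Vec d
  /-- the loss function; `l'` is `deriv l` and `l''` is `deriv (deriv l)` -/
  l : ℝ → ℝ
  /-- sub-exponential parameter of `‖x‖` -/
  σx : ℝ
  /-- Lipschitz constant of `l'` -/
  Ll : ℝ
  /-- bound on `|l'|` -/
  al : ℝ
  /-- radius of the interval on which `l` is strongly convex -/
  Δl : ℝ
  /-- strong convexity constant of `l` on `[-Δl, Δl]` -/
  μl : ℝ
  /-- a radius below `Δl` such that `|ε + s| ≤ Δεs` has positive probability -/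
  Δεs : ℝ

variable {d : ℕ} {Ω₀ : Type*} [MeasurableSpace Ω₀]

/-- Assumptions on the covariate, the noise and the corruption. -/
structure Model.DataAssumption (M : Model d Ω₀) : Prop where
  isProb : IsProbabilityMeasure M.P
  aemeasurable_x : AEMeasurable M.x M.P
  /-- `x, ε, s` are mutually independent: `x` of the pair `(ε, s)`, and `ε` of `s`. -/
  indep_x : IndepFun M.x (fun ω => (M.ε ω, M.s ω)) M.P
  indep_ε : IndepFun M.ε M.s M.P
  mean_x : ∫ ω, M.x ω ∂M.P = 0
  isotropic : ∀ i j : Fin d, ∫ ω, M.x ω i * M.x ω j ∂M.P = if i = j then 1 else 0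
  σx_pos : 0 < M.σx
  subexp_x : ∀ t : ℝ, 0 ≤ t → M.P.real {ω | t ≤ ‖M.x ω‖} ≤ 2 * Real.exp (-t / M.σx)
  integrable_ε : Integrable M.ε M.P
  mean_ε : ∫ ω, M.ε ω ∂M.P = 0
  integrable_s : Integrable M.s M.P

/-- Assumptions on the loss function. -/
structure Model.LossAssumption (M : Model d Ω₀) : Prop where
  nonneg : ∀ t, 0 ≤ M.l t
  differentiable : Differentiable ℝ M.l
  Ll_nonneg : 0 ≤ M.Ll
  lipschitz : ∀ t t' : ℝ, |deriv M.l t - deriv M.l t'| ≤ M.Ll * |t - t'|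
  mono : Monotone (deriv M.l)
  deriv_zero : deriv M.l 0 = 0
  al_pos : 0 < M.al
  bounded : ∀ t, |deriv M.l t| ≤ M.al
  Δl_pos : 0 < M.Δl
  μl_pos : 0 < M.μl
  strong : ∀ t t' : ℝ, |t| ≤ M.Δl → |t'| ≤ M.Δl → t' ≤ t →
    M.μl * (t - t') ≤ deriv M.l t - deriv M.l t'

/-- All standing assumptions; the last two say that the corrupted noise `ε + s` charges the
strongly convex region of the loss. -/
structure Model.Assumptions (M : Model d Ω₀) : Prop where
  data : M.DataAssumption
  loss : M.LossAssumption
  Δεs_lt : M.Δεs < M.Δl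
  prob_pos : 0 < M.P.real {ω | |M.ε ω + M.s ω| ≤ M.Δεs}

/-- The response `y = xᵀθ* + ε + s`. -/
def Model.y (M : Model d Ω₀) (ω : Ω₀) : ℝ :=
  inner ℝ (M.x ω) M.θstar + M.ε ω + M.s ω

/-- The population gradient `∇f(θ) = -E[l'(y - xᵀθ) x]`. -/
def Model.grad (M : Model d Ω₀) (θ : Vec d) : Vec d :=
  -∫ ω, deriv M.l (M.y ω - inner ℝ (M.x ω) θ) • M.x ω ∂M.P

/-- The gradient noise `w(θ) = -∇f(θ) - l'(y - xᵀθ) x`. -/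
def Model.noise (M : Model d Ω₀) (θ : Vec d) (ω : Ω₀) : Vec d :=
  -M.grad θ - deriv M.l (M.y ω - inner ℝ (M.x ω) θ) • M.x ω

/-- The effective outlier proportion `η̃ = P(|ε + s| ≥ Δ_l)`. -/
def Model.outlier (M : Model d Ω₀) : ℝ :=
  M.P.real {ω | M.Δl ≤ |M.ε ω + M.s ω|}

/-- `E[l'(ε + s)²]`. -/
def Model.meanSqDeriv (M : Model d Ω₀) : ℝ :=
  ∫ ω, (deriv M.l (M.ε ω + M.s ω)) ^ 2 ∂M.P

/-- `E[l''(ε + s + u)]`. -/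
def Model.meanDeriv2 (M : Model d Ω₀) (u : ℝ) : ℝ :=
  ∫ ω, deriv (deriv M.l) (M.ε ω + M.s ω + u) ∂M.P

/-- The radius `Δ = (Δ_l - Δ_{ε,s}) / (σ_x ln(8 E‖x‖⁴))`. -/
def Model.Δ (M : Model d Ω₀) : ℝ :=
  (M.Δl - M.Δεs) / (M.σx * Real.log (8 * ∫ ω, ‖M.x ω‖ ^ 4 ∂M.P))

/-- The local strong convexity constant `μ = (μ_l / 2) P(|ε + s| ≤ Δ_{ε,s})` of the population
loss. -/
def Model.μ (M : Model d Ω₀) : ℝ :=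
  M.μl / 2 * M.P.real {ω | |M.ε ω + M.s ω| ≤ M.Δεs}

/-- `b` is a linear growth constant of the population loss outside the ball of radius `Δ`:
`⟨θ - θ*, ∇f(θ)⟩ ≥ b ‖θ - θ*‖` whenever `‖θ - θ*‖ > Δ`. -/
def Model.TailConst (M : Model d Ω₀) (b : ℝ) : Prop :=
  ∀ θ : Vec d, M.Δ < ‖θ - M.θstar‖ →
    b * ‖θ - M.θstar‖ ≤ inner ℝ (θ - M.θstar) (M.grad θ)

/-- The rate `μ_{2p} = min(b / (2Δ), μ (1 + p))`. -/
def Model.rate (M : Model d Ω₀) (b : ℝ) (p : ℕ) : ℝ :=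
  min (b / (2 * M.Δ)) (M.μ * (1 + p))

/-- The piecewise Lyapunov function `V_{1,p}(θ) = ‖θ - θ*‖^p V_{1,0}(θ)`, where `V_{1,0}(θ)` is
`exp(‖θ - θ*‖ / Δ) - e / 2` if `‖θ - θ*‖ > Δ`, and `e ‖θ - θ*‖² / (2 Δ²)` otherwise. -/
def Model.V (M : Model d Ω₀) (p : ℕ) (θ : Vec d) : ℝ :=
  ‖θ - M.θstar‖ ^ p *
    (if M.Δ < ‖θ - M.θstar‖ then Real.exp (‖θ - M.θstar‖ / M.Δ) - Real.exp 1 / 2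
      else Real.exp 1 * ‖θ - M.θstar‖ ^ 2 / (2 * M.Δ ^ 2))

/-- One-step drift inequality with constant `c` for stepsizes up to `α₀`:
`E[V_{1,0}(θ - α (∇f(θ) + w(θ)))] ≤ (1 - α μ₀) V_{1,0}(θ) + α² c` for all `θ` and
`0 < α ≤ α₀` (the expectation being finite). -/
def Model.Drift (M : Model d Ω₀) (b c α₀ : ℝ) : Prop :=
  ∀ (θ : Vec d) (α : ℝ), 0 < α → α ≤ α₀ →
    Integrable (fun ω => M.V 0 (θ - α • (M.grad θ + M.noise θ ω))) M.P ∧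
    ∫ ω, M.V 0 (θ - α • (M.grad θ + M.noise θ ω)) ∂M.P
      ≤ (1 - α * M.rate b 0) * M.V 0 θ + α ^ 2 * c

/-- The Hessian of the population loss at `θ*`, the Jacobian matrix of `∇f` there. -/
def Model.hessian (M : Model d Ω₀) : Matrix (Fin d) (Fin d) ℝ :=
  Matrix.of fun i j => (fderiv ℝ M.grad M.θstar (EuclideanSpace.single j 1)) i

/-- The covariance matrix `E[w(θ*) w(θ*)ᵀ]` of the gradient noise at `θ*`. -/
def Model.noiseCov (M : Model d Ω₀) : Matrix (Fin d) (Fin d) ℝ :=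
  Matrix.of fun i j => ∫ ω, M.noise M.θstar ω i * M.noise M.θstar ω j ∂M.P

/-- The Cramér-Rao type bound with sample size `n` for the loss `l`: the trace of the sandwich
matrix `H⁻¹ S H⁻¹`, divided by `n`, with `H` the Hessian and `S` the noise covariance at `θ*`. -/
def Model.crlb (M : Model d Ω₀) (n : ℕ) : ℝ :=
  (M.hessian⁻¹ * M.noiseCov * M.hessian⁻¹).trace / n

/-- `(X_n, Y_n)` is an i.i.d. sequence of copies of the population pair `(x, y)`. -/
structure Model.IsSample (M : Model d Ω₀) {Ω : Type*} [MeasurableSpace Ω] (Q : Measure Ω)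
    (X : ℕ → Ω → Vec d) (Y : ℕ → Ω → ℝ) : Prop where
  indep : iIndepFun (fun n ω => (X n ω, Y n ω)) Q
  ident : ∀ n, IdentDistrib (fun ω => (X n ω, Y n ω)) (fun ω => (M.x ω, M.y ω)) Q M.P

/-- The online update `θ_{n+1} = θ_n + α_n l'(Y_n - X_nᵀ θ_n) X_n` started at `θ₀`. -/
def iter {d : ℕ} {Ω : Type*} (l : ℝ → ℝ) (α : ℕ → ℝ) (X : ℕ → Ω → Vec d) (Y : ℕ → Ω → ℝ)
    (θ₀ : Vec d) : ℕ → Ω → Vec d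
  | 0, _ => θ₀
  | n + 1, ω =>
      iter l α X Y θ₀ n ω +
        (α n * deriv l (Y n ω - inner ℝ (X n ω) (iter l α X Y θ₀ n ω))) • X n ω

/-- The averaged iterate `(1/n) ∑_{t=0}^{n-1} θ_t`. -/
def avg {d : ℕ} {Ω : Type*} (l : ℝ → ℝ) (α : ℕ → ℝ) (X : ℕ → Ω → Vec d) (Y : ℕ → Ω → ℝ)
    (θ₀ : Vec d) (n : ℕ) (ω : Ω) : Vec d :=
  (1 / (n : ℝ)) • ∑ t ∈ Finset.range n, iter l α X Y θ₀ t ω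

/-- `E[Z] ≤ B`, including that the expectation is finite. -/
def MeanLE {Ω : Type*} [MeasurableSpace Ω] (Q : Measure Ω) (Z : Ω → ℝ) (B : ℝ) : Prop :=
  Integrable Z Q ∧ ∫ ω, Z ω ∂Q ≤ B

end RobustReg

end

/-! The update is a stochastic gradient step for the convex loss `f`, with increments of size at
most `α * al * ‖x‖`. Because `l'` is bounded, `∇f` grows only linearly against `θ - θ*` far away, so
the squared distance is a poor Lyapunov function there. The function `V` is quadratic near `θ*`,
where `∇f` is strongly monotone, and exponential outside, where a linear lower bound on `⟨θ - θ*,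
∇f⟩` already contracts `exp (‖θ - θ*‖ / Δ)`; exponential moments of `‖x‖` keep its expectation
finite after a short step.

Growth of `∇f` (`inner_grad_ge_sq`, `exists_tailConst`): with probability bounded below, the
residuals at `θ*` and at `θ` both lie in the region of strong convexity of `l`. This gives `μ * r ^
2` for `r = ‖θ - θ*‖ ≤ Δ`, and monotonicity of `l'` along rays extends it to linear growth outside.

Drift (`exists_drift`): a second-order expansion of the radial function `V` (`radial_le`) gives a
negative first-order term and a remainder of order `α ^ 2`. Half of the first-order term absorbs the
part of the remainder that is comparable with `V`; what is left has size `α ^ (p + 2)`. Since each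
iterate is independent of the next sample, the drift becomes a scalar recursion for `E[V]`. Constant
stepsizes yield a geometric sum; for decreasing stepsizes, `harmonic_step` and `polynomial_step`
verify that the claimed bounds are supersolutions. As `V` dominates a multiple of `r ^ (q + 2)`,
moments follow.

Averaging: smoothing by the noise gives `∇f(θ) = h (θ - θ*) + O(r ^ 2)` with `h = E[l''(ε + s)]`,
isotropy making the Hessian a multiple of the identity. In `L²` the error `v` therefore satisfies a
linear recursion with orthogonal noise (`LinearRecursion`). Solving it for `h • v k` and summing
leaves a weighted telescoping sum, a sum of quadratic remainders controlled by fourth moments, and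
the noise sum, whose squared norm is the leading term. The sharp exponent depends on the cross term
between noise and telescoping sum, where orthogonality replaces Cauchy–Schwarz
(`exists_inner_bound`, `inner_noise_telescope`). -/

namespace RobustReg

/-! ### Calculus of the radial Lyapunov function. -/

section Analysis

theorem hasDerivAt_ite_lt {f g f' g' : ℝ → ℝ} {D : ℝ} (hf : ∀ t, HasDerivAt f (f' t) t)
    (hg : ∀ t, HasDerivAt g (g' t) t) (h : f D = g D) (h' : f' D = g' D) (t : ℝ) :
    HasDerivAt (fun t => if D < t then f t else g t) (if D < t then f' t else g' t) t := by
  rcases lt_trichotomy t D with ht | rfl | ht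
  · rw [if_neg ht.not_gt]
    refine (hg t).congr_of_eventuallyEq ?_
    filter_upwards [eventually_lt_nhds ht] with s hs
    rw [if_neg hs.not_gt]
  · rw [if_neg (lt_irrefl t)]
    have h1 : HasDerivWithinAt (fun s => if t < s then f s else g s) (g' t) (Set.Iic t) t := by
      refine (hg t).hasDerivWithinAt.congr (fun s hs => ?_) (by simp)
      rw [if_neg (not_lt.2 hs)]
    have h2 : HasDerivWithinAt (fun s => if t < s then f s else g s) (g' t) (Set.Ici t) t := by
      rw [← h']
      refine (hf t).hasDerivWithinAt.congr (fun s hs => ?_) (by simp [h])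
      rcases (Set.mem_Ici.1 hs).eq_or_lt with rfl | hs
      · simp [h]
      · rw [if_pos hs]
    have := h1.union h2
    rwa [Set.Iic_union_Ici, hasDerivWithinAt_univ] at this
  · rw [if_pos ht]
    refine (hf t).congr_of_eventuallyEq ?_
    filter_upwards [eventually_gt_nhds ht] with s hs
    rw [if_pos hs]

/-- The radial profile of `V_{1,0}` with radius `D`. -/
noncomputable def profile (D t : ℝ) : ℝ :=
  if D < t then Real.exp (t / D) - Real.exp 1 / 2 else Real.exp 1 * t ^ 2 / (2 * D ^ 2)

/-- The derivative of `profile`. -/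
noncomputable def profile' (D t : ℝ) : ℝ :=
  if D < t then Real.exp (t / D) / D else Real.exp 1 * t / D ^ 2

/-- The second derivative of `profile`. -/
noncomputable def profile'' (D t : ℝ) : ℝ :=
  if D < t then Real.exp (t / D) / D ^ 2 else Real.exp 1 / D ^ 2

variable {D : ℝ}

theorem hasDerivAt_profile (hD : 0 < D) (t : ℝ) : HasDerivAt (profile D) (profile' D t) t := by
  unfold profile profile'
  refine hasDerivAt_ite_lt (f' := fun t => Real.exp (t / D) / D)
    (g' := fun t => Real.exp 1 * t / D ^ 2) (fun t => ?_) (fun t => ?_) ?_ ?_ t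
  · refine ((((hasDerivAt_id' t).div_const D).exp).sub_const (Real.exp 1 / 2)).congr_deriv ?_
    ring
  · refine (((hasDerivAt_pow 2 t).const_mul (Real.exp 1)).div_const (2 * D ^ 2)).congr_deriv ?_
    field_simp
    norm_num
  · field_simp; ring
  · field_simp

theorem hasDerivAt_profile' (hD : 0 < D) (t : ℝ) :
    HasDerivAt (profile' D) (profile'' D t) t := by
  unfold profile' profile''
  refine hasDerivAt_ite_lt (f' := fun t => Real.exp (t / D) / D ^ 2)
    (g' := fun t => Real.exp 1 / D ^ 2) (fun t => ?_) (fun t => ?_) ?_ ?_ t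
  · refine ((((hasDerivAt_id' t).div_const D).exp).div_const D).congr_deriv ?_
    field_simp
  · refine (((hasDerivAt_id' t).const_mul (Real.exp 1)).div_const (D ^ 2)).congr_deriv ?_
    ring
  · field_simp
  · simp [hD.ne']

theorem exp_one_le_exp_div (hD : 0 < D) {t : ℝ} (ht : D < t) :
    Real.exp 1 ≤ Real.exp (t / D) :=
  Real.exp_le_exp.2 ((one_le_div hD).2 ht.le)

/-- A single majorant `E = e * exp (t / D) / D ^ 2` serves both branches and all orders: it bounds
the second derivative, `t * E` the first and `t ^ 2 * E` the function. Multiplying by powers of `t`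
then costs only a constant in `lyap''_le`. -/
theorem profile''_le (hD : 0 < D) {t : ℝ} (ht : 0 ≤ t) :
    profile'' D t ≤ Real.exp 1 * Real.exp (t / D) / D ^ 2 := by
  unfold profile''
  have h1 : 1 ≤ Real.exp 1 := Real.one_le_exp (by norm_num)
  have h2 : 1 ≤ Real.exp (t / D) := Real.one_le_exp (by positivity)
  split_ifs <;> gcongr <;> nlinarith

theorem profile'_nonneg (hD : 0 < D) {t : ℝ} (ht : 0 ≤ t) : 0 ≤ profile' D t := by
  unfold profile'
  split_ifs <;> positivity

theorem profile'_le (hD : 0 < D) {t : ℝ} (ht : 0 ≤ t) :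
    profile' D t ≤ t * (Real.exp 1 * Real.exp (t / D) / D ^ 2) := by
  unfold profile'
  have h1 : 1 ≤ Real.exp 1 := Real.one_le_exp (by norm_num)
  have h2 : 1 ≤ Real.exp (t / D) := Real.one_le_exp (by positivity)
  split_ifs with h
  · rw [← mul_div_assoc, div_le_div_iff₀ hD (by positivity)]
    have : Real.exp (t / D) * D ≤ Real.exp (t / D) * t := by gcongr
    have h3 : Real.exp (t / D) * t ≤ Real.exp 1 * (Real.exp (t / D) * t) :=
      le_mul_of_one_le_left (by positivity) h1
    nlinarith
  · rw [← mul_div_assoc]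
    refine div_le_div_of_nonneg_right ?_ (by positivity)
    have := mul_nonneg (mul_nonneg ht (Real.exp_pos 1).le) (sub_nonneg.2 h2)
    nlinarith

/-- For `u = t / D ≥ 1` one has `exp (u - 1) ≥ 1 + (u - 1) + (u - 1) ^ 2 / 2 = (1 + u ^ 2) / 2`, and
the constant half pays exactly for the subtracted `e / 2`. This lower bound turns estimates of `V`
into moment estimates. -/
theorem profile_quad_le (hD : 0 < D) (t : ℝ) :
    Real.exp 1 * t ^ 2 / (2 * D ^ 2) ≤ profile D t := by
  unfold profile
  split_ifs with h
  · have h1 : 1 ≤ t / D := (one_le_div hD).2 h.le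
    have h3 : Real.exp (t / D) = Real.exp 1 * Real.exp (t / D - 1) := by
      rw [← Real.exp_add]; ring_nf
    have h4 := Real.quadratic_le_exp_of_nonneg (sub_nonneg.2 h1)
    have h5 : Real.exp 1 * t ^ 2 / (2 * D ^ 2) = Real.exp 1 * ((t / D) ^ 2 / 2) := by
      field_simp
    rw [h3, h5]
    nlinarith [mul_le_mul_of_nonneg_left h4 (Real.exp_pos 1).le]
  · rfl

theorem profile_nonneg (hD : 0 < D) {t : ℝ} (ht : 0 ≤ t) : 0 ≤ profile D t :=
  le_trans (by positivity) (profile_quad_le hD t)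

theorem profile_le (hD : 0 < D) {t : ℝ} (ht : 0 ≤ t) :
    profile D t ≤ t ^ 2 * (Real.exp 1 * Real.exp (t / D) / D ^ 2) := by
  unfold profile
  have h1 : 1 ≤ Real.exp 1 := Real.one_le_exp (by norm_num)
  have h2 : 1 ≤ Real.exp (t / D) := Real.one_le_exp (by positivity)
  split_ifs with h
  · have h3 : 1 ≤ t ^ 2 / D ^ 2 := by
      rw [one_le_div (by positivity)]
      gcongr
    have h4 : t ^ 2 * (Real.exp 1 * Real.exp (t / D) / D ^ 2)
        = (t ^ 2 / D ^ 2) * (Real.exp 1 * Real.exp (t / D)) := by ring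
    have h5 : Real.exp (t / D) ≤ Real.exp 1 * Real.exp (t / D) :=
      le_mul_of_one_le_left (by positivity) h1
    have h6 : Real.exp 1 * Real.exp (t / D) ≤ (t ^ 2 / D ^ 2) * (Real.exp 1 * Real.exp (t / D)) :=
      le_mul_of_one_le_left (by positivity) h3
    rw [h4]
    linarith [Real.exp_pos 1]
  · rw [← mul_div_assoc]
    have h7 : Real.exp 1 * t ^ 2 / (2 * D ^ 2) ≤ Real.exp 1 * t ^ 2 / D ^ 2 := by
      gcongr
      nlinarith [sq_nonneg D]
    refine h7.trans (div_le_div_of_nonneg_right ?_ (by positivity))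
    have := mul_nonneg (mul_nonneg (sq_nonneg t) (Real.exp_pos 1).le) (sub_nonneg.2 h2)
    nlinarith

/-- The radial profile of `V_{1,q}` with radius `D`. -/
noncomputable def lyap (D : ℝ) (q : ℕ) (t : ℝ) : ℝ := t ^ q * profile D t

/-- The derivative of `lyap`. -/
noncomputable def lyap' (D : ℝ) (q : ℕ) (t : ℝ) : ℝ := q * t ^ (q - 1) * profile D t + t ^ q * profile' D t

/-- The second derivative of `lyap`. -/
noncomputable def lyap'' (D : ℝ) (q : ℕ) (t : ℝ) : ℝ :=
  (q * ((q - 1 : ℕ) * t ^ (q - 1 - 1)) * profile D t + q * t ^ (q - 1) * profile' D t) +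
    (q * t ^ (q - 1) * profile' D t + t ^ q * profile'' D t)

theorem hasDerivAt_lyap (hD : 0 < D) (q : ℕ) (t : ℝ) :
    HasDerivAt (lyap D q) (lyap' D q t) t :=
  (hasDerivAt_pow q t).mul (hasDerivAt_profile hD t)

theorem hasDerivAt_lyap' (hD : 0 < D) (q : ℕ) (t : ℝ) :
    HasDerivAt (lyap' D q) (lyap'' D q t) t :=
  (((hasDerivAt_pow (q - 1) t).const_mul (q : ℝ)).mul (hasDerivAt_profile hD t)).add
    ((hasDerivAt_pow q t).mul (hasDerivAt_profile' hD t))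

theorem lyap''_le (hD : 0 < D) (q : ℕ) {t : ℝ} (ht : 0 ≤ t) :
    lyap'' D q t ≤ (q + 1) ^ 2 * t ^ q * (Real.exp 1 * Real.exp (t / D) / D ^ 2) := by
  set E := Real.exp 1 * Real.exp (t / D) / D ^ 2 with hE
  have hE0 : 0 ≤ E := by positivity
  have h0 : profile D t ≤ t ^ 2 * E := profile_le hD ht
  have h1 : profile' D t ≤ t * E := profile'_le hD ht
  have h2 : profile'' D t ≤ E := profile''_le hD ht
  have key : lyap'' D q t ≤
      (q * ((q - 1 : ℕ) * t ^ (q - 1 - 1)) * (t ^ 2 * E) + q * t ^ (q - 1) * (t * E)) +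
        (q * t ^ (q - 1) * (t * E) + t ^ q * E) := by
    unfold lyap''
    gcongr
  refine key.trans ?_
  -- The exponents `q - 1` and `q - 1 - 1` are truncated, so `q = 0` and `q = 1` are separate cases.
  -- Beyond them the coefficients add up to `q * (q - 1) + 2 * q + 1 ≤ (q + 1) ^ 2`.
  rcases q with _ | _ | q
  · simp
  · simp; nlinarith [mul_nonneg ht hE0]
  · have : 0 ≤ t ^ (q + 1 + 1) * E := by positivity
    have h3 : (0 : ℝ) ≤ q := q.cast_nonneg
    simp only [Nat.add_sub_cancel]
    push_cast
    have e : ((q : ℝ) + 1 + 1) * (((q : ℝ) + 1) * t ^ q) * (t ^ 2 * E)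
        + ((q : ℝ) + 1 + 1) * t ^ (q + 1) * (t * E)
        + (((q : ℝ) + 1 + 1) * t ^ (q + 1) * (t * E) + t ^ (q + 1 + 1) * E)
        = (((q : ℝ) + 2) * (q + 1) + 2 * (q + 2) + 1) * (t ^ (q + 1 + 1) * E) := by ring
    rw [e, mul_assoc]
    gcongr
    nlinarith

theorem lyap'_zero (q : ℕ) (hD : 0 < D) : lyap' D q 0 = 0 := by
  simp [lyap', profile, profile', hD.not_gt]

theorem lyap_nonneg (hD : 0 < D) (q : ℕ) {t : ℝ} (ht : 0 ≤ t) : 0 ≤ lyap D q t :=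
  mul_nonneg (pow_nonneg ht q) (profile_nonneg hD ht)

theorem pow_le_lyap (hD : 0 < D) (q : ℕ) {t : ℝ} (ht : 0 ≤ t) :
    t ^ (q + 2) ≤ 2 * D ^ 2 * lyap D q t / Real.exp 1 := by
  rw [le_div_iff₀ (Real.exp_pos 1)]
  have := mul_le_mul_of_nonneg_left (profile_quad_le hD t) (pow_nonneg ht q)
  unfold lyap
  have e : t ^ q * (Real.exp 1 * t ^ 2 / (2 * D ^ 2)) * (2 * D ^ 2) = t ^ (q + 2) * Real.exp 1 := by
    field_simp; ring
  nlinarith [mul_le_mul_of_nonneg_right this (show 0 ≤ 2 * D ^ 2 by positivity)]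

theorem lyap_of_le (q : ℕ) {t : ℝ} (h : t ≤ D) :
    lyap D q t = Real.exp 1 * t ^ (q + 2) / (2 * D ^ 2) := by
  rw [lyap, profile, if_neg h.not_gt]; ring

theorem lyap_le_of_lt (hD : 0 < D) (q : ℕ) {t : ℝ} (h : D < t) :
    lyap D q t ≤ t ^ q * Real.exp (t / D) := by
  rw [lyap, profile, if_pos h]
  have : 0 ≤ t := (hD.trans h).le
  gcongr
  linarith [Real.exp_pos 1]

theorem le_lyap_of_lt (hD : 0 < D) (q : ℕ) {t : ℝ} (h : D < t) :
    t ^ q * Real.exp (t / D) ≤ 2 * lyap D q t := by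
  rw [lyap, profile, if_pos h]
  have h0 : 0 ≤ t := (hD.trans h).le
  have := mul_le_mul_of_nonneg_left (exp_one_le_exp_div hD h) (pow_nonneg h0 q)
  nlinarith

theorem lyap'_of_le (q : ℕ) {t : ℝ} (h : t ≤ D) (hD : 0 < D) :
    lyap' D q t = (q + 2) * Real.exp 1 * t ^ (q + 1) / (2 * D ^ 2) := by
  rw [lyap', profile, profile', if_neg h.not_gt, if_neg h.not_gt]
  rcases q with _ | q
  · simp; field_simp
  · simp only [Nat.add_sub_cancel]; push_cast; field_simp; ring

theorem le_lyap'_of_lt (hD : 0 < D) (q : ℕ) {t : ℝ} (h : D < t) :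
    t ^ q * Real.exp (t / D) / D ≤ lyap' D q t := by
  have h0 : 0 ≤ t := (hD.trans h).le
  have := profile_nonneg hD h0
  have e : profile' D t = Real.exp (t / D) / D := by rw [profile', if_pos h]
  rw [lyap', e, mul_div_assoc]
  have : 0 ≤ q * t ^ (q - 1) * profile D t := by positivity
  linarith

theorem continuous_lyap (hD : 0 < D) (q : ℕ) : Continuous (lyap D q) :=
  continuous_iff_continuousAt.2 fun t => (hasDerivAt_lyap hD q t).continuousAt

/-- Only an upper bound on `φ''` is available. It makes `N * t - φ' t` monotone, so the difference
between the quadratic and `φ` decreases before `r` and increases after it, with value zero at `r`.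
-/
theorem le_quadratic_of_deriv2_le {φ φ' φ'' : ℝ → ℝ} {R N : ℝ}
    (h1 : ∀ t, HasDerivAt φ (φ' t) t) (h2 : ∀ t, HasDerivAt φ' (φ'' t) t)
    (h3 : ∀ t, 0 ≤ t → t ≤ R → φ'' t ≤ N) {r ρ : ℝ} (hr : r ∈ Set.Icc 0 R)
    (hρ : ρ ∈ Set.Icc 0 R) :
    (r ≤ ρ → φ' ρ - φ' r ≤ N * (ρ - r)) ∧
      φ ρ ≤ φ r + φ' r * (ρ - r) + N / 2 * (ρ - r) ^ 2 := by
  have hmono : MonotoneOn (fun t => N * t - φ' t) (Set.Icc 0 R) := by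
    refine monotoneOn_of_hasDerivWithinAt_nonneg (f' := fun t => N - φ'' t) (convex_Icc 0 R)
      (fun t _ => (((continuous_const.mul continuous_id).continuousAt).sub
        (h2 t).continuousAt).continuousWithinAt) (fun t _ => ?_) (fun t ht => ?_)
    · exact ((((hasDerivAt_id' t).const_mul N).sub (h2 t)).congr_deriv
        (by ring)).hasDerivWithinAt
    · rw [interior_Icc] at ht
      exact sub_nonneg.2 (h3 t ht.1.le ht.2.le)
  have hd : ∀ t, HasDerivAt (fun t => φ r + φ' r * (t - r) + N / 2 * (t - r) ^ 2 - φ t)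
      (φ' r + N * (t - r) - φ' t) t := fun t => by
    refine ((((((hasDerivAt_id' t).sub_const r).const_mul (φ' r)).const_add (φ r)).add
      ((((hasDerivAt_id' t).sub_const r).pow 2).const_mul (N / 2))).sub (h1 t)).congr_deriv ?_
    simp; ring
  have hc : Continuous (fun t => φ r + φ' r * (t - r) + N / 2 * (t - r) ^ 2 - φ t) :=
    continuous_iff_continuousAt.2 fun t => (hd t).continuousAt
  refine ⟨fun h => ?_, ?_⟩
  · have := hmono hr hρ h
    simp only at this
    linarith
  rcases le_total r ρ with h | h
  · have hm : MonotoneOn (fun t => φ r + φ' r * (t - r) + N / 2 * (t - r) ^ 2 - φ t)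
        (Set.Icc r ρ) := by
      refine monotoneOn_of_hasDerivWithinAt_nonneg (convex_Icc r ρ) hc.continuousOn
        (fun t _ => (hd t).hasDerivWithinAt) (fun t ht => ?_)
      rw [interior_Icc] at ht
      have := hmono hr ⟨hr.1.trans ht.1.le, ht.2.le.trans hρ.2⟩ ht.1.le
      simp only at this
      linarith
    have := hm ⟨le_refl r, h⟩ ⟨h, le_refl ρ⟩ h
    simp at this
    linarith
  · have hm : AntitoneOn (fun t => φ r + φ' r * (t - r) + N / 2 * (t - r) ^ 2 - φ t)
        (Set.Icc ρ r) := by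
      refine antitoneOn_of_hasDerivWithinAt_nonpos (convex_Icc ρ r) hc.continuousOn
        (fun t _ => (hd t).hasDerivWithinAt) (fun t ht => ?_)
      rw [interior_Icc] at ht
      have := hmono ⟨hρ.1.trans ht.1.le, ht.2.le.trans hr.2⟩ hr ht.2.le
      simp only at this
      linarith
    have := hm ⟨le_refl ρ, h⟩ ⟨h, le_refl r⟩ h
    simp at this
    linarith

/-- Second-order upper bound for a radial function. -/
theorem radial_le {E : Type*} [NormedAddCommGroup E] [InnerProductSpace ℝ E]
    {φ φ' φ'' : ℝ → ℝ} {N : ℝ}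
    (h1 : ∀ t, HasDerivAt φ (φ' t) t) (h2 : ∀ t, HasDerivAt φ' (φ'' t) t) (h0 : φ' 0 = 0)
    (v h : E) (h3 : ∀ t, 0 ≤ t → t ≤ ‖v‖ + ‖h‖ → φ'' t ≤ N) :
    φ ‖v + h‖ ≤ φ ‖v‖ + φ' ‖v‖ / ‖v‖ * inner ℝ v h + N / 2 * ‖h‖ ^ 2 := by
  have hr : ‖v‖ ∈ Set.Icc 0 (‖v‖ + ‖h‖) := ⟨norm_nonneg v, by linarith [norm_nonneg h]⟩
  have hρ : ‖v + h‖ ∈ Set.Icc 0 (‖v‖ + ‖h‖) := ⟨norm_nonneg _, norm_add_le v h⟩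
  have h00 : (0 : ℝ) ∈ Set.Icc 0 (‖v‖ + ‖h‖) := ⟨le_refl 0, by positivity⟩
  have A := (le_quadratic_of_deriv2_le h1 h2 h3 hr hρ).2
  have B := (le_quadratic_of_deriv2_le h1 h2 h3 h00 hr).1 (norm_nonneg v)
  rw [h0, sub_zero, sub_zero] at B
  have C := norm_add_sq_real v h
  rcases eq_or_ne v 0 with rfl | hv
  · simp [h0] at A ⊢
    linarith
  have hvp : 0 < ‖v‖ := norm_pos_iff.2 hv
  set r := ‖v‖
  set ρ := ‖v + h‖
  -- Expanding `‖v + h‖ ^ 2` trades `ρ - r` for the inner product. The leftover `φ' r / (2 * r) *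
  -- (‖h‖ ^ 2 - (ρ - r) ^ 2)` has a nonnegative last factor, and `φ' r / r ≤ N` because `φ' 0 = 0`;
  -- added to `N / 2 * (ρ - r) ^ 2` it gives at most `N / 2 * ‖h‖ ^ 2`. The norm itself is never
  -- differentiated.
  have D1 : φ' r * (ρ - r)
      = φ' r / r * inner ℝ v h + φ' r / r / 2 * (‖h‖ ^ 2 - (ρ - r) ^ 2) := by
    have : inner ℝ v h = (ρ ^ 2 - r ^ 2 - ‖h‖ ^ 2) / 2 := by linarith
    rw [this]; field_simp; ring
  have D2 : φ' r / r ≤ N := by rwa [div_le_iff₀ hvp]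
  have D3 : 0 ≤ ‖h‖ ^ 2 - (ρ - r) ^ 2 := by
    rw [sub_nonneg, sq_le_sq, abs_of_nonneg (norm_nonneg h)]
    have := abs_norm_sub_norm_le (v + h) v
    rwa [add_sub_cancel_left] at this
  nlinarith [mul_le_mul_of_nonneg_right D2 D3]

theorem lyap_norm_add_le {E : Type*} [NormedAddCommGroup E] [InnerProductSpace ℝ E]
    (hD : 0 < D) (q : ℕ) (v h : E) {S : ℝ} (hS : ‖h‖ ≤ S) :
    lyap D q ‖v + h‖ ≤ lyap D q ‖v‖ + lyap' D q ‖v‖ / ‖v‖ * inner ℝ v h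
      + (q + 1) ^ 2 * (‖v‖ + S) ^ q * (Real.exp 1 * Real.exp ((‖v‖ + S) / D) / D ^ 2) / 2
        * S ^ 2 := by
  have hS0 : 0 ≤ S := (norm_nonneg h).trans hS
  have key := radial_le (hasDerivAt_lyap hD q) (hasDerivAt_lyap' hD q) (lyap'_zero q hD) v h
    (N := (q + 1) ^ 2 * (‖v‖ + S) ^ q * (Real.exp 1 * Real.exp ((‖v‖ + S) / D) / D ^ 2))
    (fun t ht ht' => (lyap''_le hD q ht).trans (by
      have : 0 ≤ ‖v‖ + S := add_nonneg (norm_nonneg v) hS0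
      gcongr <;> linarith))
  refine key.trans ?_
  gcongr

/-- A Young-type inequality. -/
theorem young_pow (p : ℕ) {δ α u : ℝ} (hδ : 0 < δ) (hα : 0 < α) (hu : 0 ≤ u) :
    α * u ^ p ≤ δ * u ^ (p + 1) + α ^ (p + 1) / δ ^ p := by
  -- If `α ≤ δ * u` the first summand on the right suffices alone; otherwise `u ≤ α / δ` and the
  -- second does.
  rcases le_total α (δ * u) with h | h
  · have : α * u ^ p ≤ δ * u * u ^ p := by gcongr
    have h2 : 0 ≤ α ^ (p + 1) / δ ^ p := by positivity
    rw [pow_succ]; linarith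
  · have h1 : u ≤ α / δ := by rw [le_div_iff₀ hδ]; linarith
    have : α * u ^ p ≤ α * (α / δ) ^ p := by gcongr
    have h2 : 0 ≤ δ * u ^ (p + 1) := by positivity
    rw [div_pow] at this
    have e : α * (α ^ p / δ ^ p) = α ^ (p + 1) / δ ^ p := by ring
    linarith

end Analysis

/-! ### Scalar recursions and power sums. -/

section Sequences

/-- Both sides are compared with `exp (-s / m)`. -/
theorem one_sub_div_le_rpow {s m : ℝ} (hs : 0 ≤ s) (hm : 0 < m) :
    1 - s / m ≤ (m / (m + 1)) ^ s := by
  have h2 : Real.exp (-(1 / m)) ≤ m / (m + 1) := by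
    rw [Real.exp_neg, inv_le_comm₀ (Real.exp_pos _) (by positivity), inv_div]
    have := Real.add_one_le_exp (1 / m)
    have e : (m + 1) / m = 1 / m + 1 := by field_simp; ring
    rw [e]; exact this
  calc 1 - s / m = -(s / m) + 1 := by ring
    _ ≤ Real.exp (-(s / m)) := Real.add_one_le_exp _
    _ = Real.exp (-(1 / m)) ^ s := by rw [← Real.exp_mul]; congr 1; ring
    _ ≤ _ := by gcongr

/-- Transient and noise term are propagated separately. With `a = ι * μ` the transient needs only `1
- a / m ≤ (m / (m + 1)) ^ a`. A noise term `K / m` is preserved as soon as `K * (a - 1) ≥ ι ^ 2 *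
c`, so the factor `4 * e` in `K` is slack. -/
theorem harmonic_step {ι μ κ c V₀ : ℝ} (hι : 0 < ι) (ha : 1 < ι * μ) (hκ : 0 < κ)
    (hc : 0 ≤ c) (hV : 0 ≤ V₀) (n : ℕ) :
    (1 - ι / (n + κ) * μ) * (V₀ * (κ / (n + κ)) ^ (ι * μ)
        + 4 * ι ^ 2 * Real.exp 1 * c / (ι * μ - 1) * (1 / (n + κ)))
      + (ι / (n + κ)) ^ 2 * c
    ≤ V₀ * (κ / ((n + 1 : ℕ) + κ)) ^ (ι * μ)
        + 4 * ι ^ 2 * Real.exp 1 * c / (ι * μ - 1) * (1 / ((n + 1 : ℕ) + κ)) := by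
  have hm : 0 < (n : ℝ) + κ := by positivity
  have e1 : ((n + 1 : ℕ) : ℝ) + κ = (n + κ) + 1 := by push_cast; ring
  rw [e1]
  set m := (n : ℝ) + κ
  set a := ι * μ with ha'
  have A : (1 - ι / m * μ) * (κ / m) ^ a ≤ (κ / (m + 1)) ^ a := by
    have h1 : 1 - ι / m * μ ≤ (m / (m + 1)) ^ a := by
      have := one_sub_div_le_rpow (s := a) (by linarith) hm
      rwa [ha', mul_div_right_comm] at this
    calc (1 - ι / m * μ) * (κ / m) ^ a ≤ (m / (m + 1)) ^ a * (κ / m) ^ a := by gcongr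
      _ = (κ / (m + 1)) ^ a := by
        rw [← Real.mul_rpow (by positivity) (by positivity)]
        congr 1; field_simp
  have hK : 0 ≤ 4 * ι ^ 2 * Real.exp 1 * c := by positivity
  have ha1 : 0 < a - 1 := by linarith
  set K := 4 * ι ^ 2 * Real.exp 1 * c / (a - 1) with hKdef
  have hKa : K * (a - 1) = 4 * ι ^ 2 * Real.exp 1 * c := by rw [hKdef]; field_simp
  have hK0 : 0 ≤ K := by positivity
  have B : (1 - ι / m * μ) * (K * (1 / m)) + (ι / m) ^ 2 * c ≤ K * (1 / (m + 1)) := by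
    have e : K * (1 / (m + 1)) - (1 - ι / m * μ) * (K * (1 / m)) - (ι / m) ^ 2 * c
        = ((K * (a - 1) - ι ^ 2 * c) * (m + 1) + K) / (m ^ 2 * (m + 1)) := by
      rw [ha']; field_simp; ring
    have : 0 ≤ ((K * (a - 1) - ι ^ 2 * c) * (m + 1) + K) / (m ^ 2 * (m + 1)) := by
      have h1 : ι ^ 2 * c ≤ K * (a - 1) := by
        rw [hKa]
        have h3 : 1 ≤ Real.exp 1 := Real.one_le_exp (by norm_num)
        have h4 : 0 ≤ ι ^ 2 * c := by positivity
        nlinarith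
      have := sub_nonneg.2 h1
      positivity
    linarith
  nlinarith [mul_le_mul_of_nonneg_left A hV]

theorem add_one_rpow_sub_le {s m : ℝ} (hs : 0 ≤ s) (hs1 : s ≤ 1) (hm : 0 < m) :
    (m + 1) ^ s - m ^ s ≤ s * m ^ (s - 1) := by
  have h := rpow_one_add_le_one_add_mul_self (s := 1 / m) (p := s)
    (by have : 0 < 1 / m := by positivity
        linarith) hs hs1
  have e : (m + 1) ^ s = m ^ s * (1 + 1 / m) ^ s := by
    rw [← Real.mul_rpow hm.le (by positivity)]; congr 1; field_simp
  rw [e, Real.rpow_sub hm, Real.rpow_one]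
  have := mul_le_mul_of_nonneg_left h (Real.rpow_nonneg hm.le s)
  have e2 : m ^ s * (1 + s * (1 / m)) = m ^ s + s * (m ^ s / m) := by ring
  linarith

theorem rpow_neg_sub_le {s m : ℝ} (hs : 0 ≤ s) (hm : 0 < m) :
    m ^ (-s) - (m + 1) ^ (-s) ≤ s * m ^ (-s - 1) := by
  have h1 := one_sub_div_le_rpow hs hm
  have e : (m + 1) ^ (-s) = m ^ (-s) * (m / (m + 1)) ^ s := by
    rw [Real.div_rpow hm.le (by positivity), Real.rpow_neg hm.le, Real.rpow_neg (by positivity)]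
    have : m ^ s ≠ 0 := by positivity
    field_simp
  rw [e, Real.rpow_sub hm, Real.rpow_one]
  have := mul_le_mul_of_nonneg_left h1 (Real.rpow_nonneg hm.le (-s))
  have e2 : m ^ (-s) * (1 - s / m) = m ^ (-s) - s * (m ^ (-s) / m) := by ring
  linarith

/-- With noise level `2 * ι * c / μ` the contraction removes `2 * ι ^ 2 * c * m ^ (-2 * ξ)`. Half of
it offsets the new noise; the other half pays for the decrease of `m ^ (-ξ)`, which is at most `ξ *
m ^ (-ξ - 1)` and small enough by `hm1`. -/
theorem polynomial_step {ι μ ξ c V₀ κ₀ : ℝ} (hι : 0 < ι) (hμ : 0 < μ) (hξ : 0 < ξ) (hξ1 : ξ < 1)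
    (hc : 0 ≤ c) (hV : 0 ≤ V₀) {m : ℝ} (hm : 0 < m) (hm1 : 2 * ξ / (μ * ι) ≤ m ^ (1 - ξ)) :
    (1 - ι / m ^ ξ * μ) *
        (V₀ * Real.exp (-(μ * ι / (1 - ξ) * (m ^ (1 - ξ) - κ₀ ^ (1 - ξ))))
          + 2 * ι * c / μ * (1 / m ^ ξ))
      + (ι / m ^ ξ) ^ 2 * c
    ≤ V₀ * Real.exp (-(μ * ι / (1 - ξ) * ((m + 1) ^ (1 - ξ) - κ₀ ^ (1 - ξ))))
          + 2 * ι * c / μ * (1 / (m + 1) ^ ξ) := by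
  have h1ξ : 0 < 1 - ξ := by linarith
  have A : (1 - ι / m ^ ξ * μ) * Real.exp (-(μ * ι / (1 - ξ) * (m ^ (1 - ξ) - κ₀ ^ (1 - ξ))))
      ≤ Real.exp (-(μ * ι / (1 - ξ) * ((m + 1) ^ (1 - ξ) - κ₀ ^ (1 - ξ)))) := by
    have h0 := add_one_rpow_sub_le h1ξ.le (by linarith) hm
    rw [show 1 - ξ - 1 = -ξ by ring, Real.rpow_neg hm.le] at h0
    have h2 : 1 - ι / m ^ ξ * μ ≤ Real.exp (-(ι / m ^ ξ * μ)) := by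
      have := Real.add_one_le_exp (-(ι / m ^ ξ * μ)); linarith
    calc _ ≤ Real.exp (-(ι / m ^ ξ * μ)) *
          Real.exp (-(μ * ι / (1 - ξ) * (m ^ (1 - ξ) - κ₀ ^ (1 - ξ)))) := by gcongr
      _ ≤ _ := by
        rw [← Real.exp_add, Real.exp_le_exp]
        have := mul_le_mul_of_nonneg_left h0 (show 0 ≤ μ * ι / (1 - ξ) by positivity)
        have e : μ * ι / (1 - ξ) * ((1 - ξ) * (m ^ ξ)⁻¹) = ι / m ^ ξ * μ := by field_simp
        rw [e] at this
        linarith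
  have B : (1 - ι / m ^ ξ * μ) * (2 * ι * c / μ * (1 / m ^ ξ)) + (ι / m ^ ξ) ^ 2 * c
      ≤ 2 * ι * c / μ * (1 / (m + 1) ^ ξ) := by
    have h0 := rpow_neg_sub_le hξ.le hm
    rw [Real.rpow_neg hm.le, Real.rpow_neg (by positivity)] at h0
    have h1 : ξ * m ^ (-ξ - 1) ≤ μ * ι / 2 * (1 / m ^ ξ) ^ 2 := by
      have e : m ^ (-ξ - 1) = (1 / m ^ ξ) ^ 2 / m ^ (1 - ξ) := by
        rw [show -ξ - 1 = -(2 * ξ) - (1 - ξ) by ring, Real.rpow_sub hm, Real.rpow_neg hm.le,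
          mul_comm (2 : ℝ), Real.rpow_mul hm.le]
        norm_num
      have hp : 0 < m ^ (1 - ξ) := by positivity
      rw [div_le_iff₀ (by positivity)] at hm1
      rw [e, ← mul_div_assoc, div_le_iff₀ hp]
      have := mul_le_mul_of_nonneg_right hm1 (show 0 ≤ (1 / m ^ ξ) ^ 2 by positivity)
      linarith
    have h2 := mul_le_mul_of_nonneg_left (h0.trans h1) (show 0 ≤ 2 * ι * c / μ by positivity)
    have e2 : 2 * ι * c / μ * (μ * ι / 2 * (1 / m ^ ξ) ^ 2) = ι ^ 2 * c * (1 / m ^ ξ) ^ 2 := by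
      field_simp
    have e3 : ι / m ^ ξ * μ * (2 * ι * c / μ * (1 / m ^ ξ)) = 2 * ι ^ 2 * c * (1 / m ^ ξ) ^ 2 := by
      field_simp
    have e4 : (ι / m ^ ξ) ^ 2 * c = ι ^ 2 * c * (1 / m ^ ξ) ^ 2 := by ring
    simp only [← one_div] at h2
    nlinarith
  nlinarith [mul_le_mul_of_nonneg_left A hV]

theorem exists_bound_of_eventually {u w : ℕ → ℝ} (hw : ∀ n, 0 < w n) {N : ℕ} {C : ℝ}
    (h : ∀ n, N ≤ n → u n ≤ C * w n) : ∃ C', 0 ≤ C' ∧ ∀ n, u n ≤ C' * w n := by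
  refine ⟨|C| + ∑ k ∈ Finset.range N, |u k| / w k, by
    have : ∀ k ∈ Finset.range N, 0 ≤ |u k| / w k := fun k _ => by have := hw k; positivity
    have := Finset.sum_nonneg this
    positivity, fun n => ?_⟩
  have hs : ∀ k ∈ Finset.range N, 0 ≤ |u k| / w k := fun k _ => by have := hw k; positivity
  have hs' := Finset.sum_nonneg hs
  rcases le_or_gt N n with hn | hn
  · refine (h n hn).trans ?_
    have := hw n
    gcongr
    linarith [le_abs_self C]
  · have h1 := Finset.single_le_sum hs (Finset.mem_range.2 hn)
    have h2 : u n ≤ |u n| / w n * w n := by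
      rw [div_mul_cancel₀ _ (hw n).ne']; exact le_abs_self _
    refine h2.trans ?_
    have := hw n
    gcongr
    linarith [abs_nonneg C]

theorem tendsto_add_one_rpow_neg {s : ℝ} (hs : 0 < s) :
    Filter.Tendsto (fun n : ℕ => ((n : ℝ) + 1) ^ (-s)) Filter.atTop (nhds 0) :=
  (tendsto_rpow_neg_atTop hs).comp
    (Filter.tendsto_atTop_add_const_right _ 1 tendsto_natCast_atTop_atTop)

/-- Polynomial decay from a contraction with polynomially decaying rate and perturbation. -/
theorem exists_decay_bound {u : ℕ → ℝ} {m c ξ q : ℝ} (hm : 0 < m) (hξ : 0 < ξ) (hξ1 : ξ < 1)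
    (hq : 0 ≤ q) {N : ℕ}
    (h : ∀ n, N ≤ n → u (n + 1) ≤
      (1 - m * ((n : ℝ) + 1) ^ (-ξ)) * u n + c * ((n : ℝ) + 1) ^ (-ξ - q)) :
    ∃ C, 0 ≤ C ∧ ∀ n, u n ≤ C * ((n : ℝ) + 1) ^ (-q) := by
  have t1 := (tendsto_add_one_rpow_neg hξ).const_mul m
  have t2 := (tendsto_add_one_rpow_neg (sub_pos.2 hξ1)).const_mul q
  rw [mul_zero] at t1 t2
  -- From `N1` on, the contraction factor is positive and the relative decrease `q / x` of `x ^
  -- (-q)` uses less than half of the rate `m * x ^ (-ξ)`. The other half absorbs the perturbation,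
  -- whence the summand `2 * |c| / m` of `C`.
  obtain ⟨N1, hN1⟩ := Filter.eventually_atTop.1
    ((t1.eventually (gt_mem_nhds one_pos)).and (t2.eventually (gt_mem_nhds (half_pos hm))))
  set K := max N N1 with hK
  set C := |u K| * ((K : ℝ) + 1) ^ q + 2 * |c| / m with hC
  have hC0 : 0 ≤ C := by positivity
  refine exists_bound_of_eventually (N := K) (C := C) (fun n => by positivity) fun n hn => ?_
  induction n, hn using Nat.le_induction with
  | base =>
    have : u K ≤ |u K| * ((K : ℝ) + 1) ^ q * ((K : ℝ) + 1) ^ (-q) := by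
      rw [mul_assoc, ← Real.rpow_add (by positivity)]; simp [le_abs_self]
    refine this.trans ?_
    gcongr
    rw [hC]
    have : 0 ≤ 2 * |c| / m := by positivity
    linarith
  | succ n hn ih =>
    have hb := hN1 n ((le_max_right _ _).trans hn)
    have hr := h n ((le_max_left _ _).trans hn)
    have hx : (0 : ℝ) < (n : ℝ) + 1 := by positivity
    push_cast
    set x := (n : ℝ) + 1
    have h1 := rpow_neg_sub_le hq hx
    have h2 : (1 - m * x ^ (-ξ)) * u n ≤ (1 - m * x ^ (-ξ)) * (C * x ^ (-q)) :=
      mul_le_mul_of_nonneg_left ih (by linarith [hb.1])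
    have e1 : x ^ (-ξ) * x ^ (-q) = x ^ (-ξ - q) := by
      rw [← Real.rpow_add hx]; congr 1
    have e2 : x ^ (-q - 1) = x ^ (-(1 - ξ)) * x ^ (-ξ - q) := by
      rw [← Real.rpow_add hx]; congr 1; ring
    have hp : 0 < x ^ (-ξ - q) := by positivity
    have h3 : q * x ^ (-q - 1) ≤ m / 2 * x ^ (-ξ - q) := by
      rw [e2, ← mul_assoc]
      exact mul_le_mul_of_nonneg_right hb.2.le hp.le
    have h4 : C * x ^ (-q) - C * (x + 1) ^ (-q) ≤ C * (m / 2 * x ^ (-ξ - q)) := by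
      rw [← mul_sub]; exact mul_le_mul_of_nonneg_left (h1.trans h3) hC0
    have h5 : |c| ≤ C * m / 2 := by
      have : 2 * |c| / m ≤ C := by rw [hC]; linarith [show 0 ≤ |u K| * ((K : ℝ) + 1) ^ q by positivity]
      rw [div_le_iff₀ hm] at this
      linarith
    have h6 : c * x ^ (-ξ - q) ≤ C * m / 2 * x ^ (-ξ - q) :=
      mul_le_mul_of_nonneg_right ((le_abs_self c).trans h5) hp.le
    have h7 : m * x ^ (-ξ) * (C * x ^ (-q)) = C * m * x ^ (-ξ - q) := by
      rw [← e1]; ring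
    nlinarith

/-- Telescoping: Bernoulli's inequality at `-1 / (n + 1)` bounds `s * (n + 1) ^ (s - 1)` by `(n + 1)
^ s - n ^ s`. -/
theorem sum_rpow_le {s : ℝ} (hs : 0 < s) (hs1 : s ≤ 1) (n : ℕ) :
    ∑ k ∈ Finset.range n, ((k : ℝ) + 1) ^ (s - 1) ≤ 1 / s * (n : ℝ) ^ s := by
  induction n with
  | zero => simp [Real.zero_rpow hs.ne']
  | succ n ih =>
    rw [Finset.sum_range_succ]
    have h1 : s * ((n : ℝ) + 1) ^ (s - 1) ≤ ((n : ℝ) + 1) ^ s - (n : ℝ) ^ s := by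
      have hx : (0 : ℝ) < (n : ℝ) + 1 := by positivity
      have h := rpow_one_add_le_one_add_mul_self (s := -1 / ((n : ℝ) + 1)) (p := s)
        (by rw [le_div_iff₀ hx]; linarith [(n.cast_nonneg : (0 : ℝ) ≤ n)]) hs.le hs1
      have h0 : 0 ≤ 1 + -1 / ((n : ℝ) + 1) := by
        have e : 1 + -1 / ((n : ℝ) + 1) = n / (n + 1) := by field_simp; ring
        rw [e]; positivity
      have e : (n : ℝ) ^ s = ((n : ℝ) + 1) ^ s * (1 + -1 / ((n : ℝ) + 1)) ^ s := by
        rw [← Real.mul_rpow hx.le h0]; congr 1; field_simp; ring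
      rw [e, Real.rpow_sub hx, Real.rpow_one]
      have := mul_le_mul_of_nonneg_left h (Real.rpow_nonneg hx.le s)
      have e2 : ((n : ℝ) + 1) ^ s * (1 + s * (-1 / ((n : ℝ) + 1)))
        = ((n : ℝ) + 1) ^ s - s * (((n : ℝ) + 1) ^ s / (n + 1)) := by ring
      linarith
    push_cast
    have h2 : ((n : ℝ) + 1) ^ (s - 1) ≤ 1 / s * (((n : ℝ) + 1) ^ s - (n : ℝ) ^ s) := by
      rw [one_div, ← div_eq_inv_mul, le_div_iff₀ hs]; linarith
    linarith

end Sequences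

/-! ### Moments of the covariate and the population gradient. -/

section Population

variable {d : ℕ} {Ω₀ : Type*} [MeasurableSpace Ω₀] {M : Model d Ω₀}

/-- The corrupted noise `ε + s`. -/
noncomputable def Model.z (M : Model d Ω₀) (ω : Ω₀) : ℝ := M.ε ω + M.s ω

/-- The population sample `(x, y)`. -/
noncomputable def Model.pair (M : Model d Ω₀) (ω : Ω₀) : Vec d × ℝ := (M.x ω, M.y ω)

/-- The stochastic descent direction `l'(y - xᵀθ) x`. -/
noncomputable def Model.dir (M : Model d Ω₀) (θ : Vec d) (ζ : Vec d × ℝ) : Vec d :=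
  deriv M.l (ζ.2 - inner ℝ ζ.1 θ) • ζ.1

theorem Model.grad_eq (M : Model d Ω₀) (θ : Vec d) :
    M.grad θ = -∫ ω, M.dir θ (M.pair ω) ∂M.P := rfl

theorem Model.residual (M : Model d Ω₀) (θ : Vec d) (ω : Ω₀) :
    M.y ω - inner ℝ (M.x ω) θ = M.z ω - inner ℝ (M.x ω) (θ - M.θstar) := by
  rw [Model.y, Model.z, inner_sub_right]; ring

theorem Model.dir_pair (M : Model d Ω₀) (θ : Vec d) (ω : Ω₀) :
    M.dir θ (M.pair ω) = deriv M.l (M.z ω - inner ℝ (M.x ω) (θ - M.θstar)) • M.x ω := by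
  rw [← M.residual]; rfl

theorem Model.LossAssumption.continuous_deriv (h : M.LossAssumption) : Continuous (deriv M.l) := by
  refine (LipschitzWith.of_dist_le_mul (K := ⟨M.Ll, h.Ll_nonneg⟩) fun t t' => ?_).continuous
  rw [Real.dist_eq, Real.dist_eq]
  exact h.lipschitz t t'

theorem Model.LossAssumption.continuous_dir (h : M.LossAssumption) :
    Continuous (fun q : Vec d × (Vec d × ℝ) => M.dir q.1 q.2) := by
  have := h.continuous_deriv
  unfold Model.dir
  fun_prop

theorem Model.LossAssumption.norm_dir_le (h : M.LossAssumption) (θ : Vec d) (ζ : Vec d × ℝ) :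
    ‖M.dir θ ζ‖ ≤ M.al * ‖ζ.1‖ := by
  rw [Model.dir, norm_smul]
  gcongr
  exact h.bounded _

theorem Model.DataAssumption.aemeasurable_z (h : M.DataAssumption) : AEMeasurable M.z M.P :=
  h.integrable_ε.aemeasurable.add h.integrable_s.aemeasurable

theorem Model.DataAssumption.aemeasurable_inner (h : M.DataAssumption) (v : Vec d) :
    AEMeasurable (fun ω => inner ℝ (M.x ω) v) M.P :=
  (Measurable.inner measurable_id measurable_const).comp_aemeasurable h.aemeasurable_x

theorem Model.DataAssumption.aemeasurable_pair (h : M.DataAssumption) :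
    AEMeasurable M.pair M.P :=
  h.aemeasurable_x.prodMk
    (((h.aemeasurable_inner M.θstar).add h.integrable_ε.aemeasurable).add
      h.integrable_s.aemeasurable)

theorem Model.DataAssumption.indep_z (h : M.DataAssumption) : IndepFun M.x M.z M.P :=
  h.indep_x.comp measurable_id (measurable_fst.add measurable_snd)

/-- Layer-cake formula: `E[exp (λ‖x‖)] - 1` is the integral of `λ * exp (λ t) * P(‖x‖ ≥ t)`. At `λ =
1 / (2 * σx)` the tail bound leaves a multiple of `exp (-λ t)`. -/
theorem Model.DataAssumption.integrable_exp (h : M.DataAssumption) :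
    Integrable (fun ω => Real.exp (‖M.x ω‖ / (2 * M.σx))) M.P := by
  have := h.isProb
  have hσ := h.σx_pos
  have hx : AEMeasurable (fun ω => ‖M.x ω‖) M.P := h.aemeasurable_x.norm
  set lam : ℝ := 1 / (2 * M.σx) with hl
  have hl0 : 0 < lam := by positivity
  have key := lintegral_comp_eq_lintegral_meas_le_mul (f := fun ω => ‖M.x ω‖)
    (g := fun t => lam * Real.exp (lam * t)) M.P
    (Filter.Eventually.of_forall fun _ => norm_nonneg _) hx
    (fun t _ => (by fun_prop : Continuous fun t => lam * Real.exp (lam * t)).intervalIntegrable _ _)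
    (Filter.Eventually.of_forall fun t => by positivity)
  have hint : ∀ r : ℝ, ∫ t in (0 : ℝ)..r, lam * Real.exp (lam * t) = Real.exp (lam * r) - 1 := by
    intro r
    rw [intervalIntegral.integral_eq_sub_of_hasDerivAt (f := fun t => Real.exp (lam * t))]
    · simp
    · intro t _
      refine (((hasDerivAt_id' t).const_mul lam).exp).congr_deriv (by ring)
    · exact (by fun_prop : Continuous fun t => lam * Real.exp (lam * t)).intervalIntegrable _ _
  simp only [hint] at key
  have hfin : ∫⁻ ω, ENNReal.ofReal (Real.exp (lam * ‖M.x ω‖) - 1) ∂M.P < ⊤ := by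
    rw [key]
    have hI : IntegrableOn (fun t => 2 * lam * Real.exp (-lam * t)) (Set.Ioi 0) :=
      (integrableOn_exp_mul_Ioi (by linarith : -lam < 0) 0).const_mul _
    refine lt_of_le_of_lt (setLIntegral_mono_ae' measurableSet_Ioi
      (Filter.Eventually.of_forall fun t ht => ?_)) hI.lintegral_lt_top
    have ht0 : (0 : ℝ) ≤ t := le_of_lt ht
    have h1 : M.P {a | t ≤ ‖M.x a‖} ≤ ENNReal.ofReal (2 * Real.exp (-t / M.σx)) := by
      rw [← ofReal_measureReal]
      exact ENNReal.ofReal_le_ofReal (h.subexp_x t ht0)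
    refine (mul_le_mul_left h1 _).trans ?_
    rw [← ENNReal.ofReal_mul (by positivity)]
    apply le_of_eq
    congr 1
    have e : Real.exp (-t / M.σx) * Real.exp (lam * t) = Real.exp (-lam * t) := by
      rw [← Real.exp_add]; congr 1; rw [hl]; field_simp; ring
    rw [← e]; ring
  have hI : Integrable (fun ω => Real.exp (lam * ‖M.x ω‖) - 1) M.P := by
    refine ⟨(Real.measurable_exp.comp_aemeasurable (hx.const_mul lam)).sub_const 1
      |>.aestronglyMeasurable, ?_⟩
    rw [hasFiniteIntegral_iff_ofReal (Filter.Eventually.of_forall fun ω => ?_)]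
    · exact hfin
    · have : 1 ≤ Real.exp (lam * ‖M.x ω‖) := Real.one_le_exp (by positivity)
      simp only [Pi.zero_apply]; linarith
  have := hI.add (integrable_const (1 : ℝ))
  refine this.congr (Filter.Eventually.of_forall fun ω => ?_)
  simp only [Pi.add_apply, sub_add_cancel, hl]
  congr 1; ring

/-- Half of the available exponential rate is spent on the polynomial factor. The surviving rate `1
/ (4 * σx)` is the origin of the stepsize restriction `al * α ≤ D / (4 * σx)` below. -/
theorem Model.DataAssumption.integrable_pow_mul_exp (h : M.DataAssumption) (k : ℕ) :
    Integrable (fun ω => ‖M.x ω‖ ^ k * Real.exp (‖M.x ω‖ / (4 * M.σx))) M.P := by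
  have hσ := h.σx_pos
  have hx : AEMeasurable (fun ω => ‖M.x ω‖) M.P := h.aemeasurable_x.norm
  refine (h.integrable_exp.const_mul (k.factorial * (4 * M.σx) ^ k)).mono'
    ((by fun_prop : Measurable fun t : ℝ => t ^ k * Real.exp (t / (4 * M.σx))).comp_aemeasurable
      hx).aestronglyMeasurable (Filter.Eventually.of_forall fun ω => ?_)
  rw [Real.norm_of_nonneg (by positivity)]
  have h1 := Real.pow_div_factorial_le_exp (x := ‖M.x ω‖ / (4 * M.σx)) (by positivity) k
  have e : Real.exp (‖M.x ω‖ / (2 * M.σx))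
      = Real.exp (‖M.x ω‖ / (4 * M.σx)) * Real.exp (‖M.x ω‖ / (4 * M.σx)) := by
    rw [← Real.exp_add]; congr 1; field_simp; ring
  rw [e, ← mul_assoc]
  gcongr
  rw [div_pow, div_div, div_le_iff₀ (by positivity)] at h1
  linarith

theorem Model.DataAssumption.integrable_norm_pow (h : M.DataAssumption) (k : ℕ) :
    Integrable (fun ω => ‖M.x ω‖ ^ k) M.P := by
  have hσ := h.σx_pos
  refine (h.integrable_pow_mul_exp k).mono'
    (h.aemeasurable_x.norm.pow_const k).aestronglyMeasurable
    (Filter.Eventually.of_forall fun ω => ?_)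
  rw [Real.norm_of_nonneg (by positivity)]
  exact le_mul_of_one_le_right (by positivity) (Real.one_le_exp (by positivity))

theorem Model.DataAssumption.integrable_norm (h : M.DataAssumption) :
    Integrable (fun ω => ‖M.x ω‖) M.P := by
  simpa using h.integrable_norm_pow 1

theorem Model.DataAssumption.integrable_inner_mul_inner (h : M.DataAssumption) (u v : Vec d) :
    Integrable (fun ω => inner ℝ (M.x ω) u * inner ℝ (M.x ω) v) M.P := by
  refine ((h.integrable_norm_pow 2).const_mul (‖u‖ * ‖v‖)).mono'
    ((h.aemeasurable_inner u).mul (h.aemeasurable_inner v)).aestronglyMeasurable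
    (Filter.Eventually.of_forall fun ω => ?_)
  rw [norm_mul]
  have h1 := norm_inner_le_norm (𝕜 := ℝ) (M.x ω) u
  have h2 := norm_inner_le_norm (𝕜 := ℝ) (M.x ω) v
  calc _ ≤ (‖M.x ω‖ * ‖u‖) * (‖M.x ω‖ * ‖v‖) := by gcongr
    _ = _ := by ring

theorem Model.DataAssumption.integral_inner_mul_inner (h : M.DataAssumption) (u v : Vec d) :
    ∫ ω, inner ℝ (M.x ω) u * inner ℝ (M.x ω) v ∂M.P = inner ℝ u v := by
  have e : ∀ ω, inner ℝ (M.x ω) u * inner ℝ (M.x ω) v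
      = ∑ i, ∑ j, (u i * v j) * (M.x ω i * M.x ω j) := fun ω => by
    simp only [PiLp.inner_apply, Finset.sum_mul_sum]
    refine Finset.sum_congr rfl fun i _ => Finset.sum_congr rfl fun j _ => ?_
    simp; ring
  have hI : ∀ i j, Integrable (fun ω => M.x ω i * M.x ω j) M.P := fun i j => by
    refine (h.integrable_inner_mul_inner (EuclideanSpace.single i 1)
      (EuclideanSpace.single j 1)).congr (Filter.Eventually.of_forall fun ω => ?_)
    simp [EuclideanSpace.inner_single_right]
  simp only [e]
  rw [integral_finsetSum _ fun i _ => integrable_finsetSum _ fun j _ => (hI i j).const_mul _]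
  simp only [PiLp.inner_apply]
  refine Finset.sum_congr rfl fun i _ => ?_
  rw [integral_finsetSum _ fun j _ => (hI i j).const_mul _]
  simp only [integral_const_mul, h.isotropic]
  simp [mul_comm]

theorem Model.DataAssumption.integral_norm_sq (h : M.DataAssumption) :
    ∫ ω, ‖M.x ω‖ ^ 2 ∂M.P = d := by
  have e : ∀ ω, ‖M.x ω‖ ^ 2 = ∑ i, M.x ω i * M.x ω i := fun ω => by
    rw [EuclideanSpace.norm_sq_eq]
    refine Finset.sum_congr rfl fun i _ => ?_
    rw [Real.norm_eq_abs, sq_abs, sq]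
  have hI : ∀ i, Integrable (fun ω => M.x ω i * M.x ω i) M.P := fun i => by
    refine (h.integrable_inner_mul_inner (EuclideanSpace.single i 1)
      (EuclideanSpace.single i 1)).congr (Filter.Eventually.of_forall fun ω => ?_)
    simp [EuclideanSpace.inner_single_right]
  simp only [e]
  rw [integral_finsetSum _ fun i _ => hI i]
  simp [h.isotropic]

/-- Integrating `2 * ‖x‖ ^ 2 - 1 ≤ ‖x‖ ^ 4` with `E‖x‖ ^ 2 = d`. It makes the logarithm in `M.Δ`
positive. -/
theorem Model.DataAssumption.one_le_fourth (h : M.DataAssumption) (hd : 0 < d) :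
    1 ≤ ∫ ω, ‖M.x ω‖ ^ 4 ∂M.P := by
  have := h.isProb
  have h1 : ∫ ω, (2 * ‖M.x ω‖ ^ 2 - 1) ∂M.P ≤ ∫ ω, ‖M.x ω‖ ^ 4 ∂M.P := by
    refine integral_mono (((h.integrable_norm_pow 2).const_mul 2).sub (integrable_const 1))
      (h.integrable_norm_pow 4) fun ω => ?_
    simp only
    nlinarith [sq_nonneg (‖M.x ω‖ ^ 2 - 1)]
  rw [integral_sub ((h.integrable_norm_pow 2).const_mul 2) (integrable_const 1),
    integral_const_mul, h.integral_norm_sq] at h1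
  have : (1 : ℝ) ≤ d := by exact_mod_cast hd
  simp at h1
  linarith

theorem Model.Assumptions.log_pos (hM : M.Assumptions) (hd : 0 < d) :
    0 < Real.log (8 * ∫ ω, ‖M.x ω‖ ^ 4 ∂M.P) :=
  Real.log_pos (by linarith [hM.data.one_le_fourth hd])

theorem Model.Assumptions.Δ_pos (hM : M.Assumptions) (hd : 0 < d) : 0 < M.Δ :=
  div_pos (sub_pos.2 hM.Δεs_lt) (mul_pos hM.data.σx_pos (hM.log_pos hd))

theorem Model.Assumptions.μ_pos (hM : M.Assumptions) : 0 < M.μ :=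
  mul_pos (half_pos hM.loss.μl_pos) hM.prob_pos

theorem Model.Assumptions.aestronglyMeasurable_dir (hM : M.Assumptions) (θ : Vec d) :
    AEStronglyMeasurable (fun ω => M.dir θ (M.pair ω)) M.P :=
  ((hM.loss.continuous_dir.comp (by fun_prop : Continuous fun q : Vec d × ℝ => (θ, q))).measurable
    |>.comp_aemeasurable hM.data.aemeasurable_pair).aestronglyMeasurable

theorem Model.Assumptions.integrable_dir (hM : M.Assumptions) (θ : Vec d) :
    Integrable (fun ω => M.dir θ (M.pair ω)) M.P :=
  (hM.data.integrable_norm.const_mul M.al).mono' (hM.aestronglyMeasurable_dir θ)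
    (Filter.Eventually.of_forall fun ω => hM.loss.norm_dir_le θ (M.pair ω))

theorem Model.Assumptions.integral_deriv_z_smul (hM : M.Assumptions) :
    ∫ ω, deriv M.l (M.z ω) • M.x ω ∂M.P = 0 := by
  have := hM.data.isProb
  have := hM.data.indep_z.symm.integral_fun_comp_smul_comp (f := deriv M.l) (g := id)
    hM.data.aemeasurable_z hM.data.aemeasurable_x
    hM.loss.continuous_deriv.aestronglyMeasurable measurable_id.aestronglyMeasurable
  simpa [hM.data.mean_x] using this

theorem Model.Assumptions.grad_θstar (hM : M.Assumptions) : M.grad M.θstar = 0 := by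
  rw [M.grad_eq]
  simp only [M.dir_pair, sub_self, inner_zero_right, sub_zero]
  rw [hM.integral_deriv_z_smul, neg_zero]

theorem Model.dir_θstar (M : Model d Ω₀) (ω : Ω₀) :
    M.dir M.θstar (M.pair ω) = deriv M.l (M.z ω) • M.x ω := by
  rw [M.dir_pair, sub_self, inner_zero_right, sub_zero]

theorem Model.Assumptions.integrable_monotone_gap (hM : M.Assumptions) (v u : Vec d) :
    Integrable (fun ω => (deriv M.l (M.z ω) - deriv M.l (M.z ω - inner ℝ (M.x ω) v))
      * inner ℝ (M.x ω) u) M.P := by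
  have h1 := (hM.integrable_dir M.θstar).sub (hM.integrable_dir (M.θstar + v))
  refine (h1.inner_const u).congr (Filter.Eventually.of_forall fun ω => ?_)
  simp only [Pi.sub_apply, M.dir_θstar, M.dir_pair, add_sub_cancel_left]
  rw [← sub_smul, real_inner_smul_left]

/-- Subtracting `∇f(θ*) = 0` writes the gradient through increments of `l'`, which monotonicity and
strong convexity control pointwise. -/
theorem Model.Assumptions.inner_grad (hM : M.Assumptions) (v u : Vec d) :
    inner ℝ u (M.grad (M.θstar + v)) =
      ∫ ω, (deriv M.l (M.z ω) - deriv M.l (M.z ω - inner ℝ (M.x ω) v)) * inner ℝ (M.x ω) u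
        ∂M.P := by
  have h1 := (hM.integrable_dir M.θstar).sub (hM.integrable_dir (M.θstar + v))
  have h2 : M.grad (M.θstar + v)
      = ∫ ω, (M.dir M.θstar (M.pair ω) - M.dir (M.θstar + v) (M.pair ω)) ∂M.P := by
    rw [integral_sub (hM.integrable_dir _) (hM.integrable_dir _), M.grad_eq]
    have := hM.grad_θstar
    rw [M.grad_eq, neg_eq_zero] at this
    rw [this, zero_sub]
  refine (congrArg (inner ℝ u) h2).trans ((integral_inner h1 u).symm.trans ?_)
  congr 1; ext ω
  simp only [Pi.sub_apply, M.dir_θstar, M.dir_pair, add_sub_cancel_left]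
  rw [← sub_smul, real_inner_smul_right, real_inner_comm u]

end Population

/-! ### Lower bounds on the population gradient. -/

section Growth

variable {d : ℕ} {Ω₀ : Type*} [MeasurableSpace Ω₀] {M : Model d Ω₀}

theorem integral_indicator_comp {α β : Type*} [MeasurableSpace α] [MeasurableSpace β]
    {P : Measure α} {f : α → β} (hf : AEMeasurable f P) {S : Set β} (hS : MeasurableSet S) :
    ∫ ω, S.indicator (fun _ => (1 : ℝ)) (f ω) ∂P = P.real (f ⁻¹' S) := by
  have e : (fun ω => S.indicator (fun _ => (1 : ℝ)) (f ω))
      = (f ⁻¹' S).indicator (fun _ => (1 : ℝ)) := by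
    ext ω; by_cases h : f ω ∈ S <;> simp [Set.indicator, h]
  rw [e, integral_indicator₀ (hf.nullMeasurableSet_preimage hS)]
  simp

/-- With `κ = E‖x‖ ^ 4`, Young's inequality `t ^ 2 ≤ t ^ 4 / (4 * κ) + κ` on the event `‖x‖ > R`
gives `1 / 4 + κ * P(‖x‖ ≥ R)`. The radius `R = σx * log (8 * κ)` is the one at which the tail bound
equals `1 / (4 * κ)`. -/
theorem Model.Assumptions.integral_tail_sq_le (hM : M.Assumptions) (hd : 0 < d) :
    ∫ ω, (Set.Ioi (M.σx * Real.log (8 * ∫ ω, ‖M.x ω‖ ^ 4 ∂M.P))).indicator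
      (fun t => t ^ 2) ‖M.x ω‖ ∂M.P ≤ 1 / 2 := by
  have := hM.data.isProb
  have hκ := hM.data.one_le_fourth hd
  set κ := ∫ ω, ‖M.x ω‖ ^ 4 ∂M.P with hκdef
  clear_value κ
  set R := M.σx * Real.log (8 * κ) with hR
  have hσ := hM.data.σx_pos
  have hx : AEMeasurable (fun ω => ‖M.x ω‖) M.P := hM.data.aemeasurable_x.norm
  have hR0 : 0 ≤ R := mul_nonneg hσ.le (Real.log_nonneg (by linarith))
  have hI1 : Integrable (fun ω => (Set.Ici R).indicator (fun _ => (1 : ℝ)) ‖M.x ω‖) M.P :=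
    (integrable_const (1 : ℝ)).mono'
      ((measurable_const.indicator measurableSet_Ici).comp_aemeasurable hx).aestronglyMeasurable
      (Filter.Eventually.of_forall fun ω => by
        by_cases h : ‖M.x ω‖ ∈ Set.Ici R <;> simp [h])
  have hI0 : Integrable (fun ω => (Set.Ioi R).indicator (fun t => t ^ 2) ‖M.x ω‖) M.P :=
    (hM.data.integrable_norm_pow 2).mono'
      (((measurable_id.pow_const 2).indicator measurableSet_Ioi).comp_aemeasurable
        hx).aestronglyMeasurable
      (Filter.Eventually.of_forall fun ω => by
        by_cases h : ‖M.x ω‖ ∈ Set.Ioi R <;> simp [h])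
  have h1 : ∫ ω, (Set.Ioi R).indicator (fun t => t ^ 2) ‖M.x ω‖ ∂M.P
      ≤ ∫ ω, (1 / (4 * κ) * ‖M.x ω‖ ^ 4
        + κ * (Set.Ici R).indicator (fun _ => (1 : ℝ)) ‖M.x ω‖) ∂M.P := by
    refine integral_mono hI0 (((hM.data.integrable_norm_pow 4).const_mul _).add
      (hI1.const_mul _)) fun ω => ?_
    simp only
    by_cases h : R < ‖M.x ω‖
    · rw [Set.indicator_of_mem (Set.mem_Ioi.2 h), Set.indicator_of_mem (Set.mem_Ici.2 h.le)]
      have : 1 / (4 * κ) * ‖M.x ω‖ ^ 4 + κ * 1 - ‖M.x ω‖ ^ 2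
          = (‖M.x ω‖ ^ 2 - 2 * κ) ^ 2 / (4 * κ) := by field_simp; ring
      have h2 : 0 ≤ (‖M.x ω‖ ^ 2 - 2 * κ) ^ 2 / (4 * κ) := by positivity
      linarith
    · rw [Set.indicator_of_notMem (by simpa using h)]
      have : 0 ≤ (Set.Ici R).indicator (fun _ => (1 : ℝ)) ‖M.x ω‖ :=
        Set.indicator_nonneg (fun _ _ => zero_le_one) _
      positivity
  have h2 : M.P.real ((fun ω => ‖M.x ω‖) ⁻¹' Set.Ici R) ≤ 2 / (8 * κ) := by
    refine (hM.data.subexp_x R hR0).trans (le_of_eq ?_)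
    rw [hR, neg_div, mul_div_cancel_left₀ _ hσ.ne', Real.exp_neg, Real.exp_log (by positivity)]
    ring
  refine h1.trans ?_
  rw [integral_add ((hM.data.integrable_norm_pow 4).const_mul _) (hI1.const_mul _),
    integral_const_mul, integral_const_mul, integral_indicator_comp hx measurableSet_Ici, ← hκdef]
  have h3 := mul_le_mul_of_nonneg_left h2 (by linarith : 0 ≤ κ)
  have e1 : 1 / (4 * κ) * κ = 1 / 4 := by field_simp
  have e2 : κ * (2 / (8 * κ)) = 1 / 4 := by field_simp; norm_num
  linarith

theorem Model.Assumptions.gap_nonneg (hM : M.Assumptions) (a b : ℝ) :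
    0 ≤ (deriv M.l a - deriv M.l (a - b)) * b := by
  rcases le_total 0 b with h | h
  · exact mul_nonneg (sub_nonneg.2 (hM.loss.mono (by linarith))) h
  · exact mul_nonneg_of_nonpos_of_nonpos (sub_nonpos.2 (hM.loss.mono (by linarith))) h

theorem Model.Assumptions.gap_strong (hM : M.Assumptions) {a b : ℝ} (ha : |a| ≤ M.Δεs)
    (hb : |b| ≤ M.Δl - M.Δεs) :
    M.μl * b ^ 2 ≤ (deriv M.l a - deriv M.l (a - b)) * b := by
  have h1 : |a| ≤ M.Δl := ha.trans hM.Δεs_lt.le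
  have h2 : |a - b| ≤ M.Δl := (abs_sub a b).trans (by linarith)
  rcases le_total 0 b with h | h
  · have := hM.loss.strong a (a - b) h1 h2 (by linarith)
    nlinarith
  · have := hM.loss.strong (a - b) a h2 h1 (by linarith)
    nlinarith

/-- When `|ε + s| ≤ Δεs` and `‖x‖ ≤ R`, the shift satisfies `|⟨x, v⟩| ≤ R * Δ = Δl - Δεs`, so both
residuals stay where `l` is strongly convex and the integrand is at least `μl * ⟨x, v⟩ ^ 2`.
Elsewhere it is nonnegative. -/
theorem Model.Assumptions.inner_grad_ge_sq (hM : M.Assumptions) (hd : 0 < d) {v : Vec d}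
    (hv : ‖v‖ ≤ M.Δ) : M.μ * ‖v‖ ^ 2 ≤ inner ℝ v (M.grad (M.θstar + v)) := by
  have := hM.data.isProb
  have hσ := hM.data.σx_pos
  have hlog := hM.log_pos hd
  set R := M.σx * Real.log (8 * ∫ ω, ‖M.x ω‖ ^ 4 ∂M.P) with hR
  have hR0 : 0 < R := mul_pos hσ hlog
  have hRΔ : R * M.Δ = M.Δl - M.Δεs := by rw [Model.Δ, ← hR]; field_simp
  set F : ℝ → ℝ := (Set.Icc (-M.Δεs) M.Δεs).indicator (fun _ => (1 : ℝ)) with hF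
  -- `G` equals `⟨x, v⟩ ^ 2` for `‖x‖ ≤ R` and is nonpositive otherwise. It depends on `x` alone, so
  -- independence splits off the probability of the noise event; isotropy and the tail bound leave
  -- `E[G] ≥ ‖v‖ ^ 2 / 2`.
  set G : Vec d → ℝ := fun x => (inner ℝ x v) ^ 2 - (Set.Ioi R).indicator (fun t => t ^ 2) ‖x‖ * ‖v‖ ^ 2
    with hG
  have hFm : Measurable F := measurable_const.indicator measurableSet_Icc
  have hGm : Measurable G := by
    have h1 : Measurable fun x : Vec d => inner ℝ x v := measurable_id.inner measurable_const
    have h2 : Measurable fun x : Vec d => (Set.Ioi R).indicator (fun t : ℝ => t ^ 2) ‖x‖ :=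
      ((measurable_id.pow_const 2).indicator measurableSet_Ioi).comp measurable_norm
    exact (h1.pow_const 2).sub (h2.mul_const _)
  have hF01 : ∀ t, 0 ≤ F t ∧ F t ≤ 1 := fun t => by
    by_cases h : t ∈ Set.Icc (-M.Δεs) M.Δεs <;> simp [hF, h]
  have hI0 : Integrable (fun ω => (Set.Ioi R).indicator (fun t => t ^ 2) ‖M.x ω‖) M.P :=
    (hM.data.integrable_norm_pow 2).mono'
      (((measurable_id.pow_const 2).indicator measurableSet_Ioi).comp_aemeasurable
        hM.data.aemeasurable_x.norm).aestronglyMeasurable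
      (Filter.Eventually.of_forall fun ω => by
        by_cases h : ‖M.x ω‖ ∈ Set.Ioi R <;> simp [h])
  have hI2 : Integrable (fun ω => (inner ℝ (M.x ω) v) ^ 2) M.P := by
    refine (hM.data.integrable_inner_mul_inner v v).congr (Filter.Eventually.of_forall fun ω => ?_)
    simp only; ring
  have hGI : Integrable (fun ω => G (M.x ω)) M.P := hI2.sub (hI0.mul_const _)
  have hprod : ∫ ω, F (M.z ω) * G (M.x ω) ∂M.P
      = (∫ ω, F (M.z ω) ∂M.P) * ∫ ω, G (M.x ω) ∂M.P :=
    hM.data.indep_z.symm.integral_fun_comp_mul_comp hM.data.aemeasurable_z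
      hM.data.aemeasurable_x hFm.aestronglyMeasurable hGm.aestronglyMeasurable
  have hFint : ∫ ω, F (M.z ω) ∂M.P = M.P.real {ω | |M.ε ω + M.s ω| ≤ M.Δεs} := by
    rw [hF, integral_indicator_comp hM.data.aemeasurable_z measurableSet_Icc]
    congr 1; ext ω; simp [Model.z, abs_le]
  have hGint : ‖v‖ ^ 2 / 2 ≤ ∫ ω, G (M.x ω) ∂M.P := by
    rw [integral_sub hI2 (hI0.mul_const _), integral_mul_const]
    have h1 := hM.integral_tail_sq_le hd
    rw [← hR] at h1
    have h2 : ∫ ω, (inner ℝ (M.x ω) v) ^ 2 ∂M.P = ‖v‖ ^ 2 := by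
      rw [← real_inner_self_eq_norm_sq, ← hM.data.integral_inner_mul_inner v v]
      congr 1; ext ω; ring
    rw [h2]
    nlinarith [mul_le_mul_of_nonneg_right h1 (sq_nonneg ‖v‖)]
  have hFG : Integrable (fun ω => F (M.z ω) * G (M.x ω)) M.P := by
    refine hGI.norm.mono' (((hFm.comp_aemeasurable hM.data.aemeasurable_z).mul
      (hGm.comp_aemeasurable hM.data.aemeasurable_x)).aestronglyMeasurable)
      (Filter.Eventually.of_forall fun ω => ?_)
    rw [norm_mul]
    refine mul_le_of_le_one_left (norm_nonneg _) ?_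
    rw [Real.norm_of_nonneg (hF01 _).1]
    exact (hF01 _).2
  have hlow : ∫ ω, M.μl * (F (M.z ω) * G (M.x ω)) ∂M.P
      ≤ inner ℝ v (M.grad (M.θstar + v)) := by
    rw [hM.inner_grad]
    refine integral_mono (hFG.const_mul _) (hM.integrable_monotone_gap v v) fun ω => ?_
    simp only
    have hxv : |inner ℝ (M.x ω) v| ≤ ‖M.x ω‖ * ‖v‖ := abs_real_inner_le_norm _ _
    by_cases hz : M.z ω ∈ Set.Icc (-M.Δεs) M.Δεs
    · have hz' : F (M.z ω) = 1 := by simp [hF, hz]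
      rw [hz', one_mul]
      by_cases hx : R < ‖M.x ω‖
      · refine le_trans ?_ (hM.gap_nonneg _ _)
        refine mul_nonpos_of_nonneg_of_nonpos hM.loss.μl_pos.le ?_
        simp only [hG, Set.indicator_of_mem (Set.mem_Ioi.2 hx)]
        rw [← mul_pow, sub_nonpos, sq_le_sq, abs_of_nonneg (by positivity : 0 ≤ ‖M.x ω‖ * ‖v‖)]
        exact hxv
      · simp only [hG, Set.indicator_of_notMem (show ‖M.x ω‖ ∉ Set.Ioi R by simpa using hx),
          zero_mul, sub_zero]
        refine hM.gap_strong (abs_le.2 hz) (hxv.trans ?_)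
        rw [← hRΔ]
        have := not_lt.1 hx
        gcongr
    · have hz' : F (M.z ω) = 0 := by simp [hF, hz]
      rw [hz', zero_mul, mul_zero]
      exact hM.gap_nonneg _ _
  rw [integral_const_mul, hprod, hFint] at hlow
  refine le_trans ?_ hlow
  have h0 := mul_nonneg hM.loss.μl_pos.le hM.prob_pos.le
  have := mul_le_mul_of_nonneg_left hGint h0
  rw [Model.μ]
  nlinarith

/-- Along a ray from `θ*` the directional derivative of `f` is nondecreasing, since `l'` is. Outside
the ball it is therefore at least its value on the sphere of radius `Δ`, where the quadratic bound
applies. -/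
theorem Model.Assumptions.exists_tailConst (hM : M.Assumptions) (hd : 0 < d) :
    M.TailConst (M.μ * M.Δ) := by
  intro θ hθ
  have hΔ := hM.Δ_pos hd
  set v := θ - M.θstar with hv
  have hv0 : 0 < ‖v‖ := hΔ.trans hθ
  set c := M.Δ / ‖v‖ with hc
  have hc0 : 0 < c := by positivity
  have hc1 : c ≤ 1 := (div_le_one hv0).2 hθ.le
  have hcv : ‖c • v‖ = M.Δ := by
    rw [norm_smul, Real.norm_of_nonneg hc0.le, hc]; field_simp
  have h1 := hM.inner_grad_ge_sq hd hcv.le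
  rw [hcv, real_inner_smul_left] at h1
  have h2 : inner ℝ v (M.grad (M.θstar + c • v)) ≤ inner ℝ v (M.grad (M.θstar + v)) := by
    rw [hM.inner_grad, hM.inner_grad]
    refine integral_mono (hM.integrable_monotone_gap _ v) (hM.integrable_monotone_gap _ v)
      fun ω => ?_
    simp only [inner_smul_right]
    rcases le_total 0 (inner ℝ (M.x ω) v) with h | h
    · refine mul_le_mul_of_nonneg_right (sub_le_sub_left (hM.loss.mono ?_) _) h
      nlinarith
    · refine mul_le_mul_of_nonpos_right (sub_le_sub_left (hM.loss.mono ?_) _) h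
      nlinarith
  have e : M.θstar + v = θ := by rw [hv]; abel
  rw [e] at h2
  have h3 : M.μ * M.Δ ^ 2 ≤ c * inner ℝ v (M.grad θ) :=
    h1.trans (mul_le_mul_of_nonneg_left h2 hc0.le)
  have h4 : c * ‖v‖ = M.Δ := by rw [hc]; field_simp
  have h5 : c * (M.μ * M.Δ * ‖v‖) ≤ c * inner ℝ v (M.grad θ) := by
    have : c * (M.μ * M.Δ * ‖v‖) = M.μ * M.Δ ^ 2 := by
      calc _ = M.μ * M.Δ * (c * ‖v‖) := by ring
        _ = _ := by rw [h4]; ring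
    rwa [this]
  exact le_of_mul_le_mul_left h5 hc0

theorem Model.Assumptions.rate_pos (hM : M.Assumptions) (hd : 0 < d) {b : ℝ} (hb : 0 < b) (p : ℕ) :
    0 < M.rate b p := by
  have := hM.Δ_pos hd
  have := hM.μ_pos
  exact lt_min (by positivity) (by positivity)

theorem Model.Assumptions.rate_le (hM : M.Assumptions) (b : ℝ) (p : ℕ) :
    M.rate b p ≤ M.μl * (1 - M.outlier) * (1 + p) := by
  have := hM.data.isProb
  refine (min_le_right _ _).trans ?_
  have hms : NullMeasurableSet {ω | M.Δl ≤ |M.ε ω + M.s ω|} M.P :=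
    (measurable_abs.comp_aemeasurable hM.data.aemeasurable_z).nullMeasurableSet_preimage
      measurableSet_Ici
  have h1 : M.P.real {ω | |M.ε ω + M.s ω| ≤ M.Δεs} ≤ 1 - M.outlier := by
    rw [Model.outlier, ← probReal_compl_eq_one_sub₀ hms]
    refine measureReal_mono fun ω hω => ?_
    simp only [Set.mem_compl_iff, Set.mem_ofPred_eq, not_le] at *
    exact hω.trans_lt hM.Δεs_lt
  have h0 : 0 ≤ M.P.real {ω | |M.ε ω + M.s ω| ≤ M.Δεs} := measureReal_nonneg
  have hμ := hM.loss.μl_pos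
  gcongr
  rw [Model.μ]
  nlinarith

end Growth

/-! ### One-step drift of the Lyapunov function. -/

section Drift

variable {d : ℕ} {Ω₀ : Type*} [MeasurableSpace Ω₀] {M : Model d Ω₀} {D m b : ℝ}

theorem Model.sub_grad_add_noise (M : Model d Ω₀) (θ : Vec d) (α : ℝ) (ω : Ω₀) :
    θ - α • (M.grad θ + M.noise θ ω) = θ + α • M.dir θ (M.pair ω) := by
  have : M.noise θ ω = -M.grad θ - M.dir θ (M.pair ω) := rfl
  rw [this]
  module

theorem Model.V_eq (M : Model d Ω₀) (q : ℕ) (θ : Vec d) : M.V q θ = lyap M.Δ q ‖θ - M.θstar‖ := rfl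

/-- Growth of the population gradient: quadratic in the ball of radius `D`, linear outside. -/
structure Model.Growth (M : Model d Ω₀) (D m b : ℝ) : Prop where
  inside : ∀ θ : Vec d, ‖θ - M.θstar‖ ≤ D →
    m * ‖θ - M.θstar‖ ^ 2 ≤ inner ℝ (θ - M.θstar) (M.grad θ)
  outside : ∀ θ : Vec d, D < ‖θ - M.θstar‖ →
    b * ‖θ - M.θstar‖ ≤ inner ℝ (θ - M.θstar) (M.grad θ)

theorem Model.Assumptions.growth (hM : M.Assumptions) (hd : 0 < d) (hb : M.TailConst b) :
    M.Growth M.Δ M.μ b where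
  inside θ hθ := by
    have := hM.inner_grad_ge_sq hd hθ
    rwa [add_sub_cancel] at this
  outside := hb

/-- Separates the state `r` from the sample `y = ‖x‖` in the Taylor remainder, so that the sample
factor can be integrated. The stepsize condition turns the exponential of the increment into `exp (y
/ (4 * σ))`, which is integrable. -/
theorem lyap_remainder_le {q : ℕ} {r α a σ y : ℝ} (hD : 0 < D) (hr : 0 ≤ r) (hα : 0 < α)
    (ha : 0 < a) (hσ : 0 < σ) (hy : 0 ≤ y) (hα1 : a * α ≤ D / (4 * σ)) :
    (q + 1) ^ 2 * (r + a * α * y) ^ q * (Real.exp 1 * Real.exp ((r + a * α * y) / D) / D ^ 2) / 2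
        * (a * α * y) ^ 2
      ≤ (q + 1) ^ 2 * 2 ^ q * Real.exp 1 / D ^ 2 * a ^ 2
        * (y ^ 2 * Real.exp (y / (4 * σ)) + a ^ q * (y ^ (q + 2) * Real.exp (y / (4 * σ))))
        * (α ^ 2 * (r ^ q + α ^ q) * Real.exp (r / D)) := by
  have h1 : (r + a * α * y) ^ q ≤ 2 ^ q * ((r ^ q + α ^ q) * (1 + a ^ q * y ^ q)) := by
    have hS : 0 ≤ a * α * y := by positivity
    have h3 : (2 : ℝ) ^ (q - 1) ≤ 2 ^ q := pow_le_pow_right₀ (by norm_num) (Nat.sub_le q 1)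
    refine (add_pow_le hr hS q).trans ?_
    have h4 : r ^ q + (a * α * y) ^ q ≤ (r ^ q + α ^ q) * (1 + a ^ q * y ^ q) := by
      rw [mul_pow, mul_pow]
      have : 0 ≤ r ^ q * (a ^ q * y ^ q) := by positivity
      have : 0 ≤ α ^ q := by positivity
      nlinarith
    gcongr
  have h2 : Real.exp ((r + a * α * y) / D) ≤ Real.exp (r / D) * Real.exp (y / (4 * σ)) := by
    rw [← Real.exp_add, Real.exp_le_exp, add_div]
    have : a * α * y / D ≤ D / (4 * σ) * y / D := by gcongr
    have e : D / (4 * σ) * y / D = y / (4 * σ) := by field_simp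
    linarith
  calc _ ≤ (q + 1) ^ 2 * (2 ^ q * ((r ^ q + α ^ q) * (1 + a ^ q * y ^ q)))
        * (Real.exp 1 * (Real.exp (r / D) * Real.exp (y / (4 * σ))) / D ^ 2) / 1
        * (a * α * y) ^ 2 := by gcongr; norm_num
    _ = _ := by ring

theorem Model.Assumptions.lyap_step (hM : M.Assumptions) (hD : 0 < D) (q : ℕ) :
    ∃ C : ℝ, 0 ≤ C ∧ ∀ (θ : Vec d) (α : ℝ), 0 < α → M.al * α ≤ D / (4 * M.σx) →
      Integrable (fun ω => lyap D q ‖θ + α • M.dir θ (M.pair ω) - M.θstar‖) M.P ∧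
      ∫ ω, lyap D q ‖θ + α • M.dir θ (M.pair ω) - M.θstar‖ ∂M.P ≤
        lyap D q ‖θ - M.θstar‖
          - α * (lyap' D q ‖θ - M.θstar‖ / ‖θ - M.θstar‖ * inner ℝ (θ - M.θstar) (M.grad θ))
          + C * (α ^ 2 * (‖θ - M.θstar‖ ^ q + α ^ q) * Real.exp (‖θ - M.θstar‖ / D)) := by
  have := hM.data.isProb
  have hσ := hM.data.σx_pos
  have ha := hM.loss.al_pos
  set Ψ : Ω₀ → ℝ := fun ω => ‖M.x ω‖ ^ 2 * Real.exp (‖M.x ω‖ / (4 * M.σx))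
    + M.al ^ q * (‖M.x ω‖ ^ (q + 2) * Real.exp (‖M.x ω‖ / (4 * M.σx))) with hΨ
  have hΨI : Integrable Ψ M.P := (hM.data.integrable_pow_mul_exp 2).add
    ((hM.data.integrable_pow_mul_exp (q + 2)).const_mul _)
  set K := (q + 1) ^ 2 * 2 ^ q * Real.exp 1 / D ^ 2 * M.al ^ 2 with hK
  refine ⟨K * ∫ ω, Ψ ω ∂M.P, mul_nonneg (by positivity)
    (integral_nonneg fun ω => by positivity), fun θ α hα hα1 => ?_⟩
  set v := θ - M.θstar with hv
  set B := α ^ 2 * (‖v‖ ^ q + α ^ q) * Real.exp (‖v‖ / D) with hB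
  have hpt : ∀ ω, lyap D q ‖θ + α • M.dir θ (M.pair ω) - M.θstar‖ ≤
      (lyap D q ‖v‖ + lyap' D q ‖v‖ / ‖v‖ * inner ℝ v (α • M.dir θ (M.pair ω))) + K * Ψ ω * B := by
    intro ω
    have hS : ‖α • M.dir θ (M.pair ω)‖ ≤ M.al * α * ‖M.x ω‖ := by
      rw [norm_smul, Real.norm_of_nonneg hα.le]
      have := hM.loss.norm_dir_le θ (M.pair ω)
      have h2 := mul_le_mul_of_nonneg_left this hα.le
      calc _ ≤ _ := h2
        _ = _ := by rw [Model.pair]; ring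
    have h1 := lyap_norm_add_le hD q v (α • M.dir θ (M.pair ω)) hS
    have h2 := lyap_remainder_le (q := q) hD (norm_nonneg v) hα ha hσ (norm_nonneg (M.x ω)) hα1
    have e : θ + α • M.dir θ (M.pair ω) - M.θstar = v + α • M.dir θ (M.pair ω) := by
      rw [hv]; abel
    rw [e]
    exact h1.trans (by gcongr)
  have hdir := (hM.integrable_dir θ).smul α
  have hin : Integrable (fun ω => inner ℝ v (α • M.dir θ (M.pair ω))) M.P := hdir.const_inner v
  have hrhs : Integrable (fun ω => (lyap D q ‖v‖
      + lyap' D q ‖v‖ / ‖v‖ * inner ℝ v (α • M.dir θ (M.pair ω))) + K * Ψ ω * B) M.P :=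
    ((integrable_const _).add (hin.const_mul _)).add ((hΨI.const_mul K).mul_const B)
  have hI : Integrable (fun ω => lyap D q ‖θ + α • M.dir θ (M.pair ω) - M.θstar‖) M.P := by
    refine hrhs.mono' ?_ (Filter.Eventually.of_forall fun ω => ?_)
    · exact (continuous_lyap hD q).comp_aestronglyMeasurable
        ((((hM.aestronglyMeasurable_dir θ).const_smul α).const_add θ).sub
          aestronglyMeasurable_const).norm
    · rw [Real.norm_of_nonneg (lyap_nonneg hD q (norm_nonneg _))]
      exact hpt ω
  refine ⟨hI, (integral_mono hI hrhs hpt).trans (le_of_eq ?_)⟩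
  have hin' : ∫ ω, inner ℝ v (α • M.dir θ (M.pair ω)) ∂M.P = -(α * inner ℝ v (M.grad θ)) := by
    refine (integral_inner hdir v).trans ?_
    simp only [Pi.smul_apply]
    rw [integral_smul, M.grad_eq, inner_smul_right, inner_neg_right]
    ring
  have hfirst : Integrable (fun ω => lyap D q ‖v‖
      + lyap' D q ‖v‖ / ‖v‖ * inner ℝ v (α • M.dir θ (M.pair ω))) M.P :=
    (integrable_const _).add (hin.const_mul _)
  rw [integral_add hfirst ((hΨI.const_mul K).mul_const B),
    integral_add (integrable_const _) (hin.const_mul _), integral_const_mul, integral_mul_const,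
    integral_const_mul, hin']
  simp
  ring

theorem Model.Growth.inner_nonneg (hG : M.Growth D m b) (hm : 0 < m) (hb : 0 < b) (θ : Vec d) :
    0 ≤ inner ℝ (θ - M.θstar) (M.grad θ) := by
  rcases le_or_gt ‖θ - M.θstar‖ D with h | h
  · exact le_trans (by positivity) (hG.inside θ h)
  · exact le_trans (by positivity) (hG.outside θ h)

theorem lyap'_nonneg (hD : 0 < D) (q : ℕ) {t : ℝ} (ht : 0 ≤ t) : 0 ≤ lyap' D q t := by
  have := profile_nonneg hD ht
  have := profile'_nonneg hD ht
  unfold lyap'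
  positivity

/-- Inside the ball the first-order term is at least `2 * (1 + p) * m * V`, and the remainder is of
order `α ^ 2 * r ^ (2 * p)` plus higher powers of `α`; Young's inequality splits `α * r ^ (2 * p)`
into a small multiple of `r ^ (2 * p + 2)` and a multiple of `α ^ (p + 1)`. Outside, first-order
term and remainder are both multiples of `r ^ (2 * p) * exp (r / D)`, so a small stepsize suffices
without an additive error. -/
theorem Model.Assumptions.exists_drift (hM : M.Assumptions) (hD : 0 < D) (hm : 0 < m) (hb : 0 < b)
    (hG : M.Growth D m b) (p : ℕ) {ρ : ℝ} (hρ : 0 ≤ ρ) (hρ1 : ρ ≤ b / (2 * D))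
    (hρ2 : ρ ≤ m * (1 + p)) :
    ∃ c α₀ : ℝ, 0 ≤ c ∧ 0 < α₀ ∧ ∀ (θ : Vec d) (α : ℝ), 0 < α → α ≤ α₀ →
      Integrable (fun ω => lyap D (2 * p) ‖θ + α • M.dir θ (M.pair ω) - M.θstar‖) M.P ∧
      ∫ ω, lyap D (2 * p) ‖θ + α • M.dir θ (M.pair ω) - M.θstar‖ ∂M.P ≤
        (1 - α * ρ) * lyap D (2 * p) ‖θ - M.θstar‖ + α ^ (p + 2) * c := by
  have hσ := hM.data.σx_pos
  have ha := hM.loss.al_pos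
  obtain ⟨C, hC, hstep⟩ := hM.lyap_step hD (2 * p)
  set E := Real.exp 1 with hE
  have hE0 : 0 < E := Real.exp_pos 1
  -- Chosen so that `C * E * δ * r ^ (2 * p + 2) ≤ (1 + p) * m * V` inside the ball, that is, at
  -- most half of the available drift.
  set δ := (1 + p) * m * E / (2 * D ^ 2) / (C * E + 1) with hδ
  have hδ0 : 0 < δ := by positivity
  have hα₀ : 0 < D / (4 * M.σx) / M.al := by positivity
  -- Below this stepsize the remainder outside the ball uses at most half of the drift `b / D`. The
  -- term `1 / D ^ (2 * p)` comes from bounding `α ^ (2 * p) ≤ 1` by a multiple of `r ^ (2 * p)`.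
  have hα₁ : 0 < b / (2 * D) / (C * (1 + 1 / D ^ (2 * p)) + 1) := by positivity
  refine ⟨C * E * (1 / δ ^ p + 1), min 1 (min (D / (4 * M.σx) / M.al)
    (b / (2 * D) / (C * (1 + 1 / D ^ (2 * p)) + 1))), by positivity,
    lt_min one_pos (lt_min hα₀ hα₁), fun θ α hα hα' => ?_⟩
  have hα1 : α ≤ 1 := hα'.trans (min_le_left _ _)
  have hα2 : α ≤ D / (4 * M.σx) / M.al := hα'.trans ((min_le_right _ _).trans (min_le_left _ _))
  have hα3 : α ≤ b / (2 * D) / (C * (1 + 1 / D ^ (2 * p)) + 1) :=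
    hα'.trans ((min_le_right _ _).trans (min_le_right _ _))
  rw [le_div_iff₀ ha] at hα2
  rw [le_div_iff₀ (by positivity)] at hα3
  obtain ⟨hI, hle⟩ := hstep θ α hα (by linarith)
  refine ⟨hI, hle.trans ?_⟩
  have hr0 : 0 ≤ ‖θ - M.θstar‖ := norm_nonneg _
  rcases le_or_gt ‖θ - M.θstar‖ D with h | h
  · have hin := hG.inside θ h
    set I := inner ℝ (θ - M.θstar) (M.grad θ)
    set r := ‖θ - M.θstar‖
    have hexp : Real.exp (r / D) ≤ E := Real.exp_le_exp.2 ((div_le_one hD).2 h)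
    have hV : lyap D (2 * p) r = E * r ^ (2 * p + 2) / (2 * D ^ 2) := lyap_of_le _ h
    have hgrad : 2 * (1 + p) * m * lyap D (2 * p) r ≤ lyap' D (2 * p) r / r * I := by
      have e : 2 * (1 + p) * m * lyap D (2 * p) r = lyap' D (2 * p) r / r * (m * r ^ 2) := by
        rw [hV, lyap'_of_le _ h hD]
        rcases eq_or_ne r 0 with hr | hr
        · simp [hr]
        · push_cast; field_simp; ring
      rw [e]
      exact mul_le_mul_of_nonneg_left hin (div_nonneg (lyap'_nonneg hD _ hr0) hr0)
    have hy := young_pow p hδ0 hα (sq_nonneg r)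
    rw [← pow_mul, ← pow_mul] at hy
    have h1 : C * (α ^ 2 * (r ^ (2 * p) + α ^ (2 * p)) * Real.exp (r / D))
        ≤ C * E * (α * (α * r ^ (2 * p)) + α ^ (p + 2)) := by
      have h2 : α ^ (2 * p + 2) ≤ α ^ (p + 2) :=
        pow_le_pow_of_le_one hα.le hα1 (by omega)
      have e : α ^ 2 * (r ^ (2 * p) + α ^ (2 * p)) = α * (α * r ^ (2 * p)) + α ^ (2 * p + 2) := by
        ring
      rw [e, mul_assoc C E, mul_comm E]
      gcongr
    have h3 : C * E * (α * (α * r ^ (2 * p)) + α ^ (p + 2))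
        ≤ C * E * (α * (δ * r ^ (2 * (p + 1)) + α ^ (p + 1) / δ ^ p) + α ^ (p + 2)) := by
      gcongr
    have h4 : C * E * (α * (δ * r ^ (2 * (p + 1)))) ≤ α * ((1 + p) * m * lyap D (2 * p) r) := by
      have : C * E * δ ≤ (1 + p) * m * E / (2 * D ^ 2) := by
        rw [hδ, ← mul_div_assoc, div_le_iff₀ (by positivity)]
        have : 0 ≤ (1 + p) * m * E / (2 * D ^ 2) := by positivity
        nlinarith
      have h5 := mul_le_mul_of_nonneg_right this
        (show 0 ≤ α * r ^ (2 * (p + 1)) by positivity)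
      rw [hV]
      calc _ = C * E * δ * (α * r ^ (2 * (p + 1))) := by ring
        _ ≤ _ := h5
        _ = _ := by ring
    have hV0 : 0 ≤ lyap D (2 * p) r := lyap_nonneg hD _ hr0
    have h6 : α * ρ * lyap D (2 * p) r ≤ α * ((1 + p) * m * lyap D (2 * p) r) := by
      rw [mul_assoc]
      gcongr
      linarith
    have h7 := mul_le_mul_of_nonneg_left hgrad hα.le
    have e8 : C * E * (α * (δ * r ^ (2 * (p + 1)) + α ^ (p + 1) / δ ^ p) + α ^ (p + 2))
        = C * E * (α * (δ * r ^ (2 * (p + 1)))) + α ^ (p + 2) * (C * E * (1 / δ ^ p + 1)) := by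
      ring
    linarith
  · have hout := hG.outside θ h
    set I := inner ℝ (θ - M.θstar) (M.grad θ)
    set r := ‖θ - M.θstar‖
    have hr : 0 < r := hD.trans h
    set X := r ^ (2 * p) * Real.exp (r / D) with hX
    have hX0 : 0 < X := by positivity
    have hgrad : b / D * X ≤ lyap' D (2 * p) r / r * I := by
      have h1 := le_lyap'_of_lt hD (2 * p) h
      have h2 : lyap' D (2 * p) r / r * (b * r) ≤ lyap' D (2 * p) r / r * I :=
        mul_le_mul_of_nonneg_left hout (div_nonneg (lyap'_nonneg hD _ hr0) hr0)
      refine le_trans ?_ h2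
      have e : lyap' D (2 * p) r / r * (b * r) = b * lyap' D (2 * p) r := by field_simp
      rw [e]
      have := mul_le_mul_of_nonneg_left h1 hb.le
      calc _ = b * (r ^ (2 * p) * Real.exp (r / D) / D) := by rw [hX]; ring
        _ ≤ _ := this
    have h1 : C * (α ^ 2 * (r ^ (2 * p) + α ^ (2 * p)) * Real.exp (r / D))
        ≤ α * (b / (2 * D)) * X := by
      have h2 : α ^ (2 * p) ≤ 1 / D ^ (2 * p) * r ^ (2 * p) := by
        have h3 : α ^ (2 * p) ≤ 1 := pow_le_one₀ hα.le hα1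
        have h4 : D ^ (2 * p) ≤ r ^ (2 * p) := by gcongr
        have h5 : 1 ≤ 1 / D ^ (2 * p) * r ^ (2 * p) := by
          rw [one_div, ← div_eq_inv_mul, one_le_div (by positivity)]; exact h4
        linarith
      calc C * (α ^ 2 * (r ^ (2 * p) + α ^ (2 * p)) * Real.exp (r / D))
          ≤ C * (α ^ 2 * (r ^ (2 * p) + 1 / D ^ (2 * p) * r ^ (2 * p)) * Real.exp (r / D)) := by
            gcongr
        _ = α * (α * (C * (1 + 1 / D ^ (2 * p)))) * X := by rw [hX]; ring
        _ ≤ _ := by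
            gcongr
            linarith
    have h2 : α * ρ * lyap D (2 * p) r ≤ α * (b / (2 * D)) * X := by
      have hV0 : 0 ≤ lyap D (2 * p) r := lyap_nonneg hD _ hr0
      have := lyap_le_of_lt hD (2 * p) h
      gcongr
    have h3 := mul_le_mul_of_nonneg_left hgrad hα.le
    have e : α * (b / D * X) = 2 * (α * (b / (2 * D)) * X) := by field_simp
    have h4 : 0 ≤ α ^ (p + 2) * (C * E * (1 / δ ^ p + 1)) := by positivity
    linarith

/-- No contraction, but it holds for every stepsize whose exponential moments are finite. It keeps
`E[V]` finite during the early steps, before the stepsizes are small enough for `exists_drift`. -/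
theorem Model.Assumptions.exists_crude_step (hM : M.Assumptions) (hD : 0 < D) (hm : 0 < m)
    (hb : 0 < b) (hG : M.Growth D m b) (q : ℕ) :
    ∃ A : ℝ, 0 ≤ A ∧ ∀ (θ : Vec d) (α : ℝ), 0 < α → M.al * α ≤ D / (4 * M.σx) →
      Integrable (fun ω => lyap D q ‖θ + α • M.dir θ (M.pair ω) - M.θstar‖) M.P ∧
      ∫ ω, lyap D q ‖θ + α • M.dir θ (M.pair ω) - M.θstar‖ ∂M.P ≤
        A * lyap D q ‖θ - M.θstar‖ + A := by
  have hσ := hM.data.σx_pos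
  have ha := hM.loss.al_pos
  obtain ⟨C, hC, hstep⟩ := hM.lyap_step hD q
  set s := D / (4 * M.σx) / M.al with hs
  have hs0 : 0 < s := by positivity
  set A₁ := C * (s ^ 2 * (D ^ q + s ^ q) * Real.exp 1) with hA₁
  set A₂ := 2 * (C * (s ^ 2 * (1 + s ^ q / D ^ q))) with hA₂
  have hA₁0 : 0 ≤ A₁ := by positivity
  have hA₂0 : 0 ≤ A₂ := by positivity
  refine ⟨1 + A₁ + A₂, by positivity, fun θ α hα hα' => ?_⟩
  obtain ⟨hI, hle⟩ := hstep θ α hα hα'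
  have hαs : α ≤ s := by rw [hs, le_div_iff₀ ha]; linarith
  refine ⟨hI, hle.trans ?_⟩
  have hr0 : 0 ≤ ‖θ - M.θstar‖ := norm_nonneg _
  have hin := hG.inner_nonneg hm hb θ
  have h0 : 0 ≤ α * (lyap' D q ‖θ - M.θstar‖ / ‖θ - M.θstar‖
      * inner ℝ (θ - M.θstar) (M.grad θ)) :=
    mul_nonneg hα.le (mul_nonneg (div_nonneg (lyap'_nonneg hD _ hr0) hr0) hin)
  set r := ‖θ - M.θstar‖
  have hV0 : 0 ≤ lyap D q r := lyap_nonneg hD _ hr0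
  have key : C * (α ^ 2 * (r ^ q + α ^ q) * Real.exp (r / D)) ≤ A₁ + A₂ * lyap D q r := by
    rcases le_or_gt r D with h | h
    · have hexp : Real.exp (r / D) ≤ Real.exp 1 := Real.exp_le_exp.2 ((div_le_one hD).2 h)
      have : C * (α ^ 2 * (r ^ q + α ^ q) * Real.exp (r / D)) ≤ A₁ := by
        rw [hA₁]; gcongr
      have : 0 ≤ A₂ * lyap D q r := by positivity
      linarith
    · have h1 := le_lyap_of_lt hD q h
      have h4 : D ^ q ≤ r ^ q := by gcongr
      have h2 : α ^ q ≤ s ^ q / D ^ q * r ^ q := by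
        have h5 : α ^ q ≤ s ^ q := by gcongr
        refine h5.trans ?_
        rw [div_mul_eq_mul_div, le_div_iff₀ (by positivity)]
        gcongr
      calc C * (α ^ 2 * (r ^ q + α ^ q) * Real.exp (r / D))
          ≤ C * (s ^ 2 * (r ^ q + s ^ q / D ^ q * r ^ q) * Real.exp (r / D)) := by gcongr
        _ = C * (s ^ 2 * (1 + s ^ q / D ^ q)) * (r ^ q * Real.exp (r / D)) := by ring
        _ ≤ C * (s ^ 2 * (1 + s ^ q / D ^ q)) * (2 * lyap D q r) := by gcongr
        _ = A₂ * lyap D q r := by rw [hA₂]; ring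
        _ ≤ _ := by linarith
  have : 0 ≤ A₁ * lyap D q r := by positivity
  linarith

end Drift

/-! ### Functions of past samples and their independence of the next one. -/

section Past

variable {Ω S E F : Type*} [MeasurableSpace S] [MeasurableSpace E] [MeasurableSpace F]

/-- `Z` is a measurable function of the first `n` samples. -/
def Past (ζ : ℕ → Ω → S) (n : ℕ) (Z : Ω → E) : Prop :=
  ∃ G : (Finset.range n → S) → E, Measurable G ∧ ∀ ω, Z ω = G fun i => ζ i ω

variable {ζ : ℕ → Ω → S} {n : ℕ} {Z : Ω → E} {W : Ω → F}

theorem Past.comp (h : Past ζ n Z) {φ : E → F} (hφ : Measurable φ) :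
    Past ζ n fun ω => φ (Z ω) := by
  obtain ⟨G, hG, e⟩ := h
  exact ⟨fun s => φ (G s), hφ.comp hG, fun ω => congrArg φ (e ω)⟩

theorem Past.prodMk (h : Past ζ n Z) (h' : Past ζ n W) : Past ζ n fun ω => (Z ω, W ω) := by
  obtain ⟨G, hG, e⟩ := h
  obtain ⟨H, hH, e'⟩ := h'
  exact ⟨fun s => (G s, H s), hG.prodMk hH, fun ω => Prod.ext (e ω) (e' ω)⟩

theorem past_const (c : E) : Past ζ n fun _ => c :=
  ⟨fun _ => c, measurable_const, fun _ => rfl⟩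

theorem Past.mono (h : Past ζ n Z) {k : ℕ} (hk : n ≤ k) : Past ζ k Z := by
  obtain ⟨G, hG, e⟩ := h
  refine ⟨fun s => G fun i => s ⟨i, Finset.mem_range.2 ((Finset.mem_range.1 i.2).trans_le hk)⟩,
    hG.comp (measurable_pi_lambda _ fun i => measurable_pi_apply _), fun ω => e ω⟩

theorem past_sample (ζ : ℕ → Ω → S) {i : ℕ} (hi : i < n) : Past ζ n (ζ i) :=
  ⟨fun s => s ⟨i, Finset.mem_range.2 hi⟩, measurable_pi_apply _, fun _ => rfl⟩

variable [MeasurableSpace Ω] {Q : Measure Ω}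

theorem Past.aemeasurable (h : Past ζ n Z) (hζ : ∀ i, AEMeasurable (ζ i) Q) :
    AEMeasurable Z Q := by
  obtain ⟨G, hG, e⟩ := h
  rw [show Z = fun ω => G fun i => ζ i ω from funext e]
  exact hG.comp_aemeasurable (aemeasurable_pi_lambda _ fun i => hζ i)

theorem Past.indepFun (h : Past ζ n Z) (hζ : ∀ i, AEMeasurable (ζ i) Q) (hi : iIndepFun ζ Q) :
    IndepFun Z (ζ n) Q := by
  obtain ⟨G, hG, e⟩ := h
  rw [show Z = fun ω => G fun i => ζ i ω from funext e]
  have h1 := hi.indepFun_finset₀ (Finset.range n) {n} (by simp) hζ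
  have h2 : Measurable fun s : ({n} : Finset ℕ) → S => s ⟨n, Finset.mem_singleton_self n⟩ :=
    measurable_pi_apply _
  exact h1.comp hG h2

variable {Ω₀ : Type*} [MeasurableSpace Ω₀] {P : Measure Ω₀} {π : Ω₀ → S} [IsProbabilityMeasure Q]

/-- The joint law is a product, so Fubini averages over `W` with `Z` frozen. It serves both for past
and next sample and for covariate and noise. -/
theorem integral_eq_integral_integral_of_indepFun {W : Ω → S} (hZ : AEMeasurable Z Q)
    (hW : IdentDistrib W π Q P) (hi : IndepFun Z W Q) {f : E × S → ℝ} (hf : Measurable f)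
    (hI : Integrable (fun ω => f (Z ω, W ω)) Q) :
    ∫ ω, f (Z ω, W ω) ∂Q = ∫ ω, ∫ ω', f (Z ω, π ω') ∂P ∂Q := by
  have hm := hW.aemeasurable_fst
  have hπ := hW.aemeasurable_snd
  have hmap : Q.map (fun ω => (Z ω, W ω)) = (Q.map Z).prod (P.map π) := by
    rw [← hW.map_eq]
    exact (indepFun_iff_map_prod_eq_prod_map_map hZ hm).1 hi
  have hP : IsProbabilityMeasure (P.map π) := by
    rw [← hW.map_eq]; exact Measure.isProbabilityMeasure_map hm
  have hQZ : IsProbabilityMeasure (Q.map Z) := Measure.isProbabilityMeasure_map hZ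
  have hZW : AEMeasurable (fun ω => (Z ω, W ω)) Q := hZ.prodMk hm
  have hI' : Integrable f ((Q.map Z).prod (P.map π)) := by
    rw [← hmap]
    exact (integrable_map_measure hf.aestronglyMeasurable hZW).2 hI
  have h1 := integral_map hZW (f := f) hf.aestronglyMeasurable
  rw [← h1, hmap, integral_prod _ hI', integral_map hZ hI'.integral_prod_left.aestronglyMeasurable]
  refine integral_congr_ae (Filter.Eventually.of_forall fun ω => ?_)
  exact integral_map hπ (hf.comp measurable_prodMk_left).aestronglyMeasurable

theorem Past.map_prod (h : Past ζ n Z) (hζ : ∀ i, IdentDistrib (ζ i) π Q P)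
    (hi : iIndepFun ζ Q) :
    Q.map (fun ω => (Z ω, ζ n ω)) = (Q.map Z).prod (P.map π) := by
  have hm : ∀ i, AEMeasurable (ζ i) Q := fun i => (hζ i).aemeasurable_fst
  rw [← (hζ n).map_eq]
  exact (indepFun_iff_map_prod_eq_prod_map_map (h.aemeasurable hm) (hm n)).1 (h.indepFun hm hi)

theorem Past.integral_eq (h : Past ζ n Z) (hζ : ∀ i, IdentDistrib (ζ i) π Q P)
    (hi : iIndepFun ζ Q) {f : E × S → ℝ} (hf : Measurable f)
    (hI : Integrable (fun ω => f (Z ω, ζ n ω)) Q) :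
    ∫ ω, f (Z ω, ζ n ω) ∂Q = ∫ ω, ∫ ω', f (Z ω, π ω') ∂P ∂Q :=
  have hm : ∀ i, AEMeasurable (ζ i) Q := fun i => (hζ i).aemeasurable_fst
  integral_eq_integral_integral_of_indepFun (h.aemeasurable hm) (hζ n) (h.indepFun hm hi) hf hI

/-- Integrability of the composite is a conclusion: `f` is nonnegative, so it follows from the bound
`B` on the sections and the integrability of `B ∘ Z`. -/
theorem Past.meanLE (h : Past ζ n Z) (hζ : ∀ i, IdentDistrib (ζ i) π Q P)
    (hi : iIndepFun ζ Q) {f : E × S → ℝ} (hf : Measurable f) (hf0 : ∀ q, 0 ≤ f q) {B : E → ℝ}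
    (hB : Measurable B) (hstep : ∀ z, MeanLE P (fun ω => f (z, π ω)) (B z))
    (hBI : Integrable (fun ω => B (Z ω)) Q) :
    MeanLE Q (fun ω => f (Z ω, ζ n ω)) (∫ ω, B (Z ω) ∂Q) := by
  have hm : ∀ i, AEMeasurable (ζ i) Q := fun i => (hζ i).aemeasurable_fst
  have hZ := h.aemeasurable hm
  have hπ := (hζ n).aemeasurable_snd
  have hmap := h.map_prod hζ hi
  have hP : IsProbabilityMeasure (P.map π) := by
    rw [← (hζ n).map_eq]; exact Measure.isProbabilityMeasure_map (hm n)
  have hQZ : IsProbabilityMeasure (Q.map Z) := Measure.isProbabilityMeasure_map hZ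
  have hZζ : AEMeasurable (fun ω => (Z ω, ζ n ω)) Q := hZ.prodMk (hm n)
  have hsec : ∀ z, Measurable fun s => f (z, s) := fun z => hf.comp measurable_prodMk_left
  have hinner : ∀ z, ∫ s, ‖f (z, s)‖ ∂(P.map π) ≤ B z := fun z => by
    simp only [Real.norm_of_nonneg (hf0 _)]
    rw [integral_map hπ (hsec z).aestronglyMeasurable]
    exact (hstep z).2
  have hI' : Integrable f ((Q.map Z).prod (P.map π)) := by
    rw [integrable_prod_iff hf.aestronglyMeasurable]
    refine ⟨Filter.Eventually.of_forall fun z =>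
      (integrable_map_measure (hsec z).aestronglyMeasurable hπ).2 (hstep z).1, ?_⟩
    refine ((integrable_map_measure hB.aestronglyMeasurable hZ).2 hBI).mono'
      hf.aestronglyMeasurable.norm.integral_prod_right' (Filter.Eventually.of_forall fun z => ?_)
    rw [Real.norm_of_nonneg (integral_nonneg fun s => norm_nonneg _)]
    exact hinner z
  have hI : Integrable (fun ω => f (Z ω, ζ n ω)) Q := by
    rw [← hmap] at hI'
    exact (integrable_map_measure hf.aestronglyMeasurable hZζ).1 hI'
  refine ⟨hI, ?_⟩
  rw [h.integral_eq hζ hi hf hI]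
  by_cases hint : Integrable (fun ω => ∫ ω', f (Z ω, π ω') ∂P) Q
  · exact integral_mono hint hBI fun ω => (hstep (Z ω)).2
  · rw [integral_undef hint]
    refine integral_nonneg fun ω => le_trans ?_ (hstep (Z ω)).2
    exact integral_nonneg fun ω' => hf0 _

end Past

/-! ### Moment bounds for the iterates. -/

section Iterates

variable {d : ℕ} {Ω₀ : Type*} [MeasurableSpace Ω₀] {M : Model d Ω₀} {Ω : Type*}
  {X : ℕ → Ω → Vec d} {Y : ℕ → Ω → ℝ}

/-- The observed pairs `(X_n, Y_n)`. -/
def sample (X : ℕ → Ω → Vec d) (Y : ℕ → Ω → ℝ) (n : ℕ) (ω : Ω) : Vec d × ℝ := (X n ω, Y n ω)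

theorem Model.iter_succ (M : Model d Ω₀) (α : ℕ → ℝ) (θ₀ : Vec d) (n : ℕ) (ω : Ω) :
    iter M.l α X Y θ₀ (n + 1) ω = iter M.l α X Y θ₀ n ω
      + α n • M.dir (iter M.l α X Y θ₀ n ω) (sample X Y n ω) := by
  rw [iter, Model.dir, mul_smul]; rfl

theorem Model.Assumptions.past_iter (hM : M.Assumptions) (α : ℕ → ℝ) (θ₀ : Vec d) (n : ℕ) :
    Past (sample X Y) n (iter M.l α X Y θ₀ n) := by
  induction n with
  | zero => exact past_const θ₀
  | succ n ih =>
    have h1 := (ih.mono n.le_succ).prodMk (past_sample (sample X Y) n.lt_succ_self)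
    have h2 : Measurable fun q : Vec d × (Vec d × ℝ) => q.1 + α n • M.dir q.1 q.2 := by
      have := hM.loss.continuous_dir
      exact (continuous_fst.add (this.const_smul (α n))).measurable
    rw [show iter M.l α X Y θ₀ (n + 1) = fun ω => iter M.l α X Y θ₀ n ω
      + α n • M.dir (iter M.l α X Y θ₀ n ω) (sample X Y n ω) from
      funext fun ω => M.iter_succ α θ₀ n ω]
    exact h1.comp h2

variable [MeasurableSpace Ω] {Q : Measure Ω}

theorem Model.Assumptions.meanLE_norm_pow (hM : M.Assumptions) (hXY : M.IsSample Q X Y)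
    {D : ℝ} (hD : 0 < D) (q : ℕ) {α : ℕ → ℝ} {θ₀ : Vec d} {n : ℕ} {e : ℝ}
    (h : MeanLE Q (fun ω => lyap D q ‖iter M.l α X Y θ₀ n ω - M.θstar‖) e) :
    MeanLE Q (fun ω => ‖iter M.l α X Y θ₀ n ω - M.θstar‖ ^ (q + 2))
      (2 * D ^ 2 / Real.exp 1 * e) := by
  have hpt : ∀ ω, ‖iter M.l α X Y θ₀ n ω - M.θstar‖ ^ (q + 2)
      ≤ 2 * D ^ 2 / Real.exp 1 * lyap D q ‖iter M.l α X Y θ₀ n ω - M.θstar‖ := fun ω => by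
    have := pow_le_lyap hD q (norm_nonneg (iter M.l α X Y θ₀ n ω - M.θstar))
    rwa [mul_div_right_comm] at this
  have hm := (hM.past_iter (X := X) (Y := Y) α θ₀ n).aemeasurable
    (Q := Q) fun i => (hXY.ident i).aemeasurable_fst
  have hI : Integrable (fun ω => ‖iter M.l α X Y θ₀ n ω - M.θstar‖ ^ (q + 2)) Q := by
    refine (h.1.const_mul (2 * D ^ 2 / Real.exp 1)).mono'
      ((hm.sub_const _).norm.pow_const _).aestronglyMeasurable
      (Filter.Eventually.of_forall fun ω => ?_)
    rw [Real.norm_of_nonneg (by positivity)]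
    exact hpt ω
  refine ⟨hI, (integral_mono hI (h.1.const_mul _) hpt).trans ?_⟩
  rw [integral_const_mul]
  gcongr
  exact h.2

theorem MeanLE.congr_bound {Z : Ω → ℝ} {B B' : ℝ} (h : MeanLE Q Z B) (e : B ≤ B') :
    MeanLE Q Z B' := ⟨h.1, h.2.trans e⟩

variable [IsProbabilityMeasure Q]

theorem Model.Assumptions.meanLE_lyap_succ (hM : M.Assumptions) (hXY : M.IsSample Q X Y)
    {D : ℝ} (hD : 0 < D) (q : ℕ) {α : ℕ → ℝ} {θ₀ : Vec d} {n : ℕ} {A B e : ℝ} (hA : 0 ≤ A)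
    (hstep : ∀ θ : Vec d, MeanLE M.P
      (fun ω => lyap D q ‖θ + α n • M.dir θ (M.pair ω) - M.θstar‖)
      (A * lyap D q ‖θ - M.θstar‖ + B))
    (ih : MeanLE Q (fun ω => lyap D q ‖iter M.l α X Y θ₀ n ω - M.θstar‖) e) :
    MeanLE Q (fun ω => lyap D q ‖iter M.l α X Y θ₀ (n + 1) ω - M.θstar‖) (A * e + B) := by
  have hdir := hM.loss.continuous_dir
  have hl := continuous_lyap hD q
  have h1 := (hM.past_iter (X := X) (Y := Y) α θ₀ n).meanLE hXY.ident hXY.indep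
    (f := fun p => lyap D q ‖p.1 + α n • M.dir p.1 p.2 - M.θstar‖)
    (B := fun θ => A * lyap D q ‖θ - M.θstar‖ + B)
    (hl.comp (((continuous_fst.add (hdir.const_smul (α n))).sub
      continuous_const).norm)).measurable
    (fun p => lyap_nonneg hD q (norm_nonneg _))
    (((hl.comp (continuous_id.sub continuous_const).norm).const_mul A).add
      continuous_const).measurable hstep ((ih.1.const_mul A).add (integrable_const B))
  simp only [M.iter_succ]
  refine ⟨h1.1, h1.2.trans ?_⟩
  rw [integral_add (ih.1.const_mul A) (integrable_const B), integral_const_mul]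
  simp only [integral_const, probReal_univ, smul_eq_mul, one_mul]
  gcongr
  exact ih.2

theorem meanLE_const (c : ℝ) : MeanLE Q (fun _ => c) c :=
  ⟨integrable_const c, by simp⟩

/-- Constant stepsize: moments of all even orders. -/
theorem Model.Assumptions.constant_stepsize (hM : M.Assumptions) (hd : 0 < d)
    (hXY : M.IsSample Q X Y) {b : ℝ} (hb : 0 < b) (hT : M.TailConst b) (p : ℕ) :
    ∃ αp : ℝ, 0 < αp ∧ ∃ D : ℝ, ∀ α : ℝ, 0 < α → α ≤ αp → ∀ (θ₀ : Vec d) (n : ℕ),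
      MeanLE Q (fun ω => ‖iter M.l (fun _ => α) X Y θ₀ n ω - M.θstar‖ ^ (2 * p + 2))
        (2 * M.Δ ^ 2 * M.V (2 * p) θ₀ / Real.exp 1 * (1 - α * M.rate b p) ^ n
          + α ^ (p + 1) * D) := by
  have hΔ := hM.Δ_pos hd
  have hρ := hM.rate_pos hd hb p
  obtain ⟨c, α₀, hc, hα₀, hdrift⟩ := hM.exists_drift hΔ hM.μ_pos hb (hM.growth hd hT) p hρ.le
    (min_le_left _ _) (min_le_right _ _)
  set ρ := M.rate b p
  -- The bound `1 / ρ` keeps the contraction factor nonnegative. The constant comes from the fixed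
  -- point `α ^ (p + 1) * (c / ρ)` of `e ↦ (1 - α * ρ) * e + α ^ (p + 2) * c`.
  refine ⟨min α₀ (1 / ρ), lt_min hα₀ (by positivity), 2 * M.Δ ^ 2 / Real.exp 1 * (c / ρ),
    fun α hα hα' θ₀ n => ?_⟩
  have hα1 : α ≤ α₀ := hα'.trans (min_le_left _ _)
  have hα2 : α * ρ ≤ 1 := by
    have := hα'.trans (min_le_right _ _)
    rwa [le_div_iff₀ hρ] at this
  have key : MeanLE Q (fun ω => lyap M.Δ (2 * p) ‖iter M.l (fun _ => α) X Y θ₀ n ω - M.θstar‖)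
      (M.V (2 * p) θ₀ * (1 - α * ρ) ^ n + α ^ (p + 1) * (c / ρ)) := by
    induction n with
    | zero =>
      refine (meanLE_const (M.V (2 * p) θ₀)).congr_bound ?_
      have : 0 ≤ α ^ (p + 1) * (c / ρ) := by positivity
      simp only [pow_zero, mul_one]
      linarith
    | succ n ih =>
      have h1 := hM.meanLE_lyap_succ hXY hΔ (2 * p) (α := fun _ => α) (A := 1 - α * ρ)
        (B := α ^ (p + 2) * c) (sub_nonneg.2 hα2) (fun θ => hdrift θ α hα hα1) ih
      refine h1.congr_bound (le_of_eq ?_)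
      have e : c / ρ * ρ = c := div_mul_cancel₀ c hρ.ne'
      generalize c / ρ = w at e
      linear_combination (-α ^ (p + 2)) * e
  refine (hM.meanLE_norm_pow hXY hΔ _ key).congr_bound (le_of_eq ?_)
  ring

theorem Model.Assumptions.exists_Drift (hM : M.Assumptions) (hd : 0 < d) {b : ℝ} (hb : 0 < b)
    (hT : M.TailConst b) : ∃ c α₀ : ℝ, 0 < α₀ ∧ M.Drift b c α₀ := by
  have hρ := hM.rate_pos hd hb 0
  obtain ⟨c, α₀, -, hα₀, hdrift⟩ := hM.exists_drift (hM.Δ_pos hd) hM.μ_pos hb (hM.growth hd hT) 0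
    hρ.le (min_le_left _ _) (min_le_right _ _)
  refine ⟨c, α₀, hα₀, fun θ α hα hα' => ?_⟩
  simp only [M.sub_grad_add_noise, M.V_eq]
  exact hdrift θ α hα hα'

/-- At `θ*` the drift inequality reads `0 ≤ E[V] ≤ α₀ ^ 2 * c`, because `V` vanishes there. -/
theorem Model.Assumptions.drift_const_nonneg (hM : M.Assumptions) (hd : 0 < d) {b c α₀ : ℝ}
    (hα₀ : 0 < α₀) (h : M.Drift b c α₀) : 0 ≤ c := by
  have hΔ := hM.Δ_pos hd
  have h1 := (h M.θstar α₀ hα₀ le_rfl).2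
  have h2 : 0 ≤ ∫ ω, M.V 0 (M.θstar - α₀ • (M.grad M.θstar + M.noise M.θstar ω)) ∂M.P :=
    integral_nonneg fun ω => lyap_nonneg hΔ 0 (norm_nonneg _)
  have h3 : M.V 0 M.θstar = 0 := by
    rw [M.V_eq, sub_self, norm_zero, lyap_of_le _ hΔ.le]; simp
  rw [h3, mul_zero, zero_add] at h1
  exact nonneg_of_mul_nonneg_right (h2.trans h1) (by positivity)

/-- Comparison principle: any supersolution `e` of the scalar recursion bounds `E[V]`. -/
theorem Model.Assumptions.meanLE_of_drift (hM : M.Assumptions) (hd : 0 < d)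
    (hXY : M.IsSample Q X Y) {b c α₀ : ℝ} (h : M.Drift b c α₀) {α : ℕ → ℝ} (hα : ∀ n, 0 < α n)
    (hα' : ∀ n, α n ≤ α₀) (hαρ : ∀ n, α n * M.rate b 0 ≤ 1) {θ₀ : Vec d} {e : ℕ → ℝ}
    (h0 : M.V 0 θ₀ ≤ e 0)
    (hs : ∀ n, (1 - α n * M.rate b 0) * e n + α n ^ 2 * c ≤ e (n + 1)) (n : ℕ) :
    MeanLE Q (fun ω => ‖iter M.l α X Y θ₀ n ω - M.θstar‖ ^ 2)
      (2 * M.Δ ^ 2 / Real.exp 1 * e n) := by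
  have hΔ := hM.Δ_pos hd
  refine hM.meanLE_norm_pow hXY hΔ 0 ?_
  induction n with
  | zero => exact (meanLE_const (M.V 0 θ₀)).congr_bound h0
  | succ n ih =>
    refine (hM.meanLE_lyap_succ hXY hΔ 0 (sub_nonneg.2 (hαρ n)) (fun θ => ?_) ih).congr_bound (hs n)
    have := h θ (α n) (hα n) (hα' n)
    simp only [M.sub_grad_add_noise, M.V_eq] at this
    exact this

/-- Stepsizes of order `1 / n`. -/
theorem Model.Assumptions.harmonic_stepsize (hM : M.Assumptions) (hd : 0 < d)
    (hXY : M.IsSample Q X Y) {b c α₀ : ℝ} (hb : 0 < b) (hα₀ : 0 < α₀) (h : M.Drift b c α₀) {ι : ℝ}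
    (hι : 1 / M.rate b 0 < ι) :
    ∃ κι : ℝ, 0 < κι ∧ ∀ κ : ℝ, κι ≤ κ → ∀ (θ₀ : Vec d) (n : ℕ),
      MeanLE Q (fun ω => ‖iter M.l (fun k => ι / ((k : ℝ) + κ)) X Y θ₀ n ω - M.θstar‖ ^ 2)
        (2 * M.Δ ^ 2 * M.V 0 θ₀ / Real.exp 1 * (κ / (n + κ)) ^ (ι * M.rate b 0)
          + 8 * Real.exp 1 * ι ^ 2 * M.Δ ^ 2 * c / ((ι * M.rate b 0 - 1) * Real.exp 1)
            * (1 / (n + κ))) := by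
  have hΔ := hM.Δ_pos hd
  have hρ := hM.rate_pos hd hb 0
  have hc := hM.drift_const_nonneg hd hα₀ h
  have hι0 : 0 < ι := lt_trans (by positivity) hι
  rw [div_lt_iff₀ hρ] at hι
  -- The two lower bounds on `κ` say that every stepsize is at most `α₀` and that every contraction
  -- factor is nonnegative.
  refine ⟨max (ι / α₀) (ι * M.rate b 0), lt_max_of_lt_left (by positivity),
    fun κ hκ θ₀ n => ?_⟩
  have hκ1 : ι / α₀ ≤ κ := (le_max_left _ _).trans hκ
  have hκ2 : ι * M.rate b 0 ≤ κ := (le_max_right _ _).trans hκ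
  have hκ0 : 0 < κ := lt_of_lt_of_le (by positivity) hκ1
  have hm : ∀ k : ℕ, 0 < (k : ℝ) + κ := fun k => by positivity
  rw [div_le_iff₀ hα₀] at hκ1
  have hV : 0 ≤ M.V 0 θ₀ := lyap_nonneg hΔ 0 (norm_nonneg _)
  refine (hM.meanLE_of_drift hd hXY h (α := fun k : ℕ => ι / ((k : ℝ) + κ))
    (fun k => div_pos hι0 (hm k)) (fun k => ?_) (fun k => ?_)
    (e := fun k : ℕ => M.V 0 θ₀ * (κ / (k + κ)) ^ (ι * M.rate b 0)
        + 4 * ι ^ 2 * Real.exp 1 * c / (ι * M.rate b 0 - 1) * (1 / (k + κ))) ?_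
    (harmonic_step hι0 hι hκ0 hc hV) n).congr_bound (le_of_eq ?_)
  · rw [div_le_iff₀ (hm k)]
    nlinarith [mul_nonneg hα₀.le (k.cast_nonneg : (0 : ℝ) ≤ k)]
  · rw [div_mul_eq_mul_div, div_le_one (hm k)]
    linarith [(k.cast_nonneg : (0 : ℝ) ≤ k)]
  · have : 0 < ι * M.rate b 0 - 1 := by linarith
    have : 0 ≤ 4 * ι ^ 2 * Real.exp 1 * c / (ι * M.rate b 0 - 1) * (1 / κ) := by positivity
    simp [hκ0.ne'] at this ⊢
    linarith
  · rw [mul_comm (ι * M.rate b 0 - 1) (Real.exp 1), ← div_div]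
    ring

/-- Stepsizes of order `1 / n ^ ξ`. -/
theorem Model.Assumptions.polynomial_stepsize (hM : M.Assumptions) (hd : 0 < d)
    (hXY : M.IsSample Q X Y) {b c α₀ : ℝ} (hb : 0 < b) (hα₀ : 0 < α₀) (h : M.Drift b c α₀)
    {ξ : ℝ} (hξ : 0 < ξ) (hξ1 : ξ < 1) {ι : ℝ} (hι : 0 < ι) :
    ∃ κι : ℝ, 0 < κι ∧ ∀ κ : ℝ, κι ≤ κ → ∀ (θ₀ : Vec d) (n : ℕ),
      MeanLE Q (fun ω => ‖iter M.l (fun k => ι / ((k : ℝ) + κ) ^ ξ) X Y θ₀ n ω - M.θstar‖ ^ 2)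
        (2 * M.Δ ^ 2 * M.V 0 θ₀ / Real.exp 1
            * Real.exp (-(M.rate b 0 * ι / (1 - ξ) * (((n : ℝ) + κ) ^ (1 - ξ) - κ ^ (1 - ξ))))
          + 4 * ι * M.Δ ^ 2 * c / (M.rate b 0 * Real.exp 1) * (1 / ((n : ℝ) + κ) ^ ξ)) := by
  have hΔ := hM.Δ_pos hd
  have hρ := hM.rate_pos hd hb 0
  have hc := hM.drift_const_nonneg hd hα₀ h
  have t1 := tendsto_rpow_atTop hξ
  have t2 := tendsto_rpow_atTop (sub_pos.2 hξ1)
  obtain ⟨K, hK⟩ := Filter.eventually_atTop.1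
    (((t1.eventually_ge_atTop (ι / α₀)).and (t1.eventually_ge_atTop (ι * M.rate b 0))).and
      (t2.eventually_ge_atTop (2 * ξ / (M.rate b 0 * ι))))
  refine ⟨max K 1, lt_max_of_lt_right one_pos, fun κ hκ θ₀ n => ?_⟩
  have hκK : K ≤ κ := (le_max_left _ _).trans hκ
  have hκ0 : 0 < κ := lt_of_lt_of_le one_pos ((le_max_right _ _).trans hκ)
  have hm : ∀ k : ℕ, 0 < (k : ℝ) + κ := fun k => by positivity
  have hmK : ∀ k : ℕ, K ≤ (k : ℝ) + κ := fun k => by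
    linarith [(k.cast_nonneg : (0 : ℝ) ≤ k)]
  have hV : 0 ≤ M.V 0 θ₀ := lyap_nonneg hΔ 0 (norm_nonneg _)
  refine (hM.meanLE_of_drift hd hXY h (α := fun k : ℕ => ι / ((k : ℝ) + κ) ^ ξ)
    (fun k => div_pos hι (Real.rpow_pos_of_pos (hm k) _)) (fun k => ?_) (fun k => ?_)
    (e := fun k : ℕ => M.V 0 θ₀
          * Real.exp (-(M.rate b 0 * ι / (1 - ξ) * (((k : ℝ) + κ) ^ (1 - ξ) - κ ^ (1 - ξ))))
        + 2 * ι * c / M.rate b 0 * (1 / ((k : ℝ) + κ) ^ ξ)) ?_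
    (fun k => ?_) n).congr_bound (le_of_eq ?_)
  · have h1 := (hK _ (hmK k)).1.1
    rw [div_le_iff₀ hα₀] at h1
    rw [div_le_iff₀ (Real.rpow_pos_of_pos (hm k) _)]
    linarith
  · have h1 := (hK _ (hmK k)).1.2
    rwa [div_mul_eq_mul_div, div_le_one (Real.rpow_pos_of_pos (hm k) _)]
  · have : 0 ≤ 2 * ι * c / M.rate b 0 * (1 / κ ^ ξ) := by positivity
    simp at this ⊢
    linarith
  · have h1 := polynomial_step (κ₀ := κ) hι hρ hξ hξ1 hc hV (hm k) (hK _ (hmK k)).2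
    have e : ((k + 1 : ℕ) : ℝ) + κ = ((k : ℝ) + κ) + 1 := by push_cast; ring
    simp only [e]
    exact h1
  · ring

end Iterates

/-! ### Linearization of the gradient and noise covariance at the true parameter. -/

section Linearization

variable {d : ℕ} {Ω₀ : Type*} [MeasurableSpace Ω₀] {M : Model d Ω₀}

theorem Model.LossAssumption.abs_deriv2_le (h : M.LossAssumption) (t : ℝ) :
    |deriv (deriv M.l) t| ≤ M.Ll := by
  have hL : LipschitzWith ⟨M.Ll, h.Ll_nonneg⟩ (deriv M.l) :=
    LipschitzWith.of_dist_le_mul fun t t' => by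
      rw [Real.dist_eq, Real.dist_eq]; exact h.lipschitz t t'
  exact norm_deriv_le_of_lipschitz hL

theorem Model.LossAssumption.deriv2_ge (h : M.LossAssumption) (hdiff : Differentiable ℝ (deriv M.l))
    {t : ℝ} (ht : |t| < M.Δl) : M.μl ≤ deriv (deriv M.l) t := by
  have h1 := (hdiff t).hasDerivAt.tendsto_slope
  have h2 : Filter.Tendsto (slope (deriv M.l) t) (nhdsWithin t (Set.Ioi t))
      (nhds (deriv (deriv M.l) t)) :=
    h1.mono_left (nhdsWithin_mono t fun s hs => ne_of_gt hs)
  refine ge_of_tendsto h2 ?_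
  have h3 : ∀ᶠ s in nhdsWithin t (Set.Ioi t), |s| < M.Δl :=
    nhdsWithin_le_nhds (continuous_abs.continuousAt.eventually (gt_mem_nhds ht))
  filter_upwards [h3, self_mem_nhdsWithin] with s hs hts
  have hts' : 0 < s - t := sub_pos.2 hts
  rw [slope_def_field, le_div_iff₀ hts']
  exact h.strong s t hs.le ht.le (le_of_lt hts)

theorem Model.LossAssumption.deriv2_nonneg (h : M.LossAssumption) (t : ℝ) :
    0 ≤ deriv (deriv M.l) t := h.mono.deriv_nonneg

theorem Model.meanDeriv2_eq (M : Model d Ω₀) (u : ℝ) :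
    M.meanDeriv2 u = ∫ ω, deriv (deriv M.l) (M.z ω + u) ∂M.P := rfl

/-- `l''` is nonnegative everywhere and at least `μl` on `|t| < Δl`, where `ε + s` lies with
positive probability. -/
theorem Model.Assumptions.meanDeriv2_pos (hM : M.Assumptions)
    (hdiff : Differentiable ℝ (deriv M.l)) : 0 < M.meanDeriv2 0 := by
  have := hM.data.isProb
  have hz := hM.data.aemeasurable_z
  set S := Set.Icc (-M.Δεs) M.Δεs with hS
  have hI : Integrable (fun ω => deriv (deriv M.l) (M.z ω + 0)) M.P :=
    (integrable_const M.Ll).mono' ((measurable_deriv (deriv M.l)).comp_aemeasurable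
      (hz.add_const 0)).aestronglyMeasurable
      (Filter.Eventually.of_forall fun ω => hM.loss.abs_deriv2_le _)
  have hF : Integrable (fun ω => S.indicator (fun _ => (1 : ℝ)) (M.z ω)) M.P :=
    (integrable_const (1 : ℝ)).mono'
      ((measurable_const.indicator measurableSet_Icc).comp_aemeasurable hz).aestronglyMeasurable
      (Filter.Eventually.of_forall fun ω => by by_cases h : M.z ω ∈ S <;> simp [h])
  have h1 : ∫ ω, M.μl * S.indicator (fun _ => (1 : ℝ)) (M.z ω) ∂M.P ≤ M.meanDeriv2 0 := by
    rw [M.meanDeriv2_eq]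
    refine integral_mono (hF.const_mul _) hI fun ω => ?_
    simp only [add_zero]
    by_cases h : M.z ω ∈ S
    · rw [Set.indicator_of_mem h, mul_one]
      exact hM.loss.deriv2_ge hdiff ((abs_le.2 h).trans_lt hM.Δεs_lt)
    · rw [Set.indicator_of_notMem h, mul_zero]
      exact hM.loss.deriv2_nonneg _
  rw [integral_const_mul, integral_indicator_comp hz measurableSet_Icc] at h1
  have e : M.z ⁻¹' S = {ω | |M.ε ω + M.s ω| ≤ M.Δεs} := by
    ext ω; simp [Model.z, hS, abs_le]
  rw [e] at h1
  exact lt_of_lt_of_le (mul_pos hM.loss.μl_pos hM.prob_pos) h1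

/-- `E[l'(ε + s + u)]`. -/
noncomputable def Model.meanDeriv (M : Model d Ω₀) (u : ℝ) : ℝ :=
  ∫ ω, deriv M.l (M.z ω + u) ∂M.P

theorem Model.Assumptions.integrable_deriv_z_add (hM : M.Assumptions) (u : ℝ) :
    Integrable (fun ω => deriv M.l (M.z ω + u)) M.P := by
  have := hM.data.isProb
  exact (integrable_const M.al).mono' (hM.loss.continuous_deriv.measurable.comp_aemeasurable
    (hM.data.aemeasurable_z.add_const u)).aestronglyMeasurable
    (Filter.Eventually.of_forall fun ω => hM.loss.bounded _)

theorem Model.Assumptions.hasDerivAt_meanDeriv (hM : M.Assumptions)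
    (hdiff : Differentiable ℝ (deriv M.l)) (u : ℝ) :
    HasDerivAt M.meanDeriv (M.meanDeriv2 u) u := by
  have := hM.data.isProb
  have hz := hM.data.aemeasurable_z
  refine (hasDerivAt_integral_of_dominated_loc_of_deriv_le (s := Set.univ)
    (F := fun u ω => deriv M.l (M.z ω + u)) (F' := fun u ω => deriv (deriv M.l) (M.z ω + u))
    (bound := fun _ => M.Ll) Filter.univ_mem
    (Filter.Eventually.of_forall fun u => (hM.integrable_deriv_z_add u).aestronglyMeasurable)
    (hM.integrable_deriv_z_add u) ((measurable_deriv (deriv M.l)).comp_aemeasurable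
      (hz.add_const u)).aestronglyMeasurable
    (Filter.Eventually.of_forall fun ω u _ => hM.loss.abs_deriv2_le _) (integrable_const _)
    (Filter.Eventually.of_forall fun ω u _ => ?_)).2
  exact HasDerivAt.comp_const_add (M.z ω) u (hdiff (M.z ω + u)).hasDerivAt

theorem Model.Assumptions.abs_meanDeriv_sub_le (hM : M.Assumptions)
    (hdiff : Differentiable ℝ (deriv M.l)) {K : ℝ}
    (hK : ∀ u : ℝ, |M.meanDeriv2 u - M.meanDeriv2 0| ≤ K * |u|) (u : ℝ) :
    |M.meanDeriv u - M.meanDeriv 0 - M.meanDeriv2 0 * u| ≤ K * u ^ 2 := by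
  have hK0 : 0 ≤ K := by
    have := (abs_nonneg _).trans (hK 1); simpa using this
  have hd : ∀ t ∈ Set.Icc (-|u|) |u|, HasDerivWithinAt
      (fun t => M.meanDeriv t - M.meanDeriv2 0 * t) (M.meanDeriv2 t - M.meanDeriv2 0)
      (Set.Icc (-|u|) |u|) t := fun t _ =>
    (((hM.hasDerivAt_meanDeriv hdiff t).sub
      ((hasDerivAt_id' t).const_mul _)).congr_deriv (by ring)).hasDerivWithinAt
  have hb : ∀ t ∈ Set.Icc (-|u|) |u|, ‖M.meanDeriv2 t - M.meanDeriv2 0‖ ≤ K * |u| :=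
    fun t ht => (hK t).trans (by have := abs_le.2 ht; gcongr)
  have h0 : (0 : ℝ) ∈ Set.Icc (-|u|) |u| := by simp
  have hu : u ∈ Set.Icc (-|u|) |u| := ⟨neg_abs_le u, le_abs_self u⟩
  have := (convex_Icc (-|u|) |u|).norm_image_sub_le_of_norm_hasDerivWithin_le hd hb h0 hu
  rw [sub_zero, Real.norm_eq_abs, Real.norm_eq_abs, mul_assoc, abs_mul_abs_self, ← sq] at this
  convert this using 2
  ring

/-- Averaging over the noise with `x` fixed replaces `l'` by its smoothed version. This is why
regularity of `u ↦ E[l''(ε + s + u)]` can stand in for regularity of `l''`. -/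
theorem Model.Assumptions.inner_grad_eq_meanDeriv (hM : M.Assumptions) (v u : Vec d) :
    inner ℝ u (M.grad (M.θstar + v)) =
      ∫ ω, (M.meanDeriv 0 - M.meanDeriv (-inner ℝ (M.x ω) v)) * inner ℝ (M.x ω) u ∂M.P := by
  have := hM.data.isProb
  have hg := hM.loss.continuous_deriv
  rw [hM.inner_grad]
  have key := integral_eq_integral_integral_of_indepFun hM.data.aemeasurable_x
    (IdentDistrib.refl hM.data.aemeasurable_z) hM.data.indep_z
    (f := fun q : Vec d × ℝ => (deriv M.l q.2 - deriv M.l (q.2 - inner ℝ q.1 v)) * inner ℝ q.1 u)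
    (by fun_prop : Continuous _).measurable (hM.integrable_monotone_gap v u)
  rw [key]
  congr 1; ext ω
  simp only
  rw [integral_mul_const]
  congr 1
  have h1 := hM.integrable_deriv_z_add 0
  have h2 := hM.integrable_deriv_z_add (-inner ℝ (M.x ω) v)
  rw [Model.meanDeriv, Model.meanDeriv, ← integral_sub h1 h2]
  simp [sub_eq_add_neg]

/-- The remainder `R` is tested against itself: isotropy turns `h * ⟨v, R⟩` into an expectation, the
pointwise Taylor error is at most `K * ‖x‖ ^ 3 * ‖v‖ ^ 2 * ‖R‖`, and one factor `‖R‖` cancels. -/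
theorem Model.Assumptions.exists_grad_remainder (hM : M.Assumptions)
    (hdiff : Differentiable ℝ (deriv M.l)) {K : ℝ}
    (hK : ∀ u : ℝ, |M.meanDeriv2 u - M.meanDeriv2 0| ≤ K * |u|) :
    ∃ C : ℝ, 0 ≤ C ∧ ∀ θ : Vec d,
      ‖M.grad θ - M.meanDeriv2 0 • (θ - M.θstar)‖ ≤ C * ‖θ - M.θstar‖ ^ 2 := by
  have hK0 : 0 ≤ K := by
    have := (abs_nonneg _).trans (hK 1); simpa using this
  have hκ : 0 ≤ ∫ ω, ‖M.x ω‖ ^ 3 ∂M.P := integral_nonneg fun ω => by positivity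
  refine ⟨K * ∫ ω, ‖M.x ω‖ ^ 3 ∂M.P, by positivity, fun θ => ?_⟩
  obtain ⟨v, rfl⟩ : ∃ v, θ = M.θstar + v := ⟨θ - M.θstar, by abel⟩
  rw [add_sub_cancel_left]
  set R := M.grad (M.θstar + v) - M.meanDeriv2 0 • v with hR
  have hint2 := hM.data.integrable_inner_mul_inner v R
  have e : ‖R‖ ^ 2 = inner ℝ R (M.grad (M.θstar + v)) - M.meanDeriv2 0 * inner ℝ v R := by
    rw [← real_inner_self_eq_norm_sq]
    conv_lhs => rw [hR, inner_sub_left, real_inner_smul_left]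
    rw [real_inner_comm]
  rw [hM.inner_grad_eq_meanDeriv, ← hM.data.integral_inner_mul_inner v R,
    ← integral_const_mul] at e
  clear_value R
  have hpt : ∀ ω, (M.meanDeriv 0 - M.meanDeriv (-inner ℝ (M.x ω) v)) * inner ℝ (M.x ω) R
      ≤ M.meanDeriv2 0 * (inner ℝ (M.x ω) v * inner ℝ (M.x ω) R)
        + K * ‖v‖ ^ 2 * ‖R‖ * ‖M.x ω‖ ^ 3 := by
    intro ω
    set a := inner ℝ (M.x ω) v with ha
    set c := inner ℝ (M.x ω) R with hc
    have h1 := hM.abs_meanDeriv_sub_le hdiff hK (-a)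
    have h2 : |a| ≤ ‖M.x ω‖ * ‖v‖ := abs_real_inner_le_norm _ _
    have h3 : |c| ≤ ‖M.x ω‖ * ‖R‖ := abs_real_inner_le_norm _ _
    have h4 : (-a) ^ 2 ≤ (‖M.x ω‖ * ‖v‖) ^ 2 := by
      rw [neg_sq, ← sq_abs]; gcongr
    have h5 : |M.meanDeriv (-a) - M.meanDeriv 0 - M.meanDeriv2 0 * (-a)| * |c|
        ≤ K * (‖M.x ω‖ * ‖v‖) ^ 2 * (‖M.x ω‖ * ‖R‖) := by
      have h6 : K * (-a) ^ 2 ≤ K * (‖M.x ω‖ * ‖v‖) ^ 2 := by gcongr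
      exact mul_le_mul (h1.trans h6) h3 (abs_nonneg _) (by positivity)
    rw [← abs_mul] at h5
    have h7 := (neg_abs_le _).trans' (neg_le_neg h5)
    have e1 : K * (‖M.x ω‖ * ‖v‖) ^ 2 * (‖M.x ω‖ * ‖R‖) = K * ‖v‖ ^ 2 * ‖R‖ * ‖M.x ω‖ ^ 3 := by
      ring
    rw [e1] at h7
    nlinarith
  have hI3 := (hM.data.integrable_norm_pow 3).const_mul (K * ‖v‖ ^ 2 * ‖R‖)
  have hI1 : Integrable (fun ω => M.meanDeriv2 0 * (inner ℝ (M.x ω) v * inner ℝ (M.x ω) R)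
        + K * ‖v‖ ^ 2 * ‖R‖ * ‖M.x ω‖ ^ 3) M.P := (hint2.const_mul _).add hI3
  have hcont : Continuous M.meanDeriv :=
    continuous_iff_continuousAt.2 fun u => (hM.hasDerivAt_meanDeriv hdiff u).continuousAt
  have hbound : ∀ u, |M.meanDeriv u| ≤ M.al := fun u => by
    have := hM.data.isProb
    have h := norm_integral_le_of_norm_le_const (μ := M.P) (C := M.al)
      (f := fun ω => deriv M.l (M.z ω + u))
      (Filter.Eventually.of_forall fun ω => hM.loss.bounded _)
    rwa [probReal_univ, mul_one] at h
  have hI0 : Integrable (fun ω => (M.meanDeriv 0 - M.meanDeriv (-inner ℝ (M.x ω) v))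
      * inner ℝ (M.x ω) R) M.P := by
    refine (hM.data.integrable_norm.const_mul (2 * M.al * ‖R‖)).mono'
      (((hcont.measurable.comp_aemeasurable (hM.data.aemeasurable_inner v).neg).const_sub
        _).mul (hM.data.aemeasurable_inner R)).aestronglyMeasurable
      (Filter.Eventually.of_forall fun ω => ?_)
    rw [norm_mul, Real.norm_eq_abs, Real.norm_eq_abs]
    have h1 := (abs_sub (M.meanDeriv 0) (M.meanDeriv (-inner ℝ (M.x ω) v))).trans
      (add_le_add (hbound _) (hbound _))
    have h2 : |inner ℝ (M.x ω) R| ≤ ‖M.x ω‖ * ‖R‖ := abs_real_inner_le_norm _ _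
    calc _ ≤ (M.al + M.al) * (‖M.x ω‖ * ‖R‖) := mul_le_mul h1 h2 (abs_nonneg _)
          (by have := hM.loss.al_pos; positivity)
      _ = _ := by ring
  have h8 := integral_mono hI0 hI1 hpt
  rw [integral_add (hint2.const_mul _) hI3, integral_const_mul (K * ‖v‖ ^ 2 * ‖R‖)] at h8
  have h9 : ‖R‖ ^ 2 ≤ (K * (∫ ω, ‖M.x ω‖ ^ 3 ∂M.P) * ‖v‖ ^ 2) * ‖R‖ := by linarith
  rcases (norm_nonneg R).eq_or_lt with h0 | h0
  · rw [← h0]; exact mul_nonneg (mul_nonneg hK0 hκ) (sq_nonneg _)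
  · rw [sq] at h9
    exact le_of_mul_le_mul_right h9 h0

theorem Model.Assumptions.hasFDerivAt_grad (hM : M.Assumptions)
    (hdiff : Differentiable ℝ (deriv M.l))
    (hK : ∃ K : ℝ, ∀ u : ℝ, |M.meanDeriv2 u - M.meanDeriv2 0| ≤ K * |u|) :
    HasFDerivAt M.grad (M.meanDeriv2 0 • ContinuousLinearMap.id ℝ (Vec d)) M.θstar := by
  obtain ⟨K, hK⟩ := hK
  obtain ⟨C, -, hC⟩ := hM.exists_grad_remainder hdiff hK
  have h1 : (fun θ => M.grad θ - M.meanDeriv2 0 • (θ - M.θstar)) =O[nhds M.θstar]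
      fun θ => ‖θ - M.θstar‖ ^ 2 :=
    Asymptotics.IsBigO.of_bound C (Filter.Eventually.of_forall fun θ => by
      rw [Real.norm_of_nonneg (by positivity)]; exact hC θ)
  have h2 := h1.hasFDerivAt (𝕜 := ℝ) one_lt_two
  have h3 : HasFDerivAt (fun θ : Vec d => M.meanDeriv2 0 • (θ - M.θstar))
      (M.meanDeriv2 0 • ContinuousLinearMap.id ℝ (Vec d)) M.θstar :=
    ((hasFDerivAt_id (𝕜 := ℝ) M.θstar).sub_const M.θstar).const_smul (M.meanDeriv2 0)
  have h4 := h2.add h3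
  rw [zero_add] at h4
  refine h4.congr_of_eventuallyEq (Filter.Eventually.of_forall fun θ => ?_)
  simp

theorem Model.integral_dir (M : Model d Ω₀) (θ : Vec d) :
    ∫ ω, M.dir θ (M.pair ω) ∂M.P = -M.grad θ := by rw [M.grad_eq, neg_neg]

/-- Isotropy makes both matrices scalar, `H = h I` and, by independence of `x` and `ε + s`, `S =
E[l'(ε + s)²] I`. -/
theorem Model.Assumptions.crlb_eq (hM : M.Assumptions) (hdiff : Differentiable ℝ (deriv M.l))
    (hK : ∃ K : ℝ, ∀ u : ℝ, |M.meanDeriv2 u - M.meanDeriv2 0| ≤ K * |u|) (n : ℕ) :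
    M.crlb n = d * M.meanSqDeriv / (n * M.meanDeriv2 0 ^ 2) := by
  have := hM.data.isProb
  have hh := hM.meanDeriv2_pos hdiff
  have e1 : M.hessian = M.meanDeriv2 0 • (1 : Matrix (Fin d) (Fin d) ℝ) := by
    ext i j
    simp [Model.hessian, (hM.hasFDerivAt_grad hdiff hK).fderiv, Matrix.one_apply]
  have e2 : M.noiseCov = M.meanSqDeriv • (1 : Matrix (Fin d) (Fin d) ℝ) := by
    ext i j
    have hn : ∀ ω, M.noise M.θstar ω i * M.noise M.θstar ω j
        = (deriv M.l (M.z ω)) ^ 2 * (M.x ω i * M.x ω j) := fun ω => by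
      have : M.noise M.θstar ω = -(deriv M.l (M.z ω) • M.x ω) := by
        rw [← M.dir_θstar]
        change -M.grad M.θstar - M.dir M.θstar (M.pair ω) = _
        rw [hM.grad_θstar]; simp
      rw [this]
      simp; ring
    have hc := hM.loss.continuous_deriv
    have := hM.data.indep_z.symm.integral_fun_comp_mul_comp (f := fun t => (deriv M.l t) ^ 2)
      (g := fun x : Vec d => x i * x j) hM.data.aemeasurable_z hM.data.aemeasurable_x
      (hc.pow 2).aestronglyMeasurable (by fun_prop : Continuous _).aestronglyMeasurable
    simp only [Model.noiseCov, Matrix.of_apply, hn, this, hM.data.isotropic]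
    simp [Model.meanSqDeriv, Model.z, Matrix.one_apply]
  have e3 : M.hessian⁻¹ = (M.meanDeriv2 0)⁻¹ • (1 : Matrix (Fin d) (Fin d) ℝ) := by
    rw [e1]
    refine Matrix.inv_eq_right_inv ?_
    simp [smul_smul, hh.ne']
  rw [Model.crlb, e3, e2]
  simp
  field_simp

theorem Model.Assumptions.continuous_grad (hM : M.Assumptions) : Continuous M.grad := by
  have h : Continuous fun θ => ∫ ω, M.dir θ (M.pair ω) ∂M.P := by
    refine continuous_of_dominated (bound := fun ω => M.al * ‖M.x ω‖)
      (fun θ => hM.aestronglyMeasurable_dir θ)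
      (fun θ => Filter.Eventually.of_forall fun ω => hM.loss.norm_dir_le θ (M.pair ω))
      (hM.data.integrable_norm.const_mul _) (Filter.Eventually.of_forall fun ω => ?_)
    exact hM.loss.continuous_dir.comp (by fun_prop : Continuous fun θ => (θ, M.pair ω))
  exact h.neg

/-- The gradient noise as a function of the parameter and the sample. -/
noncomputable def Model.err (M : Model d Ω₀) (θ : Vec d) (ζ : Vec d × ℝ) : Vec d :=
  -M.grad θ - M.dir θ ζ

theorem Model.Assumptions.continuous_err (hM : M.Assumptions) :
    Continuous (fun q : Vec d × (Vec d × ℝ) => M.err q.1 q.2) :=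
  (hM.continuous_grad.comp continuous_fst).neg.sub hM.loss.continuous_dir

theorem Model.Assumptions.integrable_err (hM : M.Assumptions) (θ : Vec d) :
    Integrable (fun ω => M.err θ (M.pair ω)) M.P := by
  have := hM.data.isProb
  exact (integrable_const _).sub (hM.integrable_dir θ)

theorem Model.Assumptions.integral_err (hM : M.Assumptions) (θ : Vec d) :
    ∫ ω, M.err θ (M.pair ω) ∂M.P = 0 := by
  have := hM.data.isProb
  simp only [Model.err]
  rw [integral_sub (integrable_const _) (hM.integrable_dir θ), M.integral_dir]
  simp

theorem Model.Assumptions.integrable_dir_sq (hM : M.Assumptions) (θ : Vec d) :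
    Integrable (fun ω => ‖M.dir θ (M.pair ω)‖ ^ 2) M.P := by
  refine ((hM.data.integrable_norm_pow 2).const_mul (M.al ^ 2)).mono'
    ((hM.aestronglyMeasurable_dir θ).norm.pow 2) (Filter.Eventually.of_forall fun ω => ?_)
  rw [Real.norm_of_nonneg (by positivity), ← mul_pow]
  exact pow_le_pow_left₀ (norm_nonneg _) (hM.loss.norm_dir_le θ (M.pair ω)) 2

theorem Model.Assumptions.meanLE_err_sq (hM : M.Assumptions) (θ : Vec d) {B : ℝ}
    (hB : ∫ ω, ‖M.dir θ (M.pair ω)‖ ^ 2 ∂M.P ≤ B) :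
    MeanLE M.P (fun ω => ‖M.err θ (M.pair ω)‖ ^ 2) B := by
  have := hM.data.isProb
  have e : ∀ ω, ‖M.err θ (M.pair ω)‖ ^ 2 = ‖M.dir θ (M.pair ω)‖ ^ 2
      + 2 * inner ℝ (M.grad θ) (M.dir θ (M.pair ω)) + ‖M.grad θ‖ ^ 2 := fun ω => by
    rw [Model.err, ← neg_add', norm_neg, norm_add_sq_real]; ring
  have hin : Integrable (fun ω => inner ℝ (M.grad θ) (M.dir θ (M.pair ω))) M.P :=
    (hM.integrable_dir θ).const_inner _
  have h1 : Integrable (fun ω => ‖M.dir θ (M.pair ω)‖ ^ 2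
      + 2 * inner ℝ (M.grad θ) (M.dir θ (M.pair ω))) M.P :=
    (hM.integrable_dir_sq θ).add (hin.const_mul 2)
  simp only [MeanLE, e]
  refine ⟨h1.add (integrable_const _), ?_⟩
  rw [integral_add h1 (integrable_const _), integral_add (hM.integrable_dir_sq θ)
    (hin.const_mul 2), integral_const_mul, integral_inner (hM.integrable_dir θ), M.integral_dir,
    inner_neg_right, real_inner_self_eq_norm_sq]
  simp
  nlinarith [sq_nonneg ‖M.grad θ‖]

/-- The variance is at most the second moment of the direction. At `θ*` this moment factors into `d
* E[l'(ε + s)²]`; moving to `θ` costs `A ^ 2 - B ^ 2 = (A + B) * (A - B)`, bounded by `2 * al` times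
the Lipschitz bound for `l'`. -/
theorem Model.Assumptions.exists_meanLE_err_sq (hM : M.Assumptions) :
    ∃ C : ℝ, 0 ≤ C ∧ ∀ θ : Vec d, MeanLE M.P (fun ω => ‖M.err θ (M.pair ω)‖ ^ 2)
      (d * M.meanSqDeriv + C * ‖θ - M.θstar‖) := by
  have := hM.data.isProb
  have ha := hM.loss.al_pos
  have hL := hM.loss.Ll_nonneg
  have hκ : 0 ≤ ∫ ω, ‖M.x ω‖ ^ 3 ∂M.P := integral_nonneg fun ω => by positivity
  have hc := hM.loss.continuous_deriv
  refine ⟨2 * M.al * M.Ll * ∫ ω, ‖M.x ω‖ ^ 3 ∂M.P, by positivity, fun θ => hM.meanLE_err_sq θ ?_⟩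
  have h0 : ∫ ω, ‖M.dir M.θstar (M.pair ω)‖ ^ 2 ∂M.P = d * M.meanSqDeriv := by
    have := hM.data.indep_z.symm.integral_fun_comp_mul_comp (f := fun t => (deriv M.l t) ^ 2)
      (g := fun x : Vec d => ‖x‖ ^ 2) hM.data.aemeasurable_z hM.data.aemeasurable_x
      (hc.pow 2).aestronglyMeasurable (by fun_prop : Continuous _).aestronglyMeasurable
    rw [hM.data.integral_norm_sq] at this
    rw [mul_comm]
    refine Eq.trans ?_ this
    congr 1; ext ω
    rw [M.dir_θstar, norm_smul, mul_pow, Real.norm_eq_abs, sq_abs]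
  have hI3 := (hM.data.integrable_norm_pow 3).const_mul (2 * M.al * M.Ll * ‖θ - M.θstar‖)
  have h1 : ∫ ω, ‖M.dir θ (M.pair ω)‖ ^ 2 ∂M.P ≤ ∫ ω, (‖M.dir M.θstar (M.pair ω)‖ ^ 2
      + 2 * M.al * M.Ll * ‖θ - M.θstar‖ * ‖M.x ω‖ ^ 3) ∂M.P := by
    refine integral_mono (hM.integrable_dir_sq θ) ((hM.integrable_dir_sq _).add hI3) fun ω => ?_
    simp only
    rw [M.dir_θstar, M.dir_pair, norm_smul, norm_smul, mul_pow, mul_pow, Real.norm_eq_abs,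
      Real.norm_eq_abs, sq_abs, sq_abs]
    set v := θ - M.θstar
    set A := deriv M.l (M.z ω - inner ℝ (M.x ω) v)
    set B := deriv M.l (M.z ω)
    have hA : |A| ≤ M.al := hM.loss.bounded _
    have hB : |B| ≤ M.al := hM.loss.bounded _
    have hAB : |A - B| ≤ M.Ll * (‖M.x ω‖ * ‖v‖) := by
      refine (hM.loss.lipschitz _ _).trans ?_
      gcongr
      rw [sub_sub_cancel_left, abs_neg]
      exact abs_real_inner_le_norm _ _
    have h2 : A ^ 2 - B ^ 2 ≤ 2 * M.al * (M.Ll * (‖M.x ω‖ * ‖v‖)) := by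
      calc A ^ 2 - B ^ 2 = (A + B) * (A - B) := by ring
        _ ≤ |A + B| * |A - B| := by rw [← abs_mul]; exact le_abs_self _
        _ ≤ (M.al + M.al) * (M.Ll * (‖M.x ω‖ * ‖v‖)) :=
          mul_le_mul ((abs_add_le A B).trans (add_le_add hA hB)) hAB (abs_nonneg _) (by positivity)
        _ = _ := by ring
    have h3 := mul_le_mul_of_nonneg_right h2 (sq_nonneg ‖M.x ω‖)
    nlinarith
  refine h1.trans (le_of_eq ?_)
  rw [integral_add (hM.integrable_dir_sq _) hI3, h0, integral_const_mul]
  ring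

end Linearization

/-! ### Averages of perturbed linear recursions in a Hilbert space. -/

section Averaging

theorem sum_smul_sub {E : Type*} [AddCommGroup E] [Module ℝ E] (a : ℕ → ℝ) (f : ℕ → E) (n : ℕ) :
    ∑ k ∈ Finset.range n, a k • (f k - f (k + 1))
      = a 0 • f 0 - a n • f n + ∑ k ∈ Finset.range n, (a (k + 1) - a k) • f (k + 1) := by
  induction n with
  | zero => simp
  | succ n ih => rw [Finset.sum_range_succ, ih, Finset.sum_range_succ]; module

theorem norm_sum_smul_sub_le {E : Type*} [NormedAddCommGroup E] [NormedSpace ℝ E] {a : ℕ → ℝ}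
    (ha : ∀ k, 0 ≤ a k) (hmono : ∀ k, a k ≤ a (k + 1)) (f : ℕ → E) (n : ℕ) :
    ‖∑ k ∈ Finset.range n, a k • (f k - f (k + 1))‖
      ≤ a 0 * ‖f 0‖ + a n * ‖f n‖ + ∑ k ∈ Finset.range n, (a (k + 1) - a k) * ‖f (k + 1)‖ := by
  rw [sum_smul_sub]
  refine (norm_add_le _ _).trans (add_le_add ((norm_sub_le _ _).trans (add_le_add ?_ ?_))
    ((norm_sum_le _ _).trans (Finset.sum_le_sum fun k _ => ?_)))
  · rw [norm_smul, Real.norm_of_nonneg (ha 0)]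
  · rw [norm_smul, Real.norm_of_nonneg (ha n)]
  · rw [norm_smul, Real.norm_of_nonneg (sub_nonneg.2 (hmono k))]

variable {H : Type*} [NormedAddCommGroup H] [InnerProductSpace ℝ H]

/-- A perturbed linear recursion with orthogonal noise in a Hilbert space. -/
structure LinearRecursion (v w R : ℕ → H) (h ι ξ B C₁ C₂ C₃ : ℝ) : Prop where
  rec_eq : ∀ n, v (n + 1) = v n - (ι / ((n : ℝ) + 1) ^ ξ) • (h • v n + R n + w n)
  norm_v : ∀ n, ‖v n‖ ≤ C₁ * ((n : ℝ) + 1) ^ (-(ξ / 2))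
  norm_R : ∀ n, ‖R n‖ ≤ C₂ * ((n : ℝ) + 1) ^ (-ξ)
  norm_w : ∀ n, ‖w n‖ ^ 2 ≤ B + C₃ * ((n : ℝ) + 1) ^ (-(ξ / 2))
  orth_v : ∀ n k, k ≤ n → inner ℝ (w n) (v k) = 0
  orth_w : ∀ n k, k < n → inner ℝ (w n) (w k) = 0
  orth_R : ∀ n, inner ℝ (w n) (R n) = 0

namespace LinearRecursion

variable {v w R : ℕ → H} {h ι ξ B C₁ C₂ C₃ : ℝ}

theorem inner_sum_noise (hr : LinearRecursion v w R h ι ξ B C₁ C₂ C₃) (n : ℕ) :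
    inner ℝ (w n) (∑ k ∈ Finset.range n, w k) = 0 := by
  rw [inner_sum]
  exact Finset.sum_eq_zero fun k hk => hr.orth_w n k (Finset.mem_range.1 hk)

theorem norm_sum_noise_sq (hr : LinearRecursion v w R h ι ξ B C₁ C₂ C₃) (n : ℕ) :
    ‖∑ k ∈ Finset.range n, w k‖ ^ 2 = ∑ k ∈ Finset.range n, ‖w k‖ ^ 2 := by
  induction n with
  | zero => simp
  | succ n ih =>
    rw [Finset.sum_range_succ, norm_add_sq_real, real_inner_comm, hr.inner_sum_noise, ih,
      Finset.sum_range_succ]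
    ring

theorem rpow_neg_le_one {n : ℕ} {s : ℝ} (hs : 0 ≤ s) : ((n : ℝ) + 1) ^ (-s) ≤ 1 :=
  Real.rpow_le_one_of_one_le_of_nonpos (by linarith [(n.cast_nonneg : (0 : ℝ) ≤ n)]) (by linarith)

theorem norm_sum_noise_sq_le (hr : LinearRecursion v w R h ι ξ B C₁ C₂ C₃) (hξ : 0 < ξ)
    (hC₃ : 0 ≤ C₃) (n : ℕ) : ‖∑ k ∈ Finset.range n, w k‖ ^ 2 ≤ (B + C₃) * n := by
  rw [hr.norm_sum_noise_sq]
  refine (Finset.sum_le_card_nsmul _ _ (B + C₃) fun k _ => (hr.norm_w k).trans ?_).trans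
    (le_of_eq ?_)
  · have := rpow_neg_le_one (n := k) (half_pos hξ).le
    nlinarith
  · simp; ring

theorem norm_sum_noise_sq_le' (hr : LinearRecursion v w R h ι ξ B C₁ C₂ C₃) (hξ : 0 < ξ)
    (hξ1 : ξ < 1) (hC₃ : 0 ≤ C₃) (n : ℕ) :
    ‖∑ k ∈ Finset.range n, w k‖ ^ 2
      ≤ n * B + C₃ * (1 / (1 - ξ / 2) * (n : ℝ) ^ (1 - ξ / 2)) := by
  rw [hr.norm_sum_noise_sq]
  refine (Finset.sum_le_sum fun k _ => hr.norm_w k).trans ?_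
  rw [Finset.sum_add_distrib, ← Finset.mul_sum]
  have h1 := sum_rpow_le (s := 1 - ξ / 2) (by linarith) (by linarith) n
  rw [show 1 - ξ / 2 - 1 = -(ξ / 2) by ring] at h1
  have := mul_le_mul_of_nonneg_left h1 hC₃
  simp only [Finset.sum_const, Finset.card_range, nsmul_eq_mul]
  linarith

/-- With `N n` the noise sum and `c n = ⟨N n, v n⟩`, orthogonality gives `c (n + 1) = (1 - α h) c n
- α (⟨N n, R n⟩ + ‖w n‖²)`. Since `‖N n‖` is of order `√n` and `‖R n‖` of order `n ^ (-ξ)`, the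
bracket is bounded exactly when `ξ ≥ 1 / 2` is used, and the contraction keeps `c` bounded. -/
theorem exists_inner_bound (hr : LinearRecursion v w R h ι ξ B C₁ C₂ C₃) (hh : 0 < h) (hι : 0 < ι)
    (hξ : 1 / 2 ≤ ξ) (hB : 0 ≤ B) (hC₂ : 0 ≤ C₂) (hC₃ : 0 ≤ C₃) :
    ∃ C, 0 ≤ C ∧ ∀ n, |inner ℝ (∑ k ∈ Finset.range n, w k) (v n)| ≤ C := by
  have hξ0 : 0 < ξ := by linarith
  set W := B + C₃ with hW
  have hW0 : 0 ≤ W := by positivity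
  set K := Real.sqrt W * C₂ + W with hK
  have hK0 : 0 ≤ K := by positivity
  set c : ℕ → ℝ := fun n => inner ℝ (∑ k ∈ Finset.range n, w k) (v n) with hc
  have hMR : ∀ n, ‖∑ k ∈ Finset.range n, w k‖ * ‖R n‖ ≤ Real.sqrt W * C₂ := by
    intro n
    have hn1 : (0 : ℝ) < (n : ℝ) + 1 := by positivity
    have h1 : ‖∑ k ∈ Finset.range n, w k‖ ≤ Real.sqrt W * ((n : ℝ) + 1) ^ ξ := by
      rw [← Real.sqrt_sq (norm_nonneg (∑ k ∈ Finset.range n, w k))]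
      have h2 : ‖∑ k ∈ Finset.range n, w k‖ ^ 2 ≤ W * ((n : ℝ) + 1) :=
        (hr.norm_sum_noise_sq_le hξ0 hC₃ n).trans (by gcongr; linarith)
      refine (Real.sqrt_le_sqrt h2).trans ?_
      rw [Real.sqrt_mul hW0, Real.sqrt_eq_rpow ((n : ℝ) + 1)]
      gcongr
      linarith
    calc _ ≤ (Real.sqrt W * ((n : ℝ) + 1) ^ ξ) * (C₂ * ((n : ℝ) + 1) ^ (-ξ)) :=
          mul_le_mul h1 (hr.norm_R n) (norm_nonneg _) (by positivity)
      _ = Real.sqrt W * C₂ * (((n : ℝ) + 1) ^ ξ * ((n : ℝ) + 1) ^ (-ξ)) := by ring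
      _ = _ := by rw [← Real.rpow_add hn1]; simp
  have hstep : ∀ n : ℕ, |c (n + 1)| ≤ |1 - ι / ((n : ℝ) + 1) ^ ξ * h| * |c n|
      + ι / ((n : ℝ) + 1) ^ ξ * K := by
    intro n
    set α := ι / ((n : ℝ) + 1) ^ ξ with hα
    have hα0 : 0 < α := by positivity
    have e : c (n + 1) = (1 - α * h) * c n
        - α * (inner ℝ (∑ k ∈ Finset.range n, w k) (R n) + ‖w n‖ ^ 2) := by
      simp only [hc]
      rw [Finset.sum_range_succ, hr.rec_eq n, ← hα]
      simp only [inner_add_left, inner_sub_right, inner_add_right, inner_smul_right,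
        hr.orth_v n n le_rfl, hr.orth_R n, real_inner_self_eq_norm_sq]
      rw [real_inner_comm (w n) (∑ k ∈ Finset.range n, w k), hr.inner_sum_noise]
      ring
    have h1 : |inner ℝ (∑ k ∈ Finset.range n, w k) (R n) + ‖w n‖ ^ 2| ≤ K := by
      refine (abs_add_le _ _).trans (add_le_add ((abs_real_inner_le_norm _ _).trans (hMR n)) ?_)
      rw [abs_of_nonneg (by positivity)]
      refine (hr.norm_w n).trans ?_
      have := rpow_neg_le_one (n := n) (half_pos hξ0).le
      rw [hW]; nlinarith
    rw [e]
    refine (abs_sub _ _).trans (add_le_add (abs_mul _ _).le ?_)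
    rw [abs_mul, abs_of_pos hα0]
    gcongr
  have t1 := (tendsto_add_one_rpow_neg hξ0).const_mul (ι * h)
  rw [mul_zero] at t1
  obtain ⟨N, hN⟩ := Filter.eventually_atTop.1 (t1.eventually (gt_mem_nhds one_pos))
  obtain ⟨C, hC, hCb⟩ := exists_bound_of_eventually (u := fun n => |c n|) (w := fun _ => 1)
    (fun _ => one_pos) (N := N) (C := max |c N| (K / h)) (fun n hn => by
      rw [mul_one]
      induction n, hn using Nat.le_induction with
      | base => exact le_max_left _ _
      | succ n hn ih =>
        refine (hstep n).trans ?_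
        have h1 := hN n hn
        rw [Real.rpow_neg (by positivity)] at h1
        set α := ι / ((n : ℝ) + 1) ^ ξ with hα
        have hα0 : 0 < α := by positivity
        have e : ι * h * (((n : ℝ) + 1) ^ ξ)⁻¹ = α * h := by rw [hα]; ring
        rw [e] at h1
        rw [abs_of_pos (by linarith : 0 < 1 - α * h)]
        have h2 : K ≤ max |c N| (K / h) * h := by
          rw [← div_le_iff₀ hh]; exact le_max_right _ _
        have h3 : (1 - α * h) * |c n| ≤ (1 - α * h) * max |c N| (K / h) :=
          mul_le_mul_of_nonneg_left ih (by linarith)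
        nlinarith [mul_le_mul_of_nonneg_left h2 hα0.le])
  exact ⟨C, hC, fun n => by simpa using hCb n⟩

/-- The recursion is solved for `h • v k` before summing; the weights of the differences are the
inverse stepsizes. -/
theorem sum_v_eq (hr : LinearRecursion v w R h ι ξ B C₁ C₂ C₃) (hι : 0 < ι) (n : ℕ) :
    h • ∑ k ∈ Finset.range n, v k
      = ∑ k ∈ Finset.range n, (((k : ℝ) + 1) ^ ξ / ι) • (v k - v (k + 1))
        - ∑ k ∈ Finset.range n, R k - ∑ k ∈ Finset.range n, w k := by
  rw [Finset.smul_sum, ← Finset.sum_sub_distrib, ← Finset.sum_sub_distrib]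
  refine Finset.sum_congr rfl fun k _ => ?_
  have hk : (((k : ℝ) + 1) ^ ξ / ι) * (ι / ((k : ℝ) + 1) ^ ξ) = 1 := by
    have : 0 < ((k : ℝ) + 1) ^ ξ := by positivity
    field_simp
  rw [hr.rec_eq k, sub_sub_cancel, smul_smul, hk]
  module

/-- Noise after time `k` is orthogonal to `v k` and `v (k + 1)`, so only partial noise sums remain
and the cross term is again a weighted telescoping sum. Bounded summands then give order `n ^ ξ`,
while Cauchy–Schwarz would give `n ^ ((1 + ξ) / 2)`. -/
theorem inner_noise_telescope (hr : LinearRecursion v w R h ι ξ B C₁ C₂ C₃) (a : ℕ → ℝ) (n : ℕ) :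
    inner ℝ (∑ k ∈ Finset.range n, w k) (∑ k ∈ Finset.range n, a k • (v k - v (k + 1)))
      = ∑ k ∈ Finset.range n, a k • (inner ℝ (∑ i ∈ Finset.range k, w i) (v k)
        - inner ℝ (∑ i ∈ Finset.range (k + 1), w i) (v (k + 1))) := by
  induction n with
  | zero => simp
  | succ n ih =>
    have h0 : inner ℝ (w n) (∑ k ∈ Finset.range n, a k • (v k - v (k + 1))) = 0 := by
      rw [inner_sum]
      refine Finset.sum_eq_zero fun k hk => ?_
      have hk' := Finset.mem_range.1 hk
      rw [inner_smul_right, inner_sub_right, hr.orth_v n k hk'.le, hr.orth_v n (k + 1) hk']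
      simp
    have h1 : inner ℝ (∑ i ∈ Finset.range (n + 1), w i) (v n)
        = inner ℝ (∑ i ∈ Finset.range n, w i) (v n) := by
      rw [Finset.sum_range_succ, inner_add_left, hr.orth_v n n le_rfl, add_zero]
    rw [Finset.sum_range_succ (fun k => a k • (v k - v (k + 1))), inner_add_right,
      inner_smul_right, inner_sub_right, h1]
    conv_lhs => rw [Finset.sum_range_succ w, inner_add_left (∑ k ∈ Finset.range n, w k), h0, ih]
    rw [Finset.sum_range_succ _ n, Finset.sum_range_succ w n]
    simp

theorem exists_sum_bound (hr : LinearRecursion v w R h ι ξ B C₁ C₂ C₃) (hh : 0 < h) (hι : 0 < ι)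
    (hξ : 1 / 2 ≤ ξ) (hξ1 : ξ < 1) (hB : 0 ≤ B) (hC₁ : 0 ≤ C₁) (hC₂ : 0 ≤ C₂) (hC₃ : 0 ≤ C₃) :
    ∃ C, 0 ≤ C ∧ ∀ n : ℕ, 1 ≤ n → h ^ 2 * ‖∑ k ∈ Finset.range n, v k‖ ^ 2
      ≤ n * B + C * (n : ℝ) ^ (2 - min (ξ + 1 / 2) (2 - ξ)) := by
  have hξ0 : 0 < ξ := by linarith
  have h1ξ : 0 < 1 - ξ := by linarith
  obtain ⟨C₀, hC₀, hc⟩ := hr.exists_inner_bound hh hι hξ hB hC₂ hC₃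
  set a : ℕ → ℝ := fun k => ((k : ℝ) + 1) ^ ξ / ι with ha
  have ha0 : ∀ k, 0 ≤ a k := fun k => by simp only [ha]; positivity
  have hmono : ∀ k, a k ≤ a (k + 1) := fun k => by
    simp only [ha]; push_cast; gcongr; linarith
  have ha_n : ∀ n : ℕ, 1 ≤ n → a n ≤ 2 / ι * (n : ℝ) ^ ξ := fun n hn => by
    have hn' : (1 : ℝ) ≤ n := by exact_mod_cast hn
    have h1 : ((n : ℝ) + 1) ^ ξ ≤ 2 * (n : ℝ) ^ ξ := by
      calc ((n : ℝ) + 1) ^ ξ ≤ (2 * (n : ℝ)) ^ ξ := by gcongr; linarith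
        _ = 2 ^ ξ * (n : ℝ) ^ ξ := Real.mul_rpow (by norm_num) (by positivity)
        _ ≤ 2 ^ (1 : ℝ) * (n : ℝ) ^ ξ := by gcongr; norm_num
        _ = _ := by norm_num
    simp only [ha]
    rw [div_mul_eq_mul_div]
    gcongr
  have hstep : ∀ k : ℕ, a (k + 1) - a k ≤ ξ / ι * ((k : ℝ) + 1) ^ (ξ - 1) := fun k => by
    have := add_one_rpow_sub_le hξ0.le hξ1.le (by positivity : (0 : ℝ) < (k : ℝ) + 1)
    simp only [ha]
    push_cast
    rw [← sub_div, div_mul_eq_mul_div]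
    gcongr
  set T : ℕ → H := fun n => ∑ k ∈ Finset.range n, a k • (v k - v (k + 1)) with hT
  set S : ℕ → H := fun n => ∑ k ∈ Finset.range n, R k with hS
  set N : ℕ → H := fun n => ∑ k ∈ Finset.range n, w k with hN
  set KT := C₁ * (1 / ι + 2 / ι + ξ / ι * (1 / (ξ / 2))) with hKT
  have hKT0 : 0 ≤ KT := by positivity
  have hTn : ∀ n : ℕ, 1 ≤ n → ‖T n‖ ≤ KT * (n : ℝ) ^ (ξ / 2) := by
    intro n hn
    have hn' : (1 : ℝ) ≤ n := by exact_mod_cast hn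
    have hn0 : (0 : ℝ) < n := by linarith
    refine (norm_sum_smul_sub_le ha0 hmono v n).trans ?_
    have h1 : a 0 * ‖v 0‖ ≤ C₁ * (1 / ι) * (n : ℝ) ^ (ξ / 2) := by
      have e : a 0 = 1 / ι := by simp [ha]
      have h2 : ‖v 0‖ ≤ C₁ := by simpa using hr.norm_v 0
      have h3 : 1 ≤ (n : ℝ) ^ (ξ / 2) := Real.one_le_rpow hn' (by positivity)
      rw [e]
      calc 1 / ι * ‖v 0‖ ≤ 1 / ι * C₁ := by gcongr
        _ = C₁ * (1 / ι) * 1 := by ring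
        _ ≤ _ := by gcongr
    have h2 : a n * ‖v n‖ ≤ C₁ * (2 / ι) * (n : ℝ) ^ (ξ / 2) := by
      have h3 : ((n : ℝ) + 1) ^ (-(ξ / 2)) ≤ (n : ℝ) ^ (-(ξ / 2)) :=
        Real.rpow_le_rpow_of_nonpos hn0 (by linarith) (by linarith)
      calc a n * ‖v n‖ ≤ (2 / ι * (n : ℝ) ^ ξ) * (C₁ * (n : ℝ) ^ (-(ξ / 2))) := by
            refine mul_le_mul (ha_n n hn) ((hr.norm_v n).trans (by gcongr)) (norm_nonneg _)
              (by positivity)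
        _ = C₁ * (2 / ι) * ((n : ℝ) ^ ξ * (n : ℝ) ^ (-(ξ / 2))) := by ring
        _ = _ := by rw [← Real.rpow_add hn0]; congr 2; ring
    have h3 : ∑ k ∈ Finset.range n, (a (k + 1) - a k) * ‖v (k + 1)‖
        ≤ C₁ * (ξ / ι * (1 / (ξ / 2))) * (n : ℝ) ^ (ξ / 2) := by
      have h4 : ∀ k ∈ Finset.range n, (a (k + 1) - a k) * ‖v (k + 1)‖
          ≤ C₁ * (ξ / ι) * ((k : ℝ) + 1) ^ (ξ / 2 - 1) := fun k _ => by
        have hk : (0 : ℝ) < (k : ℝ) + 1 := by positivity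
        have h5 : ‖v (k + 1)‖ ≤ C₁ * ((k : ℝ) + 1) ^ (-(ξ / 2)) := by
          refine (hr.norm_v (k + 1)).trans ?_
          gcongr ?_ * ?_
          push_cast
          exact Real.rpow_le_rpow_of_nonpos hk (by linarith) (by linarith)
        calc _ ≤ (ξ / ι * ((k : ℝ) + 1) ^ (ξ - 1)) * (C₁ * ((k : ℝ) + 1) ^ (-(ξ / 2))) :=
              mul_le_mul (hstep k) h5 (norm_nonneg _) (by positivity)
          _ = C₁ * (ξ / ι) * (((k : ℝ) + 1) ^ (ξ - 1) * ((k : ℝ) + 1) ^ (-(ξ / 2))) := by ring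
          _ = _ := by rw [← Real.rpow_add hk]; congr 2; ring
      refine (Finset.sum_le_sum h4).trans ?_
      rw [← Finset.mul_sum]
      have h6 := sum_rpow_le (s := ξ / 2) (by positivity) (by linarith) n
      calc _ ≤ C₁ * (ξ / ι) * (1 / (ξ / 2) * (n : ℝ) ^ (ξ / 2)) := by gcongr
        _ = _ := by ring
    have e : KT * (n : ℝ) ^ (ξ / 2) = C₁ * (1 / ι) * (n : ℝ) ^ (ξ / 2)
        + C₁ * (2 / ι) * (n : ℝ) ^ (ξ / 2) + C₁ * (ξ / ι * (1 / (ξ / 2))) * (n : ℝ) ^ (ξ / 2) := by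
      rw [hKT]; ring
    rw [e]
    linarith
  set KS := C₂ * (1 / (1 - ξ)) with hKS
  have hKS0 : 0 ≤ KS := by positivity
  have hSn : ∀ n : ℕ, ‖S n‖ ≤ KS * (n : ℝ) ^ (1 - ξ) := by
    intro n
    refine (norm_sum_le _ _).trans ((Finset.sum_le_sum fun k _ => hr.norm_R k).trans ?_)
    rw [← Finset.mul_sum]
    have h6 := sum_rpow_le (s := 1 - ξ) h1ξ (by linarith) n
    rw [show 1 - ξ - 1 = -ξ by ring] at h6
    calc _ ≤ C₂ * (1 / (1 - ξ) * (n : ℝ) ^ (1 - ξ)) := by gcongr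
      _ = _ := by ring
  have hcross : ∀ n : ℕ, 1 ≤ n → |inner ℝ (N n) (T n)| ≤ 2 * C₀ * (2 / ι) * (n : ℝ) ^ ξ := by
    intro n hn
    have h1 := hr.inner_noise_telescope a n
    have h2 := norm_sum_smul_sub_le ha0 hmono
      (fun k => inner ℝ (∑ i ∈ Finset.range k, w i) (v k)) n
    rw [← h1, Real.norm_eq_abs] at h2
    refine h2.trans ?_
    have h3 : ∑ k ∈ Finset.range n, (a (k + 1) - a k)
        * ‖(inner ℝ (∑ i ∈ Finset.range (k + 1), w i) (v (k + 1)) : ℝ)‖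
        ≤ ∑ k ∈ Finset.range n, (a (k + 1) - a k) * C₀ :=
      Finset.sum_le_sum fun k _ =>
        mul_le_mul_of_nonneg_left (hc (k + 1)) (sub_nonneg.2 (hmono k))
    rw [← Finset.sum_mul, Finset.sum_range_sub] at h3
    have h4 := mul_le_mul_of_nonneg_left (hc 0) (ha0 0)
    have h5 := mul_le_mul_of_nonneg_left (hc n) (ha0 n)
    have h6 := mul_le_mul_of_nonneg_left (ha_n n hn) (show 0 ≤ 2 * C₀ by positivity)
    simp only [Real.norm_eq_abs] at *
    linarith
  have hNn : ∀ n : ℕ, ‖N n‖ ≤ Real.sqrt (B + C₃) * (n : ℝ) ^ (1 / 2 : ℝ) := by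
    intro n
    rw [← Real.sqrt_sq (norm_nonneg (N n)), ← Real.sqrt_eq_rpow, ← Real.sqrt_mul (by positivity)]
    exact Real.sqrt_le_sqrt (hr.norm_sum_noise_sq_le hξ0 hC₃ n)
  -- `E` is the larger of `3 / 2 - ξ`, from pairing remainders with noise, and `ξ`, from the
  -- telescoping terms. For `ξ ≥ 1 / 2` the exponents `2 - 2 * ξ` and `1 - ξ / 2` of the other terms
  -- do not exceed it.
  set E := 2 - min (ξ + 1 / 2) (2 - ξ) with hE
  have hE1 : 3 / 2 - ξ ≤ E := by
    have := min_le_left (ξ + 1 / 2) (2 - ξ); rw [hE]; linarith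
  have hE2 : ξ ≤ E := by
    have := min_le_right (ξ + 1 / 2) (2 - ξ); rw [hE]; linarith
  refine ⟨2 * KT ^ 2 + 2 * KS ^ 2 + 2 * (2 * C₀ * (2 / ι)) + 2 * (KS * Real.sqrt (B + C₃))
    + C₃ * (1 / (1 - ξ / 2)), ?_, fun n hn => ?_⟩
  · have : 0 < 1 - ξ / 2 := by linarith
    positivity
  have hn' : (1 : ℝ) ≤ n := by exact_mod_cast hn
  have hn0 : (0 : ℝ) < n := by linarith
  have hpow : ∀ {s : ℝ}, s ≤ E → (n : ℝ) ^ s ≤ (n : ℝ) ^ E := fun hs =>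
    Real.rpow_le_rpow_of_exponent_le hn' hs
  have e : h ^ 2 * ‖∑ k ∈ Finset.range n, v k‖ ^ 2 = ‖(T n - S n) - N n‖ ^ 2 := by
    have := hr.sum_v_eq hι n
    rw [show (T n - S n) - N n = h • ∑ k ∈ Finset.range n, v k from this.symm, norm_smul, mul_pow,
      Real.norm_eq_abs, sq_abs]
  rw [e, norm_sub_sq_real, inner_sub_left]
  have b1 : ‖T n - S n‖ ^ 2 ≤ (2 * KT ^ 2 + 2 * KS ^ 2) * (n : ℝ) ^ E := by
    have h1 : ‖T n - S n‖ ^ 2 ≤ 2 * ‖T n‖ ^ 2 + 2 * ‖S n‖ ^ 2 := by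
      have := norm_sub_le (T n) (S n)
      have h2 : ‖T n - S n‖ ^ 2 ≤ (‖T n‖ + ‖S n‖) ^ 2 := by gcongr
      nlinarith [sq_nonneg (‖T n‖ - ‖S n‖)]
    have h2 : ‖T n‖ ^ 2 ≤ KT ^ 2 * (n : ℝ) ^ E := by
      calc ‖T n‖ ^ 2 ≤ (KT * (n : ℝ) ^ (ξ / 2)) ^ 2 := by gcongr; exact hTn n hn
        _ = KT ^ 2 * (n : ℝ) ^ ξ := by
          rw [mul_pow, ← Real.rpow_mul_natCast hn0.le]; congr 2; push_cast; ring
        _ ≤ _ := by gcongr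
    have h3 : ‖S n‖ ^ 2 ≤ KS ^ 2 * (n : ℝ) ^ E := by
      calc ‖S n‖ ^ 2 ≤ (KS * (n : ℝ) ^ (1 - ξ)) ^ 2 := by gcongr; exact hSn n
        _ = KS ^ 2 * (n : ℝ) ^ (2 - 2 * ξ) := by
          rw [mul_pow, ← Real.rpow_mul_natCast hn0.le]; congr 2; push_cast; ring
        _ ≤ _ := by gcongr; linarith
    linarith
  have b2 : -(2 * inner ℝ (T n) (N n)) ≤ 2 * (2 * C₀ * (2 / ι)) * (n : ℝ) ^ E := by
    have h1 := hcross n hn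
    rw [real_inner_comm] at h1
    have h2 := (neg_abs_le _).trans' (neg_le_neg h1)
    have h3 : 2 * C₀ * (2 / ι) * (n : ℝ) ^ ξ ≤ 2 * C₀ * (2 / ι) * (n : ℝ) ^ E := by gcongr
    linarith
  have b3 : 2 * inner ℝ (S n) (N n) ≤ 2 * (KS * Real.sqrt (B + C₃)) * (n : ℝ) ^ E := by
    have h1 : inner ℝ (S n) (N n) ≤ (KS * Real.sqrt (B + C₃)) * (n : ℝ) ^ E := by
      calc inner ℝ (S n) (N n) ≤ ‖S n‖ * ‖N n‖ := real_inner_le_norm _ _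
        _ ≤ (KS * (n : ℝ) ^ (1 - ξ)) * (Real.sqrt (B + C₃) * (n : ℝ) ^ (1 / 2 : ℝ)) :=
          mul_le_mul (hSn n) (hNn n) (norm_nonneg _) (by positivity)
        _ = (KS * Real.sqrt (B + C₃)) * ((n : ℝ) ^ (1 - ξ) * (n : ℝ) ^ (1 / 2 : ℝ)) := by ring
        _ = (KS * Real.sqrt (B + C₃)) * (n : ℝ) ^ (3 / 2 - ξ) := by
          rw [← Real.rpow_add hn0]; congr 2; ring
        _ ≤ _ := by gcongr
    linarith
  have b4 : ‖N n‖ ^ 2 ≤ n * B + C₃ * (1 / (1 - ξ / 2)) * (n : ℝ) ^ E := by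
    refine (hr.norm_sum_noise_sq_le' hξ0 hξ1 hC₃ n).trans ?_
    have h1 : (n : ℝ) ^ (1 - ξ / 2) ≤ (n : ℝ) ^ E := hpow (by linarith)
    have h2 : 0 < 1 - ξ / 2 := by linarith
    have h3 : C₃ * (1 / (1 - ξ / 2) * (n : ℝ) ^ (1 - ξ / 2))
        ≤ C₃ * (1 / (1 - ξ / 2) * (n : ℝ) ^ E) := by gcongr
    linarith
  linarith

end LinearRecursion

end Averaging

/-! ### Averaged iterates. -/

section Averaged

variable {d : ℕ} {Ω₀ : Type*} [MeasurableSpace Ω₀] {M : Model d Ω₀} {Ω : Type*}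
  {X : ℕ → Ω → Vec d} {Y : ℕ → Ω → ℝ} [MeasurableSpace Ω] {Q : Measure Ω}

theorem norm_toLp_sq {Z : Ω → Vec d} (h : MemLp Z 2 Q) :
    ‖h.toLp Z‖ ^ 2 = ∫ ω, ‖Z ω‖ ^ 2 ∂Q := by
  rw [← real_inner_self_eq_norm_sq, L2.inner_def]
  refine integral_congr_ae ?_
  filter_upwards [h.coeFn_toLp] with ω hω
  rw [hω, real_inner_self_eq_norm_sq]

theorem inner_toLp {Z W : Ω → Vec d} (h : MemLp Z 2 Q) (h' : MemLp W 2 Q) :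
    inner ℝ (h.toLp Z) (h'.toLp W) = ∫ ω, inner ℝ (Z ω) (W ω) ∂Q := by
  rw [L2.inner_def]
  refine integral_congr_ae ?_
  filter_upwards [h.coeFn_toLp, h'.coeFn_toLp] with ω hω hω'
  rw [hω, hω']

variable [IsProbabilityMeasure Q]

/-- Between radii `Δ` and `D` linear growth implies quadratic growth with a constant smaller by the
factor `r / D ≤ 1`, so the ball can be enlarged. -/
theorem Model.Assumptions.exists_growth_of_le (hM : M.Assumptions) (hd : 0 < d) {D : ℝ}
    (hD : M.Δ ≤ D) : ∃ m b : ℝ, 0 < m ∧ 0 < b ∧ M.Growth D m b := by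
  have hΔ := hM.Δ_pos hd
  have hμ := hM.μ_pos
  have hD0 : 0 < D := hΔ.trans_le hD
  have hG := hM.growth hd (hM.exists_tailConst hd)
  refine ⟨min M.μ (M.μ * M.Δ / D), M.μ * M.Δ, lt_min hμ (by positivity), by positivity,
    ⟨fun θ hθ => ?_, fun θ hθ => hG.outside θ (hD.trans_lt hθ)⟩⟩
  rcases le_or_gt ‖θ - M.θstar‖ M.Δ with h | h
  · refine le_trans ?_ (hG.inside θ h)
    gcongr
    exact min_le_left _ _
  · refine le_trans ?_ (hG.outside θ h)
    have h1 : M.μ * M.Δ / D * ‖θ - M.θstar‖ ≤ M.μ * M.Δ := by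
      rw [div_mul_eq_mul_div, div_le_iff₀ hD0]
      gcongr
    have h2 : min M.μ (M.μ * M.Δ / D) ≤ M.μ * M.Δ / D := min_le_right _ _
    calc _ ≤ M.μ * M.Δ / D * ‖θ - M.θstar‖ ^ 2 := by gcongr
      _ = M.μ * M.Δ / D * ‖θ - M.θstar‖ * ‖θ - M.θstar‖ := by ring
      _ ≤ _ := by gcongr

theorem Model.Assumptions.exists_fourth_moment (hM : M.Assumptions) (hd : 0 < d)
    (hXY : M.IsSample Q X Y) {ξ ι : ℝ} (hξ : 0 < ξ) (hξ1 : ξ < 1) (hι : 0 < ι) (θ₀ : Vec d) :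
    ∃ C : ℝ, 0 ≤ C ∧ ∀ n : ℕ, MeanLE Q
      (fun ω => ‖iter M.l (fun k => ι / ((k : ℝ) + 1) ^ ξ) X Y θ₀ n ω - M.θstar‖ ^ 4)
      (C * ((n : ℝ) + 1) ^ (-(2 * ξ))) := by
  have hσ := hM.data.σx_pos
  have hal := hM.loss.al_pos
  -- The first stepsizes need not be small. The radius is enlarged instead, until every stepsize
  -- satisfies `al * α ≤ D / (4 * σx)`; the crude step then carries finiteness to the time from
  -- which the contraction with `p = 1` holds.
  set D := max M.Δ (4 * M.al * M.σx * ι) with hDdef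
  have hD : 0 < D := lt_max_of_lt_left (hM.Δ_pos hd)
  obtain ⟨m, b, hm, hb, hG⟩ := hM.exists_growth_of_le hd (le_max_left M.Δ (4 * M.al * M.σx * ι))
  rw [← hDdef] at hG
  set ρ := min (b / (2 * D)) (m * (1 + (1 : ℕ))) with hρdef
  have hρ : 0 < ρ := lt_min (by positivity) (by positivity)
  obtain ⟨c, α₀, hc, hα₀, hdrift⟩ := hM.exists_drift hD hm hb hG 1 hρ.le (min_le_left _ _)
    (min_le_right _ _)
  obtain ⟨A, hA, hcrude⟩ := hM.exists_crude_step hD hm hb hG 2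
  set α : ℕ → ℝ := fun k => ι / ((k : ℝ) + 1) ^ ξ with hα
  have hα_pos : ∀ k, 0 < α k := fun k => by simp only [hα]; positivity
  have hα_eq : ∀ k : ℕ, α k = ι * ((k : ℝ) + 1) ^ (-ξ) := fun k => by
    simp only [hα]; rw [Real.rpow_neg (by positivity)]; ring
  have hα_le : ∀ k, M.al * α k ≤ D / (4 * M.σx) := fun k => by
    rw [le_div_iff₀ (by positivity)]
    have h1 : α k ≤ ι := by
      simp only [hα]
      exact div_le_self hι.le (Real.one_le_rpow (by linarith [(k.cast_nonneg : (0 : ℝ) ≤ k)]) hξ.le)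
    calc M.al * α k * (4 * M.σx) ≤ M.al * ι * (4 * M.σx) := by gcongr
      _ = 4 * M.al * M.σx * ι := by ring
      _ ≤ D := le_max_right _ _
  have hint : ∀ n, ∃ e, MeanLE Q (fun ω => lyap D 2 ‖iter M.l α X Y θ₀ n ω - M.θstar‖) e := by
    intro n
    induction n with
    | zero => exact ⟨_, meanLE_const (lyap D 2 ‖θ₀ - M.θstar‖)⟩
    | succ n ih =>
      obtain ⟨e, he⟩ := ih
      exact ⟨_, hM.meanLE_lyap_succ hXY hD 2 (α := α) (A := A) (B := A) hA
        (fun θ => hcrude θ (α n) (hα_pos n) (hα_le n)) he⟩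
  set u : ℕ → ℝ := fun n => ∫ ω, lyap D 2 ‖iter M.l α X Y θ₀ n ω - M.θstar‖ ∂Q with hu
  have hmean : ∀ n, MeanLE Q (fun ω => lyap D 2 ‖iter M.l α X Y θ₀ n ω - M.θstar‖) (u n) :=
    fun n => ⟨(hint n).choose_spec.1, le_rfl⟩
  have t1 := (tendsto_add_one_rpow_neg hξ).const_mul ι
  rw [mul_zero] at t1
  obtain ⟨N, hN⟩ := Filter.eventually_atTop.1
    (t1.eventually (ge_mem_nhds (lt_min hα₀ (by positivity : 0 < 1 / ρ))))
  obtain ⟨C, hC, hCb⟩ := exists_decay_bound (u := u) (m := ι * ρ) (c := ι ^ 3 * c) (ξ := ξ)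
    (q := 2 * ξ) (by positivity) hξ hξ1 (by positivity) (N := N) (fun n hn => by
      have h1 := hN n hn
      rw [← hα_eq] at h1
      have h2 : α n ≤ α₀ := h1.trans (min_le_left _ _)
      have h3 : α n * ρ ≤ 1 := by
        have := h1.trans (min_le_right _ _)
        rwa [le_div_iff₀ hρ] at this
      have h4 := (hM.meanLE_lyap_succ hXY hD 2 (α := α) (A := 1 - α n * ρ)
        (B := α n ^ (1 + 2) * c) (sub_nonneg.2 h3)
        (fun θ => hdrift θ (α n) (hα_pos n) h2) (hmean n)).2
      refine h4.trans (le_of_eq ?_)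
      have hn0 : (0 : ℝ) < (n : ℝ) + 1 := by positivity
      have e : α n ^ (1 + 2) = ι ^ 3 * ((n : ℝ) + 1) ^ (-ξ - 2 * ξ) := by
        rw [hα_eq, mul_pow, ← Real.rpow_mul_natCast hn0.le]
        congr 2; push_cast; ring
      rw [e, hα_eq]
      ring)
  refine ⟨2 * D ^ 2 / Real.exp 1 * C, by positivity, fun n => ?_⟩
  refine (hM.meanLE_norm_pow hXY hD 2 ((hmean n).congr_bound (hCb n))).congr_bound (le_of_eq ?_)
  ring

/-- Martingale-difference property: given the past, the gradient noise has mean zero. -/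
theorem Model.Assumptions.integral_inner_err_eq_zero (hM : M.Assumptions) (hXY : M.IsSample Q X Y)
    {n : ℕ} {θ Z : Ω → Vec d} (hθ : Past (sample X Y) n θ) (hZ : Past (sample X Y) n Z)
    (hI : Integrable (fun ω => inner ℝ (M.err (θ ω) (sample X Y n ω)) (Z ω)) Q) :
    ∫ ω, inner ℝ (M.err (θ ω) (sample X Y n ω)) (Z ω) ∂Q = 0 := by
  have herr := hM.continuous_err
  have hf : Measurable fun q : (Vec d × Vec d) × (Vec d × ℝ) => inner ℝ (M.err q.1.1 q.2) q.1.2 :=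
    ((herr.comp ((continuous_fst.comp continuous_fst).prodMk continuous_snd)).inner
      (continuous_snd.comp continuous_fst)).measurable
  have key := (hθ.prodMk hZ).integral_eq hXY.ident hXY.indep hf hI
  refine key.trans ?_
  rw [← integral_zero Ω ℝ (μ := Q)]
  congr 1; ext ω
  have h1 := integral_inner (𝕜 := ℝ) (hM.integrable_err (θ ω)) (Z ω)
  rw [hM.integral_err, inner_zero_right] at h1
  rw [← h1]
  congr 1; ext ω'
  exact real_inner_comm _ _

theorem Model.Assumptions.averaged_iterates (hM : M.Assumptions) (hd : 0 < d)
    (hXY : M.IsSample Q X Y) (hdiff : Differentiable ℝ (deriv M.l))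
    (hK : ∃ K : ℝ, ∀ u : ℝ, |M.meanDeriv2 u - M.meanDeriv2 0| ≤ K * |u|) {ξ : ℝ}
    (hξ : 1 / 2 ≤ ξ) (hξ1 : ξ < 1) {ι : ℝ} (hι : 0 < ι) (θ₀ : Vec d) :
    ∃ C : ℝ, ∀ n : ℕ, 1 ≤ n → MeanLE Q
      (fun ω => ‖avg M.l (fun k => ι / ((k : ℝ) + 1) ^ ξ) X Y θ₀ n ω - M.θstar‖ ^ 2)
      (d * M.meanSqDeriv / (n * M.meanDeriv2 0 ^ 2)
        + C / (n : ℝ) ^ min (ξ + 1 / 2) (2 - ξ)) := by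
  have hξ0 : 0 < ξ := by linarith
  obtain ⟨K, hK⟩ := hK
  have hh := hM.meanDeriv2_pos hdiff
  set h := M.meanDeriv2 0 with hhdef
  obtain ⟨C₄, hC₄, hmom⟩ := hM.exists_fourth_moment hd hXY hξ0 hξ1 hι θ₀
  obtain ⟨CR, hCR, hrem⟩ := hM.exists_grad_remainder hdiff hK
  obtain ⟨CW, hCW, hnoise⟩ := hM.exists_meanLE_err_sq
  set α : ℕ → ℝ := fun k => ι / ((k : ℝ) + 1) ^ ξ with hα
  set th : ℕ → Ω → Vec d := fun n => iter M.l α X Y θ₀ n with hth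
  have hpast : ∀ n, Past (sample X Y) n (th n) := fun n => hM.past_iter α θ₀ n
  have hsm : ∀ i, AEMeasurable (sample X Y i) Q := fun i => (hXY.ident i).aemeasurable_fst
  set v : ℕ → Ω → Vec d := fun n ω => th n ω - M.θstar with hv
  set R : ℕ → Ω → Vec d := fun n ω => M.grad (th n ω) - h • v n ω with hR
  set w : ℕ → Ω → Vec d := fun n ω => M.err (th n ω) (sample X Y n ω) with hw
  have hpv : ∀ n, Past (sample X Y) n (v n) := fun n =>
    (hpast n).comp (measurable_id.sub_const M.θstar)
  have hpR : ∀ n, Past (sample X Y) n (R n) := fun n =>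
    (hpast n).comp (φ := fun θ => M.grad θ - h • (θ - M.θstar))
      (hM.continuous_grad.sub (by fun_prop)).measurable
  have hpw : ∀ n, Past (sample X Y) (n + 1) (w n) := fun n =>
    (((hpast n).mono n.le_succ).prodMk (past_sample (sample X Y) n.lt_succ_self)).comp
      (φ := fun q => M.err q.1 q.2) hM.continuous_err.measurable
  have hmv := fun n => ((hpv n).aemeasurable hsm).aestronglyMeasurable
  have hmR := fun n => ((hpR n).aemeasurable hsm).aestronglyMeasurable
  have hmw := fun n => ((hpw n).aemeasurable hsm).aestronglyMeasurable
  have hI4 : ∀ n, Integrable (fun ω => ‖v n ω‖ ^ 4) Q := fun n => (hmom n).1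
  have hI2 : ∀ n, Integrable (fun ω => ‖v n ω‖ ^ 2) Q := fun n => by
    refine ((integrable_const (1 : ℝ)).add (hI4 n)).mono' ((hmv n).norm.pow 2)
      (Filter.Eventually.of_forall fun ω => ?_)
    rw [Real.norm_of_nonneg (by positivity)]
    simp only [Pi.add_apply]
    nlinarith [sq_nonneg (‖v n ω‖ ^ 2 - 1)]
  have hI1 : ∀ n, Integrable (fun ω => ‖v n ω‖) Q := fun n => by
    refine ((integrable_const (1 : ℝ)).add (hI2 n)).mono' (hmv n).norm
      (Filter.Eventually.of_forall fun ω => ?_)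
    rw [Real.norm_of_nonneg (by positivity)]
    simp only [Pi.add_apply]
    nlinarith [sq_nonneg (‖v n ω‖ - 1)]
  have hsq : ∀ Z : Ω → ℝ, Integrable Z Q → Integrable (fun ω => Z ω ^ 2) Q →
      (∫ ω, Z ω ∂Q) ^ 2 ≤ ∫ ω, Z ω ^ 2 ∂Q := fun Z h1 h2 => by
    set a := ∫ ω, Z ω ∂Q with ha
    have h3 : 0 ≤ ∫ ω, (Z ω - a) ^ 2 ∂Q := integral_nonneg fun ω => sq_nonneg _
    have e : ∀ ω, (Z ω - a) ^ 2 = Z ω ^ 2 - 2 * a * Z ω + a ^ 2 := fun ω => by ring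
    have h4 : Integrable (fun ω => Z ω ^ 2 - 2 * a * Z ω) Q := h2.sub (h1.const_mul _)
    simp only [e] at h3
    rw [integral_add h4 (integrable_const _), integral_sub h2 (h1.const_mul _),
      integral_const_mul, ← ha] at h3
    simp at h3
    nlinarith
  set C₁ := Real.sqrt (Real.sqrt C₄) with hC₁
  have hm2 : ∀ n : ℕ, ∫ ω, ‖v n ω‖ ^ 2 ∂Q ≤ Real.sqrt C₄ * ((n : ℝ) + 1) ^ (-ξ) := fun n => by
    have hn0 : (0 : ℝ) < (n : ℝ) + 1 := by positivity
    refine abs_le_of_sq_le_sq' ?_ (by positivity) |>.2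
    have h1 := hsq (fun ω => ‖v n ω‖ ^ 2) (hI2 n) (by simpa [← pow_mul] using hI4 n)
    refine h1.trans ?_
    simp only [← pow_mul]
    refine (hmom n).2.trans (le_of_eq ?_)
    rw [mul_pow, Real.sq_sqrt hC₄, ← Real.rpow_mul_natCast hn0.le]
    congr 2; push_cast; ring
  have hm1 : ∀ n : ℕ, ∫ ω, ‖v n ω‖ ∂Q ≤ C₁ * ((n : ℝ) + 1) ^ (-(ξ / 2)) := fun n => by
    have hn0 : (0 : ℝ) < (n : ℝ) + 1 := by positivity
    refine abs_le_of_sq_le_sq' ?_ (by positivity) |>.2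
    refine ((hsq _ (hI1 n) (hI2 n)).trans (hm2 n)).trans (le_of_eq ?_)
    rw [mul_pow, hC₁, Real.sq_sqrt (Real.sqrt_nonneg _), ← Real.rpow_mul_natCast hn0.le]
    congr 2; push_cast; ring
  have hRle : ∀ n ω, ‖R n ω‖ ^ 2 ≤ CR ^ 2 * ‖v n ω‖ ^ 4 := fun n ω => by
    calc ‖R n ω‖ ^ 2 ≤ (CR * ‖v n ω‖ ^ 2) ^ 2 := by gcongr; exact hrem (th n ω)
      _ = _ := by ring
  have hIR : ∀ n, Integrable (fun ω => ‖R n ω‖ ^ 2) Q := fun n =>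
    ((hI4 n).const_mul (CR ^ 2)).mono' ((hmR n).norm.pow 2)
      (Filter.Eventually.of_forall fun ω => by
        rw [Real.norm_of_nonneg (by positivity)]; exact hRle n ω)
  have hBnn : 0 ≤ (d : ℝ) * M.meanSqDeriv :=
    mul_nonneg d.cast_nonneg (integral_nonneg fun ω => sq_nonneg _)
  have hWm : ∀ n, MeanLE Q (fun ω => ‖w n ω‖ ^ 2)
      (d * M.meanSqDeriv + CW * C₁ * ((n : ℝ) + 1) ^ (-(ξ / 2))) := fun n => by
    have hBI : Integrable (fun ω => d * M.meanSqDeriv + CW * ‖v n ω‖) Q :=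
      (integrable_const _).add ((hI1 n).const_mul _)
    have h1 := (hpast n).meanLE hXY.ident hXY.indep (f := fun q => ‖M.err q.1 q.2‖ ^ 2)
      (B := fun θ => d * M.meanSqDeriv + CW * ‖θ - M.θstar‖)
      (hM.continuous_err.norm.pow 2).measurable (fun q => by positivity)
      (by fun_prop : Continuous _).measurable hnoise hBI
    refine ⟨h1.1, h1.2.trans ?_⟩
    have e : ∫ ω, (d * M.meanSqDeriv + CW * ‖v n ω‖) ∂Q
        = d * M.meanSqDeriv + CW * ∫ ω, ‖v n ω‖ ∂Q := by
      rw [integral_add (integrable_const _) ((hI1 n).const_mul _), integral_const_mul CW]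
      simp
    have := mul_le_mul_of_nonneg_left (hm1 n) hCW
    linarith
  have hLv : ∀ n, MemLp (v n) 2 Q := fun n => (memLp_two_iff_integrable_sq_norm (hmv n)).2 (hI2 n)
  have hLR : ∀ n, MemLp (R n) 2 Q := fun n => (memLp_two_iff_integrable_sq_norm (hmR n)).2 (hIR n)
  have hLw : ∀ n, MemLp (w n) 2 Q := fun n => (memLp_two_iff_integrable_sq_norm (hmw n)).2 (hWm n).1
  have horth : ∀ (n : ℕ) (Z : Ω → Vec d) (hZ : MemLp Z 2 Q), Past (sample X Y) n Z →
      inner ℝ ((hLw n).toLp (w n)) (hZ.toLp Z) = 0 := fun n Z hZ hp => by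
    rw [inner_toLp]
    refine hM.integral_inner_err_eq_zero hXY (hpast n) hp ?_
    refine (L2.integrable_inner (𝕜 := ℝ) ((hLw n).toLp (w n)) (hZ.toLp Z)).congr ?_
    filter_upwards [(hLw n).coeFn_toLp, hZ.coeFn_toLp] with ω h1 h2
    rw [h1, h2]
  -- In `L²` the norm of the quadratic remainder is the root of a fourth moment of `v`, which is why
  -- fourth moments are needed; the orthogonality relations are the martingale-difference property.
  have hrec : LinearRecursion (fun n => (hLv n).toLp (v n)) (fun n => (hLw n).toLp (w n))
      (fun n => (hLR n).toLp (R n)) h ι ξ (d * M.meanSqDeriv) C₁ (CR * Real.sqrt C₄)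
      (CW * C₁) := by
    refine ⟨fun n => ?_, fun n => ?_, fun n => ?_, fun n => ?_, fun n k hk => ?_, fun n k hk => ?_,
      fun n => ?_⟩
    · have e : v (n + 1) = v n - (ι / ((n : ℝ) + 1) ^ ξ) • (h • v n + R n + w n) := by
        ext1 ω
        simp only [hv, hR, hw, hth, M.iter_succ, Pi.sub_apply, Pi.smul_apply, Pi.add_apply,
          Model.err, hα]
        module
      rw [← MemLp.toLp_const_smul, ← MemLp.toLp_add, ← MemLp.toLp_add, ← MemLp.toLp_const_smul,
        ← MemLp.toLp_sub]
      exact MemLp.toLp_congr _ _ (Filter.Eventually.of_forall fun ω => congrFun e ω)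
    · have hn0 : (0 : ℝ) < (n : ℝ) + 1 := by positivity
      refine abs_le_of_sq_le_sq' ?_ (by positivity) |>.2
      rw [norm_toLp_sq]
      refine (hm2 n).trans (le_of_eq ?_)
      rw [mul_pow, hC₁, Real.sq_sqrt (Real.sqrt_nonneg _), ← Real.rpow_mul_natCast hn0.le]
      congr 2; push_cast; ring
    · have hn0 : (0 : ℝ) < (n : ℝ) + 1 := by positivity
      refine abs_le_of_sq_le_sq' ?_ (by positivity) |>.2
      rw [norm_toLp_sq]
      refine (integral_mono (hIR n) ((hI4 n).const_mul (CR ^ 2)) (hRle n)).trans ?_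
      rw [integral_const_mul]
      refine (mul_le_mul_of_nonneg_left (hmom n).2 (sq_nonneg CR)).trans (le_of_eq ?_)
      rw [mul_pow, mul_pow, Real.sq_sqrt hC₄, ← Real.rpow_mul_natCast hn0.le, mul_assoc]
      congr 3; push_cast; ring
    · rw [norm_toLp_sq]
      exact (hWm n).2
    · exact horth n (v k) (hLv k) ((hpv k).mono hk)
    · exact horth n (w k) (hLw k) ((hpw k).mono hk)
    · exact horth n (R n) (hLR n) (hpR n)
  obtain ⟨C, hC, hsum⟩ := hrec.exists_sum_bound hh hι hξ hξ1 hBnn (by positivity) (by positivity)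
    (by positivity)
  refine ⟨C / h ^ 2, fun n hn => ?_⟩
  have hn0 : (0 : ℝ) < n := by exact_mod_cast hn
  have hLs : MemLp (fun ω => ∑ k ∈ Finset.range n, v k ω) 2 Q :=
    memLp_finsetSum _ fun k _ => hLv k
  have hsumeq : ∑ k ∈ Finset.range n, (hLv k).toLp (v k) = hLs.toLp _ := by
    refine Lp.ext ?_
    refine (Lp.coeFn_finsetSum _ _).trans ?_
    refine Filter.EventuallyEq.trans ?_ hLs.coeFn_toLp.symm
    have : ∀ᵐ ω ∂Q, ∀ k, ((hLv k).toLp (v k)) ω = v k ω :=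
      ae_all_iff.2 fun k => (hLv k).coeFn_toLp
    filter_upwards [this] with ω hω
    simp [hω]
  have havg : ∀ ω, ‖avg M.l α X Y θ₀ n ω - M.θstar‖ ^ 2
      = (1 / (n : ℝ)) ^ 2 * ‖∑ k ∈ Finset.range n, v k ω‖ ^ 2 := fun ω => by
    have e : avg M.l α X Y θ₀ n ω - M.θstar = (1 / (n : ℝ)) • ∑ k ∈ Finset.range n, v k ω := by
      simp only [hv, hth, Finset.sum_sub_distrib, Finset.sum_const, Finset.card_range, smul_sub, avg]
      rw [← Nat.cast_smul_eq_nsmul ℝ, smul_smul, one_div_mul_cancel hn0.ne', one_smul]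
    rw [e, norm_smul, mul_pow, Real.norm_of_nonneg (by positivity)]
  have hsn := hsum n hn
  rw [hsumeq, norm_toLp_sq] at hsn
  simp only [MeanLE, havg]
  refine ⟨((memLp_two_iff_integrable_sq_norm hLs.1).1 hLs).const_mul _, ?_⟩
  rw [integral_const_mul]
  set I := ∫ ω, ‖∑ k ∈ Finset.range n, v k ω‖ ^ 2 ∂Q
  have hpow : (n : ℝ) ^ (2 - min (ξ + 1 / 2) (2 - ξ))
      = (n : ℝ) ^ 2 / (n : ℝ) ^ min (ξ + 1 / 2) (2 - ξ) := by
    rw [Real.rpow_sub hn0, Real.rpow_two]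
  rw [hpow] at hsn
  have h2 : I ≤ (n * (d * M.meanSqDeriv)
      + C * ((n : ℝ) ^ 2 / (n : ℝ) ^ min (ξ + 1 / 2) (2 - ξ))) / h ^ 2 := by
    rw [le_div_iff₀ (by positivity)]; linarith
  refine (mul_le_mul_of_nonneg_left h2 (by positivity)).trans (le_of_eq ?_)
  have : 0 < (n : ℝ) ^ min (ξ + 1 / 2) (2 - ξ) := by positivity
  field_simp

end Averaged

end RobustReg

theorem mainTheorem9 {d : ℕ} (hd : 0 < d)
    {Ω₀ : Type*} [MeasurableSpace Ω₀] (M : RobustReg.Model d Ω₀) (hM : M.Assumptions)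
    {Ω : Type*} [MeasurableSpace Ω] (Q : Measure Ω) [IsProbabilityMeasure Q]
    (X : ℕ → Ω → RobustReg.Vec d) (Y : ℕ → Ω → ℝ) (hXY : M.IsSample Q X Y) :
    -- a linear growth constant exists, and every such constant is admissible below
    (∃ b : ℝ, 0 < b ∧ M.TailConst b) ∧
    (∀ b : ℝ, 0 < b → M.TailConst b →
      -- size of the rates
      (∀ p : ℕ, 0 < M.rate b p ∧ M.rate b p ≤ M.μl * (1 - M.outlier) * (1 + p)) ∧
      -- (1) constant stepsize, higher moments
      (∀ p : ℕ, ∃ αp : ℝ, 0 < αp ∧ ∃ D : ℝ, ∀ α : ℝ, 0 < α → α ≤ αp →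
        ∀ (θ₀ : RobustReg.Vec d) (n : ℕ), -(p : ℝ) * Real.log α / (α * M.rate b 0) ≤ n →
          RobustReg.MeanLE Q
            (fun ω => ‖RobustReg.iter M.l (fun _ => α) X Y θ₀ n ω - M.θstar‖ ^ (2 * p + 2))
            (2 * M.Δ ^ 2 * M.V (2 * p) θ₀ / Real.exp 1 * (1 - α * M.rate b p) ^ n
              + α ^ (p + 1) * D)) ∧
      -- the drift constant in (2) and (3)
      (∃ c α₀ : ℝ, 0 < α₀ ∧ M.Drift b c α₀) ∧
      (∀ c α₀ : ℝ, 0 < α₀ → M.Drift b c α₀ →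
        -- (2) stepsize `ι / (n + κ)`
        (∀ ι : ℝ, 1 / M.rate b 0 < ι → ∃ κι : ℝ, 0 < κι ∧ ∀ κ : ℝ, κι ≤ κ →
          ∀ (θ₀ : RobustReg.Vec d) (n : ℕ),
            RobustReg.MeanLE Q
              (fun ω => ‖RobustReg.iter M.l (fun k => ι / ((k : ℝ) + κ)) X Y θ₀ n ω
                - M.θstar‖ ^ 2)
              (2 * M.Δ ^ 2 * M.V 0 θ₀ / Real.exp 1 * (κ / (n + κ)) ^ (ι * M.rate b 0)
                + 8 * Real.exp 1 * ι ^ 2 * M.Δ ^ 2 * c / ((ι * M.rate b 0 - 1) * Real.exp 1)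
                  * (1 / (n + κ)))) ∧
        -- (3) stepsize `ι / (n + κ)^ξ`
        (∀ ξ : ℝ, 0 < ξ → ξ < 1 → ∀ ι : ℝ, 0 < ι → ∃ κι : ℝ, 0 < κι ∧ ∀ κ : ℝ, κι ≤ κ →
          ∀ (θ₀ : RobustReg.Vec d) (n : ℕ),
            RobustReg.MeanLE Q
              (fun ω => ‖RobustReg.iter M.l (fun k => ι / ((k : ℝ) + κ) ^ ξ) X Y θ₀ n ω
                - M.θstar‖ ^ 2)
              (2 * M.Δ ^ 2 * M.V 0 θ₀ / Real.exp 1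
                  * Real.exp (-(M.rate b 0 * ι / (1 - ξ)
                      * (((n : ℝ) + κ) ^ (1 - ξ) - κ ^ (1 - ξ))))
                + 4 * ι * M.Δ ^ 2 * c / (M.rate b 0 * Real.exp 1) * (1 / ((n : ℝ) + κ) ^ ξ))))) ∧
    -- (4) averaged iterates: the `k`-th update, `k = 1, 2, …`, has stepsize `ι / k^ξ`
    (Differentiable ℝ (deriv M.l) →
      (∃ K : ℝ, ∀ u : ℝ, |M.meanDeriv2 u - M.meanDeriv2 0| ≤ K * |u|) →
      0 < M.meanDeriv2 0 ∧
      (∀ n : ℕ, 1 ≤ n → M.crlb n = d * M.meanSqDeriv / (n * M.meanDeriv2 0 ^ 2)) ∧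
      ∀ ξ : ℝ, 1 / 2 ≤ ξ → ξ < 1 → ∀ ι : ℝ, 0 < ι → ∀ θ₀ : RobustReg.Vec d,
        ∃ C : ℝ, ∀ n : ℕ, 1 ≤ n →
          RobustReg.MeanLE Q
            (fun ω => ‖RobustReg.avg M.l (fun k => ι / ((k : ℝ) + 1) ^ ξ) X Y θ₀ n ω
              - M.θstar‖ ^ 2)
            (d * M.meanSqDeriv / (n * M.meanDeriv2 0 ^ 2)
              + C / (n : ℝ) ^ min (ξ + 1 / 2) (2 - ξ))) := by
  refine ⟨⟨M.μ * M.Δ, mul_pos hM.μ_pos (hM.Δ_pos hd), hM.exists_tailConst hd⟩,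
    fun b hb hT => ⟨fun p => ⟨hM.rate_pos hd hb p, hM.rate_le b p⟩,
      fun p => ?_, hM.exists_Drift hd hb hT,
      fun c α₀ hα₀ hD => ⟨fun ι hι => hM.harmonic_stepsize hd hXY hb hα₀ hD hι,
        fun ξ hξ hξ1 ι hι => hM.polynomial_stepsize hd hXY hb hα₀ hD hξ hξ1 hι⟩⟩,
    fun hdiff hK => ⟨hM.meanDeriv2_pos hdiff, fun n _ => hM.crlb_eq hdiff hK n,
      fun ξ hξ hξ1 ι hι θ₀ => hM.averaged_iterates hd hXY hdiff hK hξ hξ1 hι θ₀⟩⟩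
  obtain ⟨αp, hαp, D, hD⟩ := hM.constant_stepsize hd hXY hb hT p
  exact ⟨αp, hαp, D, fun α h0 h1 θ₀ n _ => hD α h0 h1 θ₀ n⟩
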